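/- Let $V$ be a smooth real vector bundle of rank $n$ over a smooth $m$-manifold $M$ ($m,n\ge 0$), and let $\mathcal{SM}=\Pi V=(M,\Lambda V^*)$ be the associated smooth (split) supermanifold of dimension $(m|n)$. A chart of $M$ and a trivialization of $V$ give local coordinates $x^1,\dots,x^m$ (even) and $\theta^1,\dots,\theta^n$ (odd); two such coordinate systems are related by $x'=\varphi(x)$, $\theta'^\alpha=\sum_\beta\chi^\alpha_\beta(x)\theta^\beta$. *Superforms.* $\Omega^p$ is the space of global superforms of degree $p\in\mathbb Z$, locally $\sum g_{S,I,\kappa}(x)\,\theta^S dx^I(d\theta)^\kappa$ with $|I|+|\kappa|=p$, where $dx^i$ is odd and $d\theta^\alpha$ is even, and $d=\sum_i dx^i\partial_{x^i}+\sum_\alpha d\theta^\alpha\partial_{\theta^\alpha}$. *Integral forms.* $\Sigma^p=\Gamma(\mathcal{B}er\otimes S^{m-p}\Pi\mathcal T)$, locally $\sum g_{S,I,\kappa}(x)\,\theta^S\mathcal D\otimes(\pi\partial_x)^I(\pi\partial_\theta)^\kappa$ with $|I|+|\kappa|=m-p$, where $\pi\partial_{x^i}$ is odd, $\pi\partial_{\theta^\alpha}$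 is even, and $\mathcal D=[dx^1\cdots dx^m\otimes\partial_{\theta^1}\cdots\partial_{\theta^n}]$ has parity $n$; under a change of coordinates $\mathcal D'=\det(\partial\varphi)\det(\chi)^{-1}\mathcal D$. The differential is $\delta=\sum_i\mathcal L_{\partial_{x^i}}\otimes\frac{\partial}{\partial(\pi\partial_{x^i})}-\sum_\alpha\mathcal L_{\partial_{\theta^\alpha}}\otimes\frac{\partial}{\partial(\pi\partial_{\theta^\alpha})}$ with the Koszul sign rule, i.e. $$\delta(g\,\mathcal D\otimes P)=(-1)^{|g|+n}\sum_i\partial_{x^i}g\,\mathcal D\otimes\frac{\partial P}{\partial(\pi\partial_{x^i})}-\sum_\alpha\partial_{\theta^\alpha}g\,\mathcal D\otimes\frac{\partial P}{\partial(\pi\partial_{\theta^\alpha})}.$$ *The PCO map.* $f^{(p)}:\Omega^p\to\Sigma^p$ is given in every such coordinate system by $$\sum_I g_I(x)\,dx^I+\eta\ \mapsto\ \sum_I g_I(x)\,\theta^1\cdots\theta^n\,\mathcal D\otimes\bigl(dx^I\cdot(\pi\partial_{x^m}\wedge\dots\wedge\pi\partial_{x^1})\bigr),$$ where every term of $\eta$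 contains some $\theta$ or $d\theta$, and $dx^{i_1}\cdots dx^{i_p}$ acts as $\frac{\partial}{\partial(\pi\partial_{x^{i_1}})}\circ\dots\circ\frac{\partial}{\partial(\pi\partial_{x^{i_p}})}$. *The map $Z$.* $Z^{(m-k)}:\Sigma^{m-k}\to\Omega^{m-k}$ is given in every such coordinate system by $$\sum g_{i_1\dots i_k}(x,\theta)\,\mathcal D\otimes\pi\partial_{x^{i_1}}\wedge\dots\wedge\pi\partial_{x^{i_k}}+\eta\ \mapsto\ \sum g_{i_1\dots i_k,\mathrm{top}}(x)\,\iota_{\partial_{x^{i_1}}}\cdots\iota_{\partial_{x^{i_k}}}(dx^1\wedge\dots\wedge dx^m),$$ where every term of $\eta$ contains some $\pi\partial_\theta$, and $g_{\mathrm{top}}$ is the coefficient of $\theta^1\cdots\theta^n$ in $g$. Then $(\Omega^\bullet,d)$ and $(\Sigma^\bullet,\delta)$ are cochain complexes. Both $f$ and $Z$ are well-defined (independent of the coordinate system) cochain maps between them, and they vanish in degrees $p<0$ and $p>m$. For all $p\in\mathbb Z$, $$f^{(p)}\circ Z^{(p)}\circ f^{(p)}=f^{(p)}\ \text{ on }\Omega^p,\qquad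 Z^{(p)}\circ f^{(p)}\circ Z^{(p)}=Z^{(p)}\ \text{ on }\Sigma^p.$$ For all $p\in\mathbb Z$ the maps induced by $f^{(p)}$ and $Z^{(p)}$ between $H^p(\Omega^\bullet,d)$ and $H^p(\Sigma^\bullet,\delta)$ are mutually inverse isomorphisms; in particular $f$ and $Z$ are quasi-isomorphisms. -/

import Mathlib

open scoped Manifold ContDiff
open Bundle

noncomputable section

namespace PictureChanging

/-! ### Smooth coefficient functions on an open subset of `ℝ^m` -/

section Coefficients

variable {m : ℕ}

/-- The smooth real functions on the open set `U ⊆ ℝ^m`, encoded as functions on `ℝ^m` which are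
smooth on `U` and are given the value `0` outside `U` (so that two of them are equal
if and only if they agree on `U`). -/
def smoothFunctions (U : TopologicalSpace.Opens (EuclideanSpace ℝ (Fin m))) :
    Submodule ℝ (EuclideanSpace ℝ (Fin m) → ℝ) where
  carrier := {g | ContDiffOn ℝ ∞ g U ∧ ∀ x ∉ U, g x = 0}
  add_mem' := by
    rintro g h ⟨hg, hg0⟩ ⟨hh, hh0⟩
    exact ⟨hg.add hh, fun x hx => by simp [hg0 x hx, hh0 x hx]⟩
  zero_mem' := ⟨contDiffOn_const, fun _ _ => rfl⟩
  smul_mem' := by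
    rintro c g ⟨hg, hg0⟩
    exact ⟨contDiffOn_const.smul hg, fun x hx => by simp [hg0 x hx]⟩

variable {U : TopologicalSpace.Opens (EuclideanSpace ℝ (Fin m))}

theorem smoothFunctions.differentiableAt (g : smoothFunctions U) {x : EuclideanSpace ℝ (Fin m)}
    (hx : x ∈ U) : DifferentiableAt ℝ (g : EuclideanSpace ℝ (Fin m) → ℝ) x :=
  (g.2.1.contDiffAt (U.isOpen.mem_nhds hx)).differentiableAt (by simp)

open Classical in
/-- The partial derivative `∂/∂x^i` of smooth functions on `U`. -/
def partialDeriv (i : Fin m) : smoothFunctions U →ₗ[ℝ] smoothFunctions U where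
  toFun g :=
    ⟨fun x => if x ∈ U then
        fderiv ℝ (g : EuclideanSpace ℝ (Fin m) → ℝ) x (EuclideanSpace.single i 1) else 0, by
      refine ⟨?_, fun x hx => if_neg hx⟩
      have h : ContDiffOn ℝ ∞ (fderiv ℝ (g : EuclideanSpace ℝ (Fin m) → ℝ)) U :=
        g.2.1.fderiv_of_isOpen U.isOpen (by simp)
      exact (h.clm_apply contDiffOn_const).congr fun x hx => if_pos hx⟩
  map_add' g h := by
    ext x
    by_cases hx : x ∈ U
    · simp [hx, fderiv_add (smoothFunctions.differentiableAt g hx)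
        (smoothFunctions.differentiableAt h hx)]
    · simp [hx]
  map_smul' c g := by
    ext x
    by_cases hx : x ∈ U
    · simp [hx, fderiv_const_smul (smoothFunctions.differentiableAt g hx)]
    · simp [hx]

end Coefficients

/-! ### Forms on a coordinate superdomain

On a superdomain with even coordinates `x^1, …, x^m` (ranging over `U`) and odd coordinates
`θ^1, …, θ^n`, superforms and integral forms are both given by coefficient families
`c S I κ ∈ C^∞(U)`, with `S ⊆ {1, …, n}`, `I ⊆ {1, …, m}`, `κ ∈ ℕ^n`; increasing products are
meant in `θ^S = θ^{α_1} θ^{α_2} ⋯` and so on.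

* As a superform, `c` stands for `∑ c S I κ(x) θ^S dx^I (dθ)^κ`: the `dx^i` are odd, the `dθ^α` are
  even, and all generators supercommute.
* As an integral form, `c` stands for `∑ c S I κ(x) θ^S 𝒟 ⊗ (π∂_x)^I (π∂_θ)^κ`: the `π∂_{x^i}` are
  odd, the `π∂_{θ^α}` are even, and `𝒟 = [dx^1 ⋯ dx^m ⊗ ∂_{θ^1} ⋯ ∂_{θ^n}]` is the generator of the
  Berezinian, of parity `n`.  -/

section LocalForms

variable {m n : ℕ} {U : TopologicalSpace.Opens (EuclideanSpace ℝ (Fin m))}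

variable (n U) in
/-- Coefficient families of local superforms or integral forms over `U`. -/
abbrev LocalForm : Type :=
  Finset (Fin n) → Finset (Fin m) → (Fin n → ℕ) → smoothFunctions U

/-- `(-1)` to the number of elements of `A` that are smaller than `a`: the sign for moving an odd
operator with index `a` to its place in the increasing product over `A`. -/
def sgn {k : ℕ} (A : Finset (Fin k)) (a : Fin k) : ℝ :=
  (-1) ^ (A.filter (· < a)).card

/-- The de Rham differential `d = ∑ dx^i ∂/∂x^i + ∑ dθ^α ∂/∂θ^α` of local superforms. -/
def localD : LocalForm n U →ₗ[ℝ] LocalForm n U where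
  toFun w S I κ :=
    (∑ i ∈ I, ((-1) ^ S.card * sgn I i) • partialDeriv i (w S (I.erase i) κ)) +
    ∑ α ∈ Finset.univ.filter (fun α => α ∉ S ∧ κ α ≠ 0),
      sgn S α • w (insert α S) I (κ - Pi.single α 1)
  map_add' w η := by
    funext S I κ
    simp only [Pi.add_apply, map_add, smul_add, Finset.sum_add_distrib]
    abel
  map_smul' c w := by
    funext S I κ
    simp only [Pi.smul_apply, map_smul, smul_comm _ c, ← Finset.smul_sum, smul_add,
      RingHom.id_apply]

/-- The differential
`δ = ∑ ℒ_{∂_{x^i}} ⊗ ∂/∂(π∂_{x^i}) - ∑ ℒ_{∂_{θ^α}} ⊗ ∂/∂(π∂_{θ^α})` of local integral forms;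
the sign `(-1) ^ (|S| + n)` is the Koszul sign for moving the odd operator `∂/∂(π∂_{x^i})` past
`θ^S 𝒟`. -/
def localDelta : LocalForm n U →ₗ[ℝ] LocalForm n U where
  toFun σ S I κ :=
    (∑ i ∈ Iᶜ, ((-1) ^ (S.card + n) * sgn I i) • partialDeriv i (σ S (insert i I) κ)) -
    ∑ α ∈ Sᶜ, (sgn S α * (κ α + 1 : ℝ)) • σ (insert α S) I (κ + Pi.single α 1)
  map_add' σ τ := by
    funext S I κ
    simp only [Pi.add_apply, map_add, smul_add, Finset.sum_add_distrib]
    abel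
  map_smul' c σ := by
    funext S I κ
    simp only [Pi.smul_apply, map_smul, smul_comm _ c, ← Finset.smul_sum, smul_sub,
      RingHom.id_apply]

/-- On the exterior algebra on `m` odd generators `e_1, …, e_m` (the `dx^i` or the `π∂_{x^i}`),
with elements written as `∑ P J e^J`: the odd derivation that contracts with the `i`-th dual
generator, `e_i ↦ 1`, `e_j ↦ 0` for `j ≠ i`. -/
def contract (i : Fin m) (P : Finset (Fin m) → ℝ) : Finset (Fin m) → ℝ :=
  fun J => if i ∈ J then 0 else sgn J i * P (insert i J)

/-- The composition `contract i_1 ∘ ⋯ ∘ contract i_k` for `I = {i_1 < ⋯ < i_k}`. -/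
def contractAll (I : Finset (Fin m)) (P : Finset (Fin m) → ℝ) : Finset (Fin m) → ℝ :=
  (I.sort (· ≤ ·)).foldr contract P

/-- The increasing product `e_1 ∧ ⋯ ∧ e_m`. -/
def increasingTop : Finset (Fin m) → ℝ :=
  fun J => if J = Finset.univ then 1 else 0

/-- The decreasing product `e_m ∧ ⋯ ∧ e_1`. -/
def decreasingTop : Finset (Fin m) → ℝ :=
  fun J => (-1) ^ (m * (m - 1) / 2) * increasingTop J

/-- The local PCO map `f`: a superform `∑ g_I(x) dx^I + η`, where all the terms of `η` contain some
`θ` or `dθ`, is sent to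
`∑ g_I(x) θ^1 ⋯ θ^n 𝒟 ⊗ (dx^I · π∂_{x^m} ∧ ⋯ ∧ π∂_{x^1})`, where `dx^{i_1} ⋯ dx^{i_p}` acts
through the pairing `dx^i(π∂_{x^j}) = δ^i_j`, that is, as
`∂/∂(π∂_{x^{i_1}}) ∘ ⋯ ∘ ∂/∂(π∂_{x^{i_p}})`. It vanishes in degrees `p < 0` and `p > m`, where
there is no `I` with `p` elements. -/
def localPCO : LocalForm n U →ₗ[ℝ] LocalForm n U where
  toFun w S J κ :=
    if S = Finset.univ ∧ κ = 0 then ∑ I, contractAll I decreasingTop J • w ∅ I 0 else 0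
  map_add' w η := by
    funext S I κ
    by_cases h : S = Finset.univ ∧ κ = 0 <;> simp [h, Finset.sum_add_distrib]
  map_smul' c w := by
    funext S I κ
    by_cases h : S = Finset.univ ∧ κ = 0 <;> simp [h, Finset.smul_sum, smul_comm _ c]

/-- The local map `Z`: an integral form
`∑ g_I(x, θ) 𝒟 ⊗ π∂_{x^{i_1}} ∧ ⋯ ∧ π∂_{x^{i_k}} + η`, where all the terms of `η` contain some
`π∂_θ`, is sent to `∑ g_{I,top}(x) ι_{∂_{x^{i_1}}} ⋯ ι_{∂_{x^{i_k}}} (dx^1 ∧ ⋯ ∧ dx^m)`, where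
`g_top` is the coefficient of `θ^1 ⋯ θ^n` in `g`. It vanishes in degrees `m - k < 0` and
`m - k > m`, where there is no `I` with `k` elements. -/
def localZ : LocalForm n U →ₗ[ℝ] LocalForm n U where
  toFun σ S J κ :=
    if S = ∅ ∧ κ = 0 then ∑ I, contractAll I increasingTop J • σ Finset.univ I 0 else 0
  map_add' w η := by
    funext S I κ
    by_cases h : S = ∅ ∧ κ = 0 <;> simp [h, Finset.sum_add_distrib]
  map_smul' c w := by
    funext S I κ
    by_cases h : S = ∅ ∧ κ = 0 <;> simp [h, Finset.smul_sum, smul_comm _ c]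

end LocalForms

/-! ### The free supercommutative algebra of a point -/

section Algebra

variable (m n : ℕ)

/-- The free supercommutative real algebra on odd generators `θ^1, …, θ^n`, `e_1, …, e_m` and
even generators `ξ^1, …, ξ^n`: the exterior algebra over the polynomial ring in the `ξ^α`. -/
abbrev SuperAlg : Type :=
  ExteriorAlgebra (MvPolynomial (Fin n) ℝ) (Fin n ⊕ Fin m → MvPolynomial (Fin n) ℝ)

variable {m n}

/-- The odd generator `θ^α`. -/
def genTheta (α : Fin n) : SuperAlg m n :=
  ExteriorAlgebra.ι _ (Pi.single (Sum.inl α) 1)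

/-- The odd generator `e_i`, which stands for `dx^i` or for `π∂_{x^i}`. -/
def genE (i : Fin m) : SuperAlg m n :=
  ExteriorAlgebra.ι _ (Pi.single (Sum.inr i) 1)

/-- The even generator `ξ^α`, which stands for `dθ^α` or for `π∂_{θ^α}`. -/
def genXi (α : Fin n) : SuperAlg m n :=
  algebraMap (MvPolynomial (Fin n) ℝ) _ (MvPolynomial.X α)

/-- The product `t^S h^I z^κ`, with increasing ordered products. -/
def monomialAt (t : Fin n → SuperAlg m n) (h : Fin m → SuperAlg m n) (z : Fin n → SuperAlg m n)
    (S : Finset (Fin n)) (I : Finset (Fin m)) (κ : Fin n → ℕ) : SuperAlg m n :=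
  ((S.sort (· ≤ ·)).map t).prod * ((I.sort (· ≤ ·)).map h).prod *
    ((List.finRange n).map fun α => z α ^ κ α).prod

/-- The value `∑ c S I κ(x) t^S h^I z^κ` of a coefficient family at the point `x`, with `t, h, z`
substituted for the generators. The sum runs over all `κ` with entries at most `q`; it is used for
families whose coefficients vanish unless `|I| + |κ| = q`. -/
def evalAt {U : TopologicalSpace.Opens (EuclideanSpace ℝ (Fin m))} (q : ℕ) (c : LocalForm n U)
    (x : EuclideanSpace ℝ (Fin m)) (t : Fin n → SuperAlg m n) (h : Fin m → SuperAlg m n)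
    (z : Fin n → SuperAlg m n) : SuperAlg m n :=
  ∑ S, ∑ I, ∑ κ ∈ Fintype.piFinset fun _ : Fin n => Finset.range (q + 1),
    (c S I κ : EuclideanSpace ℝ (Fin m) → ℝ) x • monomialAt t h z S I κ

theorem evalAt_add {U : TopologicalSpace.Opens (EuclideanSpace ℝ (Fin m))} (q : ℕ)
    (c c' : LocalForm n U) (x : EuclideanSpace ℝ (Fin m)) (t : Fin n → SuperAlg m n)
    (h : Fin m → SuperAlg m n) (z : Fin n → SuperAlg m n) :
    evalAt q (c + c') x t h z = evalAt q c x t h z + evalAt q c' x t h z := by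
  simp [evalAt, add_smul, Finset.sum_add_distrib]

theorem evalAt_smul {U : TopologicalSpace.Opens (EuclideanSpace ℝ (Fin m))} (q : ℕ) (r : ℝ)
    (c : LocalForm n U) (x : EuclideanSpace ℝ (Fin m)) (t : Fin n → SuperAlg m n)
    (h : Fin m → SuperAlg m n) (z : Fin n → SuperAlg m n) :
    evalAt q (r • c) x t h z = r • evalAt q c x t h z := by
  simp [evalAt, Finset.smul_sum, smul_smul]

theorem evalAt_zero {U : TopologicalSpace.Opens (EuclideanSpace ℝ (Fin m))} (q : ℕ)
    (x : EuclideanSpace ℝ (Fin m)) (t : Fin n → SuperAlg m n)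
    (h : Fin m → SuperAlg m n) (z : Fin n → SuperAlg m n) :
    evalAt q (0 : LocalForm n U) x t h z = 0 := by
  simp [evalAt]

end Algebra

/-! ### The supermanifold of a vector bundle

`V` is a smooth vector bundle of rank `n` over a smooth `m`-manifold `M`; the supermanifold is
`ΠV = (M, Λ V^*)`, of dimension `(m|n)`. A chart of `M` and a trivialization of `V` give coordinates
`x^i` of `M` and linear coordinates of the fibres, which are the odd coordinates `θ^α`; two such
coordinate systems are related by `x' = φ(x)`, `θ' = χ(x) θ`. -/

section Supermanifold

variable {m n : ℕ} {M : Type*} [TopologicalSpace M] [ChartedSpace (EuclideanSpace ℝ (Fin m)) M]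
  {V : M → Type*} [TopologicalSpace (TotalSpace (EuclideanSpace ℝ (Fin n)) V)]
  [∀ x, AddCommGroup (V x)] [∀ x, Module ℝ (V x)] [∀ x, TopologicalSpace (V x)]
  [FiberBundle (EuclideanSpace ℝ (Fin n)) V] [VectorBundle ℝ (EuclideanSpace ℝ (Fin n)) V]

variable (m n V) in
/-- A coordinate system `(x, θ)` of the supermanifold: a chart of `M` with a trivialization
of `V`. -/
structure SuperChart where
  /-- the chart of `M` -/
  chart : OpenPartialHomeomorph M (EuclideanSpace ℝ (Fin m))
  chart_mem : chart ∈ atlas (EuclideanSpace ℝ (Fin m)) M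
  /-- the trivialization of `V` -/
  triv : Trivialization (EuclideanSpace ℝ (Fin n)) (π (EuclideanSpace ℝ (Fin n)) V)
  triv_mem : MemTrivializationAtlas triv

attribute [instance] SuperChart.triv_mem

namespace SuperChart

/-- The open set of `ℝ^m` over which the coordinate system is defined. -/
def domain (a : SuperChart m n V) : TopologicalSpace.Opens (EuclideanSpace ℝ (Fin m)) where
  carrier := a.chart.target ∩ a.chart.symm ⁻¹' a.triv.baseSet
  is_open' := a.chart.symm.isOpen_inter_preimage a.triv.open_baseSet

/-- The part of the domain of `a` where the coordinate system `b` is defined, too. -/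
def overlap (a b : SuperChart m n V) : Set (EuclideanSpace ℝ (Fin m)) :=
  {x | x ∈ a.domain ∧ a.chart.symm x ∈ b.chart.source ∧ a.chart.symm x ∈ b.triv.baseSet}

/-- The transition `x ↦ x' = φ(x)` of the even coordinates from `a` to `b`. -/
def phi (a b : SuperChart m n V) (x : EuclideanSpace ℝ (Fin m)) : EuclideanSpace ℝ (Fin m) :=
  b.chart (a.chart.symm x)

/-- The transition matrix of the odd coordinates from `a` to `b`: `θ'^α = ∑ χ^α_β(x) θ^β`. -/
def chi (a b : SuperChart m n V) (x : EuclideanSpace ℝ (Fin m)) : Matrix (Fin n) (Fin n) ℝ :=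
  Matrix.of fun α β =>
    (a.triv.coordChangeL ℝ b.triv (a.chart.symm x)) (EuclideanSpace.single β 1) α

/-- The Jacobian matrix `∂x'^i/∂x^j`. -/
def jac (a b : SuperChart m n V) (x : EuclideanSpace ℝ (Fin m)) : Matrix (Fin m) (Fin m) ℝ :=
  Matrix.of fun i j => fderiv ℝ (phi a b) x (EuclideanSpace.single j 1) i

/-- The matrix `∂χ^α_β/∂x^i`. -/
def dchi (a b : SuperChart m n V) (i : Fin m) (x : EuclideanSpace ℝ (Fin m)) :
    Matrix (Fin n) (Fin n) ℝ :=
  Matrix.of fun α β => fderiv ℝ (fun y => chi a b y α β) x (EuclideanSpace.single i 1)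

/-- `θ'^α = ∑ χ^α_β θ^β`. -/
def theta' (a b : SuperChart m n V) (x : EuclideanSpace ℝ (Fin m)) (α : Fin n) : SuperAlg m n :=
  ∑ β, chi a b x α β • genTheta β

/-- `dx'^i = ∑ (∂x'^i/∂x^j) dx^j`. -/
def dx' (a b : SuperChart m n V) (x : EuclideanSpace ℝ (Fin m)) (i : Fin m) : SuperAlg m n :=
  ∑ j, jac a b x i j • genE j

/-- `dθ'^α = ∑ χ^α_β dθ^β + ∑ ∂_iχ^α_β dx^i θ^β`. -/
def dtheta' (a b : SuperChart m n V) (x : EuclideanSpace ℝ (Fin m)) (α : Fin n) : SuperAlg m n :=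
  ∑ β, chi a b x α β • genXi β + ∑ i, ∑ β, dchi a b i x α β • (genE i * genTheta β)

/-- The Berezinian of the transition: `𝒟' = (det ∂x'/∂x) (det χ)⁻¹ 𝒟`. -/
def ber (a b : SuperChart m n V) (x : EuclideanSpace ℝ (Fin m)) : ℝ :=
  (jac a b x).det / (chi a b x).det

/-- `π∂_{x'^j} = ∑ (∂x^i/∂x'^j) π∂_{x^i} + ∑ (∂θ^β/∂x'^j) π∂_{θ^β}`; the derivatives of the inverse
transition are taken at the point `x'` and `∂θ^β/∂x'^j` is expressed through the `θ^γ`. The sign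
`(-1) ^ n` is the Koszul sign for moving the odd function `∂θ^β/∂x'^j` to the left of `𝒟`, as
all functions stand there in a coefficient family. -/
def piDx' (a b : SuperChart m n V) (x : EuclideanSpace ℝ (Fin m)) (j : Fin m) : SuperAlg m n :=
  ∑ i, jac b a (phi a b x) i j • genE i +
    (-1 : ℝ) ^ n • ∑ β, ∑ γ,
      (dchi b a j (phi a b x) * chi a b x) β γ • (genTheta γ * genXi β)

/-- `π∂_{θ'^α} = ∑ (∂θ^β/∂θ'^α) π∂_{θ^β}`. -/
def piDtheta' (a b : SuperChart m n V) (x : EuclideanSpace ℝ (Fin m)) (α : Fin n) :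
    SuperAlg m n :=
  ∑ β, chi b a (phi a b x) β α • genXi β

end SuperChart

variable (m n V) in
/-- Families of local forms, one for each coordinate system, without any condition of
compatibility. -/
abbrev Family : Type _ := ∀ a : SuperChart m n V, LocalForm n a.domain

variable (m n V) in
/-- The space `Ω^p` of superforms of degree `p`: the families of local superforms of degree `p` (a
term with `dx^I (dθ)^κ` has degree `|I| + |κ|`) that agree on all overlaps. -/
def superforms (p : ℤ) : Submodule ℝ (Family m n V) where
  carrier := {w |
    (∀ a S I κ, (I.card : ℤ) + ∑ α, (κ α : ℤ) ≠ p → w a S I κ = 0) ∧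
    ∀ a b : SuperChart m n V, ∀ x ∈ SuperChart.overlap a b,
      evalAt p.toNat (w a) x genTheta genE genXi =
        evalAt p.toNat (w b) (SuperChart.phi a b x)
          (SuperChart.theta' a b x) (SuperChart.dx' a b x) (SuperChart.dtheta' a b x)}
  add_mem' := by
    rintro w η ⟨h1, h2⟩ ⟨h3, h4⟩
    refine ⟨fun a S I κ h => by simp [h1 a S I κ h, h3 a S I κ h], fun a b x hx => ?_⟩
    simp only [Pi.add_apply w η, evalAt_add, h2 a b x hx, h4 a b x hx]
  zero_mem' := ⟨fun _ _ _ _ _ => rfl, fun a b x _ => by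
    simp only [Pi.zero_apply, evalAt_zero]⟩
  smul_mem' := by
    rintro c w ⟨h1, h2⟩
    refine ⟨fun a S I κ h => by simp [h1 a S I κ h], fun a b x hx => ?_⟩
    simp only [Pi.smul_apply c w, evalAt_smul, h2 a b x hx]

variable (m n V) in
/-- The space `Σ^p` of integral forms of degree `p`, that is, of sections of
`Ber ⊗ S^{m-p} ΠT`: the families of local integral forms of degree `p` (a term with
`(π∂_x)^I (π∂_θ)^κ` has degree `m - |I| - |κ|`) that agree on all overlaps. -/
def integralForms (p : ℤ) : Submodule ℝ (Family m n V) where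
  carrier := {σ |
    (∀ a S I κ, (I.card : ℤ) + ∑ α, (κ α : ℤ) ≠ m - p → σ a S I κ = 0) ∧
    ∀ a b : SuperChart m n V, ∀ x ∈ SuperChart.overlap a b,
      evalAt (m - p).toNat (σ a) x genTheta genE genXi =
        SuperChart.ber a b x • evalAt (m - p).toNat (σ b) (SuperChart.phi a b x)
          (SuperChart.theta' a b x) (SuperChart.piDx' a b x) (SuperChart.piDtheta' a b x)}
  add_mem' := by
    rintro w η ⟨h1, h2⟩ ⟨h3, h4⟩
    refine ⟨fun a S I κ h => by simp [h1 a S I κ h, h3 a S I κ h], fun a b x hx => ?_⟩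
    simp only [Pi.add_apply w η, evalAt_add, h2 a b x hx, h4 a b x hx, smul_add]
  zero_mem' := ⟨fun _ _ _ _ _ => rfl, fun a b x _ => by
    simp only [Pi.zero_apply, evalAt_zero, smul_zero]⟩
  smul_mem' := by
    rintro c w ⟨h1, h2⟩
    refine ⟨fun a S I κ h => by simp [h1 a S I κ h], fun a b x hx => ?_⟩
    simp only [Pi.smul_apply c w, evalAt_smul, h2 a b x hx, smul_comm c]

variable (m n V) in
/-- The de Rham differential `d`, computed in each coordinate system. -/
def deRham : Family m n V →ₗ[ℝ] Family m n V :=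
  LinearMap.pi fun a => localD ∘ₗ LinearMap.proj a

variable (m n V) in
/-- The differential `δ` of integral forms, computed in each coordinate system. -/
def delta : Family m n V →ₗ[ℝ] Family m n V :=
  LinearMap.pi fun a => localDelta ∘ₗ LinearMap.proj a

variable (m n V) in
/-- The PCO map `f`, computed in each coordinate system. -/
def pco : Family m n V →ₗ[ℝ] Family m n V :=
  LinearMap.pi fun a => localPCO ∘ₗ LinearMap.proj a

variable (m n V) in
/-- The map `Z`, computed in each coordinate system. -/
def quasiInv : Family m n V →ₗ[ℝ] Family m n V :=
  LinearMap.pi fun a => localZ ∘ₗ LinearMap.proj a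

end Supermanifold

/-! ### Cohomology -/

section Cohomology

variable {W : Type*} [AddCommGroup W] [Module ℝ W]

/-- The cocycles of degree `p` of a complex whose terms are subspaces `C p` of `W` and whose
differential is the restriction of `D`. -/
def cocycles (C : ℤ → Submodule ℝ W) (D : W →ₗ[ℝ] W) (p : ℤ) : Submodule ℝ W :=
  C p ⊓ LinearMap.ker D

/-- The coboundaries `D (C (p - 1))`, as a subspace of the cocycles of degree `p`. -/
def coboundaries (C : ℤ → Submodule ℝ W) (D : W →ₗ[ℝ] W) (p : ℤ) :
    Submodule ℝ (cocycles C D p) :=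
  ((C (p - 1)).map D).comap (cocycles C D p).subtype

/-- The cohomology of degree `p`. -/
abbrev Cohomology (C : ℤ → Submodule ℝ W) (D : W →ₗ[ℝ] W) (p : ℤ) : Type _ :=
  cocycles C D p ⧸ coboundaries C D p

/-- The cohomology class of a cocycle. -/
abbrev cohomologyClass (C : ℤ → Submodule ℝ W) (D : W →ₗ[ℝ] W) (p : ℤ) (w : W)
    (hw : w ∈ cocycles C D p) : Cohomology C D p :=
  Submodule.Quotient.mk ⟨w, hw⟩

end Cohomology

end PictureChanging

end

open PictureChanging

/-!
In each coordinate system, forms take values in the free supercommutative algebra on odd generators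
`θ^α`, `e_i` and even generators `ξ^α`, where `e = dx`, `ξ = dθ` for superforms and `e = π∂_x`,
`ξ = π∂_θ` for integral forms. A change of coordinates acts by an algebra homomorphism (`formMap`,
`intMap`), times the Berezinian for integral forms, and statements about it are checked on products
with one generator at a time (`gen_induction`).

*The differentials are natural.* For `d` this is because the images of `dx'` and `dθ'` are closed
and `d` is a derivation (`formMap_natural`, `deRham_mem`). The operator `δ` is of second order, and
its bracket with the product with `π∂_{x'^k}` is the Lie derivative along `∂/∂x'^k` (`deltaAt_e`).
This Lie derivative annihilates the new generators since the coordinate vector fields commute, and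
no divergence term occurs because the Berezinian is the quotient of the coordinate volume elements:
by Jacobi's formula, its logarithmic derivative is minus the divergence of the vector fields
(`divergence_jac`, `pd_ber`, `isIntChange`). Together with the brackets with the other generators
this gives `intMap_natural` and `delta_mem`.

*The maps `f` and `Z`.* Both are contractions of a top form, `f` of `π∂_{x^m} ∧ ⋯ ∧ π∂_{x^1}` and
`Z` of `dx^1 ∧ ⋯ ∧ dx^m`. Contraction of a top form exchanges products with derivatives, so that
`f` and `Z` are cochain maps in each coordinate system (`localPCO_localD`, `localZ_localDelta`),
and contracting twice gives back the form one started from (`contraction_contraction`). Therefore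
`Z ∘ f` is the projection to the terms without `θ` and `dθ`, and `f ∘ Z` is the projection to the
terms `θ^1 ⋯ θ^n g(x) 𝒟 ⊗ (π∂_x)^I`. The quasi-inverse identities follow at once. The map `f` does
not depend on the coordinates, because the factor `θ^1 ⋯ θ^n` removes the nilpotent part of the
transformation of `π∂_x`, and the Berezinian cancels the determinants of the top forms (`pco_mem`).

*Homotopies.* As the `θ'` are linear in the `θ`, the Euler vector field `E = ∑ θ^α ∂/∂θ^α` is
globally defined, hence so are the contraction `ι` of superforms with `E` and the product `P` of
integral forms with `E`. By Cartan's formula, `dι + ιd` multiplies each monomial by its degree in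
`θ` and `dθ`, and `-(δP + Pδ)` multiplies `θ^S 𝒟 ⊗ (π∂_x)^I (π∂_θ)^κ` by `n - |S| + |κ|`. These
weights are natural numbers, bounded in each degree, and the terms of weight `0` are those to which
`Z ∘ f` and `f ∘ Z` project. So both projections are polynomials with constant term `1` in a
null-homotopic operator, namely `∏ (1 - T / k)` over the positive weights `k` (`aeval_formWeight`,
`aeval_intWeight`). This has two consequences. The projection of an integral form to weight `0` is
again globally defined, whence `Z` does not depend on the coordinates either (`pco_quasiInv_mem`,
`quasiInv_mem`). And a cocycle differs from its projection by a coboundary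
(`exists_eq_of_aeval_eq_zero`), so that `f` and `Z` are inverse to each other in cohomology.
-/

noncomputable section

namespace PictureChanging

/-! ### The free supercommutative algebra -/

section FreeAlgebra

variable {m n : ℕ}

theorem genTheta_mul_genTheta (α β : Fin n) :
    (genTheta α : SuperAlg m n) * genTheta β = -(genTheta β * genTheta α) :=
  eq_neg_of_add_eq_zero_left (ExteriorAlgebra.ι_add_mul_swap _ _)

theorem genE_mul_genE (i j : Fin m) :
    (genE i : SuperAlg m n) * genE j = -(genE j * genE i) :=
  eq_neg_of_add_eq_zero_left (ExteriorAlgebra.ι_add_mul_swap _ _)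

theorem genE_mul_genTheta (i : Fin m) (α : Fin n) :
    (genE i : SuperAlg m n) * genTheta α = -(genTheta α * genE i) :=
  eq_neg_of_add_eq_zero_left (ExteriorAlgebra.ι_add_mul_swap _ _)

theorem genTheta_sq (α : Fin n) : (genTheta α : SuperAlg m n) * genTheta α = 0 :=
  ExteriorAlgebra.ι_sq_zero _

theorem genE_sq (i : Fin m) : (genE i : SuperAlg m n) * genE i = 0 :=
  ExteriorAlgebra.ι_sq_zero _

theorem genXi_comm (α : Fin n) (u : SuperAlg m n) : genXi α * u = u * genXi α :=
  Algebra.commutes _ _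

theorem xi_theta (α β : Fin n) :
    (genXi α : SuperAlg m n) * genTheta β = genTheta β * genXi α := genXi_comm _ _

theorem xi_e (α : Fin n) (i : Fin m) :
    (genXi α : SuperAlg m n) * genE i = genE i * genXi α := genXi_comm _ _

/-- The algebra is spanned by the iterated products of generators, so a linear property can be
checked by multiplying with one generator at a time from the left. -/
theorem gen_induction {P : SuperAlg m n → Prop} (one : P 1)
    (smul : ∀ (r : ℝ) a, P a → P (r • a)) (add : ∀ a b, P a → P b → P (a + b))
    (theta : ∀ α a, P a → P (genTheta α * a)) (e : ∀ i a, P a → P (genE i * a))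
    (xi : ∀ α a, P a → P (genXi α * a)) (a : SuperAlg m n) : P a := by
  have poly : ∀ (p : MvPolynomial (Fin n) ℝ) (u : SuperAlg m n), P u →
      P (algebraMap _ (SuperAlg m n) p * u) := by
    intro p
    induction p using MvPolynomial.induction_on with
    | C r =>
      intro u hu
      have : algebraMap (MvPolynomial (Fin n) ℝ) (SuperAlg m n) (MvPolynomial.C r) * u = r • u := by
        rw [← MvPolynomial.algebraMap_eq, ← IsScalarTower.algebraMap_apply, Algebra.smul_def]
      rw [this]
      exact smul r u hu
    | add p q hp hq =>
      intro u hu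
      rw [map_add, add_mul]
      exact add _ _ (hp u hu) (hq u hu)
    | mul_X p α hp =>
      intro u hu
      rw [map_mul, mul_assoc]
      exact hp _ (xi α u hu)
  have key : ∀ a u : SuperAlg m n, P u → P (a * u) := by
    intro a
    induction a using ExteriorAlgebra.induction with
    | algebraMap p => exact poly p
    | ι v =>
      intro u hu
      have hv : v = ∑ j, v j • (Pi.single j 1 : Fin n ⊕ Fin m → MvPolynomial (Fin n) ℝ) := by
        exact pi_eq_sum_univ' v
      rw [hv, map_sum, Finset.sum_mul]
      refine Finset.sum_induction _ P (fun a b => add a b) ?_ ?_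
      · have := smul 0 u hu
        rwa [zero_smul] at this
      · intro j _
        rw [map_smul, Algebra.smul_def, mul_assoc]
        refine poly _ _ ?_
        cases j with
        | inl α => exact theta α u hu
        | inr i => exact e i u hu
    | mul a b ha hb =>
      intro u hu
      rw [mul_assoc]
      exact ha _ (hb u hu)
    | add a b ha hb =>
      intro u hu
      rw [add_mul]
      exact add _ _ (ha u hu) (hb u hu)
  simpa using key a 1 one

/-- Two real linear maps on the free supercommutative algebra agree if they agree on `1` and if
agreement at `u` implies agreement at the products of `u` with the generators. -/
theorem linearMap_ext_gen {B : Type*} [AddCommGroup B] [Module ℝ B] (f g : SuperAlg m n →ₗ[ℝ] B)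
    (one : f 1 = g 1) (theta : ∀ α a, f a = g a → f (genTheta α * a) = g (genTheta α * a))
    (e : ∀ i a, f a = g a → f (genE i * a) = g (genE i * a))
    (xi : ∀ α a, f a = g a → f (genXi α * a) = g (genXi α * a)) (a : SuperAlg m n) :
    f a = g a := by
  induction a using gen_induction with
  | one => exact one
  | smul r a h => rw [map_smul, map_smul, h]
  | add a b ha hb => rw [map_add, map_add, ha, hb]
  | theta α a h => exact theta α a h
  | e i a h => exact e i a h
  | xi α a h => exact xi α a h

/-! ### The universal property -/

variable {B : Type*} [Ring B] [Algebra ℝ B]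

/-- Images of the generators of the free supercommutative algebra: odd elements `v`, which
anticommute, and central elements `z`. -/
structure IsSuperSystem (v : Fin n ⊕ Fin m → B) (z : Fin n → B) : Prop where
  anticomm : ∀ a b, v a * v b = -(v b * v a)
  central : ∀ α b, z α * b = b * z α

/-- The polynomials in the even generators, evaluated at central elements. -/
def evalCentral (z : Fin n → B) (hz : ∀ α b, z α * b = b * z α) :
    MvPolynomial (Fin n) ℝ →ₐ[ℝ] B :=
  (Subalgebra.center ℝ B).val.comp (MvPolynomial.aeval fun α =>
    ⟨z α, Subalgebra.mem_center_iff.2 fun b => (hz α b).symm⟩)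

theorem exists_lift (v : Fin n ⊕ Fin m → B) (z : Fin n → B) (h : IsSuperSystem v z) :
    ∃ Φ : SuperAlg m n →ₐ[ℝ] B, (∀ α, Φ (genTheta α) = v (Sum.inl α)) ∧
      (∀ i, Φ (genE i) = v (Sum.inr i)) ∧ ∀ α, Φ (genXi α) = z α := by
  let f := evalCentral z h.central
  have hf : ∀ p b, f p * b = b * f p := fun p b =>
    ((Subalgebra.mem_center_iff.1 (Subtype.prop _)) b).symm
  let _ : Algebra (MvPolynomial (Fin n) ℝ) B := f.toRingHom.toAlgebra' hf
  have : IsScalarTower ℝ (MvPolynomial (Fin n) ℝ) B := IsScalarTower.of_algebraMap_eq fun r =>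
    (f.commutes r).symm
  let g : (Fin n ⊕ Fin m → MvPolynomial (Fin n) ℝ) →ₗ[MvPolynomial (Fin n) ℝ] B :=
    Fintype.linearCombination (MvPolynomial (Fin n) ℝ) v
  have hv : ∀ a b, v a * v b + v b * v a = 0 := fun a b => by rw [h.anticomm a b, neg_add_cancel]
  have hg : ∀ x, g x * g x = 0 := by
    intro x
    have h2 : g x * g x + g x * g x = 0 := by
      have hx : g x = ∑ a, x a • v a := Fintype.linearCombination_apply _ _ _
      have h3 : g x * g x = ∑ a, ∑ b, (x a * x b) • (v a * v b) := by
        rw [hx, Finset.sum_mul_sum]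
        refine Finset.sum_congr rfl fun a _ => Finset.sum_congr rfl fun b _ => ?_
        rw [smul_mul_smul_comm]
      have h4 : g x * g x = ∑ a, ∑ b, (x a * x b) • (v b * v a) := by
        rw [h3, Finset.sum_comm]
        refine Finset.sum_congr rfl fun a _ => Finset.sum_congr rfl fun b _ => ?_
        rw [mul_comm]
      nth_rewrite 1 [h3]
      rw [h4, ← Finset.sum_add_distrib]
      refine Finset.sum_eq_zero fun a _ => ?_
      rw [← Finset.sum_add_distrib]
      refine Finset.sum_eq_zero fun b _ => ?_
      rw [← smul_add, hv, smul_zero]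
    have h5 : (2 : ℝ) • (g x * g x) = 0 := by rw [two_smul, h2]
    exact (smul_eq_zero.1 h5).resolve_left two_ne_zero
  let Φ := ExteriorAlgebra.lift (MvPolynomial (Fin n) ℝ) ⟨g, hg⟩
  have hΦ : ∀ a, Φ (ExteriorAlgebra.ι _ (Pi.single a 1)) = v a := by
    intro a
    rw [ExteriorAlgebra.lift_ι_apply]
    simp [g]
  refine ⟨Φ.restrictScalars ℝ, fun α => hΦ _, fun i => hΦ _, fun α => ?_⟩
  have h6 : Φ (algebraMap _ _ (MvPolynomial.X α)) = algebraMap _ B (MvPolynomial.X α) :=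
    Φ.commutes _
  refine h6.trans ?_
  change f (MvPolynomial.X α) = z α
  simp [f, evalCentral]

/-- The algebra homomorphism with prescribed values on the generators. -/
def superLift (v : Fin n ⊕ Fin m → B) (z : Fin n → B) (h : IsSuperSystem v z) :
    SuperAlg m n →ₐ[ℝ] B :=
  (exists_lift v z h).choose

@[simp]
theorem superLift_theta (v : Fin n ⊕ Fin m → B) (z : Fin n → B) (h : IsSuperSystem v z)
    (α : Fin n) : superLift v z h (genTheta α) = v (Sum.inl α) :=
  (exists_lift v z h).choose_spec.1 α

@[simp]
theorem superLift_e (v : Fin n ⊕ Fin m → B) (z : Fin n → B) (h : IsSuperSystem v z)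
    (i : Fin m) : superLift v z h (genE i) = v (Sum.inr i) :=
  (exists_lift v z h).choose_spec.2.1 i

@[simp]
theorem superLift_xi (v : Fin n ⊕ Fin m → B) (z : Fin n → B) (h : IsSuperSystem v z)
    (α : Fin n) : superLift v z h (genXi α) = z α :=
  (exists_lift v z h).choose_spec.2.2 α

/-! ### Partial derivatives -/

/-- The odd derivation `∂/∂θ^α`. -/
def dTheta (α : Fin n) : SuperAlg m n →ₗ[ℝ] SuperAlg m n :=
  (CliffordAlgebra.contractLeft (Q := 0)
    (LinearMap.proj (Sum.inl α) :
      (Fin n ⊕ Fin m → MvPolynomial (Fin n) ℝ) →ₗ[_] _)).restrictScalars ℝ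

/-- The odd derivation `∂/∂e_i`. -/
def dE (i : Fin m) : SuperAlg m n →ₗ[ℝ] SuperAlg m n :=
  (CliffordAlgebra.contractLeft (Q := 0)
    (LinearMap.proj (Sum.inr i) :
      (Fin n ⊕ Fin m → MvPolynomial (Fin n) ℝ) →ₗ[_] _)).restrictScalars ℝ

theorem contractLeft_gen_mul (a b : Fin n ⊕ Fin m) (u : SuperAlg m n) :
    (CliffordAlgebra.contractLeft (Q := 0)
      (LinearMap.proj a : (Fin n ⊕ Fin m → MvPolynomial (Fin n) ℝ) →ₗ[_] _))
      (ExteriorAlgebra.ι _ (Pi.single b 1) * u) = (if a = b then u else 0) -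
      ExteriorAlgebra.ι _ (Pi.single b 1) * (CliffordAlgebra.contractLeft (Q := 0)
      (LinearMap.proj a : (Fin n ⊕ Fin m → MvPolynomial (Fin n) ℝ) →ₗ[_] _)) u := by
  refine (CliffordAlgebra.contractLeft_ι_mul _ _ _).trans ?_
  congr 1
  rw [LinearMap.proj_apply, Pi.single_apply]
  split_ifs <;> simp

@[simp]
theorem dTheta_one (α : Fin n) : dTheta α (1 : SuperAlg m n) = 0 :=
  CliffordAlgebra.contractLeft_one (Q := 0) _

@[simp]
theorem dE_one (i : Fin m) : dE i (1 : SuperAlg m n) = 0 :=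
  CliffordAlgebra.contractLeft_one (Q := 0) _

theorem dTheta_theta_mul (α β : Fin n) (u : SuperAlg m n) :
    dTheta α (genTheta β * u) = (if α = β then u else 0) - genTheta β * dTheta α u := by
  refine (contractLeft_gen_mul _ _ _).trans ?_
  simp only [Sum.inl.injEq]
  rfl

theorem dTheta_e_mul (α : Fin n) (j : Fin m) (u : SuperAlg m n) :
    dTheta α (genE j * u) = -(genE j * dTheta α u) := by
  refine (contractLeft_gen_mul _ _ _).trans ?_
  simp only [reduceCtorEq, if_false, zero_sub]
  rfl

theorem dTheta_xi_mul (α β : Fin n) (u : SuperAlg m n) :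
    dTheta α (genXi β * u) = genXi β * dTheta α u :=
  CliffordAlgebra.contractLeft_algebraMap_mul _ _ _

theorem dE_e_mul (i j : Fin m) (u : SuperAlg m n) :
    dE i (genE j * u) = (if i = j then u else 0) - genE j * dE i u := by
  refine (contractLeft_gen_mul _ _ _).trans ?_
  simp only [Sum.inr.injEq]
  rfl

theorem dE_theta_mul (i : Fin m) (β : Fin n) (u : SuperAlg m n) :
    dE i (genTheta β * u) = -(genTheta β * dE i u) := by
  refine (contractLeft_gen_mul _ _ _).trans ?_
  simp only [reduceCtorEq, if_false, zero_sub]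
  rfl

theorem dE_xi_mul (i : Fin m) (β : Fin n) (u : SuperAlg m n) :
    dE i (genXi β * u) = genXi β * dE i u :=
  CliffordAlgebra.contractLeft_algebraMap_mul _ _ _

/-- The images of the generators under the infinitesimal translation `ξ^α ↦ ξ^α + ε`. -/
theorem isSuperSystem_xiShift (α : Fin n) :
    IsSuperSystem (B := DualNumber (SuperAlg m n))
      (Sum.elim (fun β => TrivSqZeroExt.inl (genTheta β)) fun i => TrivSqZeroExt.inl (genE i))
      (fun β => TrivSqZeroExt.inl (genXi β) + TrivSqZeroExt.inr (if α = β then 1 else 0)) where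
  anticomm := by
    rintro (a | a) (b | b) <;>
      simp only [Sum.elim_inl, Sum.elim_inr, ← TrivSqZeroExt.inl_mul, ← TrivSqZeroExt.inl_neg]
    · rw [genTheta_mul_genTheta]
    · rw [genE_mul_genTheta, neg_neg]
    · rw [genE_mul_genTheta]
    · rw [genE_mul_genE]
  central := by
    intro β b
    ext
    · simp only [TrivSqZeroExt.fst_mul, TrivSqZeroExt.fst_add, TrivSqZeroExt.fst_inl,
        TrivSqZeroExt.fst_inr, add_zero, genXi_comm]
    · simp only [TrivSqZeroExt.snd_mul, TrivSqZeroExt.fst_add, TrivSqZeroExt.fst_inl,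
        TrivSqZeroExt.fst_inr, TrivSqZeroExt.snd_add, TrivSqZeroExt.snd_inl,
        TrivSqZeroExt.snd_inr, smul_eq_mul, MulOpposite.smul_eq_mul_unop, MulOpposite.unop_op]
      split_ifs <;> simp [genXi_comm, add_comm]

/-- The algebra homomorphism `u ↦ u + ε ∂u/∂ξ^α`. -/
def xiShift (α : Fin n) : SuperAlg m n →ₐ[ℝ] DualNumber (SuperAlg m n) :=
  superLift _ _ (isSuperSystem_xiShift α)

/-- The even derivation `∂/∂ξ^α`. -/
def dXi (α : Fin n) : SuperAlg m n →ₗ[ℝ] SuperAlg m n :=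
  (TrivSqZeroExt.sndHom (SuperAlg m n) (SuperAlg m n)).restrictScalars ℝ ∘ₗ
    (xiShift α).toLinearMap

theorem fst_xiShift (α : Fin n) (u : SuperAlg m n) : (xiShift α u).fst = u := by
  induction u using gen_induction with
  | one => simp
  | smul r a h => rw [map_smul, TrivSqZeroExt.fst_smul, h]
  | add a b ha hb => rw [map_add, TrivSqZeroExt.fst_add, ha, hb]
  | theta β a h => rw [map_mul, TrivSqZeroExt.fst_mul, h]; simp [xiShift]
  | e i a h => rw [map_mul, TrivSqZeroExt.fst_mul, h]; simp [xiShift]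
  | xi β a h =>
    rw [map_mul, TrivSqZeroExt.fst_mul, h, xiShift, superLift_xi, TrivSqZeroExt.fst_add,
      TrivSqZeroExt.fst_inl, TrivSqZeroExt.fst_inr, add_zero]

theorem dXi_apply (α : Fin n) (u : SuperAlg m n) : dXi α u = (xiShift α u).snd := rfl

@[simp]
theorem dXi_one (α : Fin n) : dXi α (1 : SuperAlg m n) = 0 := by
  simp [dXi_apply]

theorem dXi_mul (α : Fin n) (u v : SuperAlg m n) : dXi α (u * v) = u * dXi α v + dXi α u * v := by
  simp only [dXi_apply, map_mul, TrivSqZeroExt.snd_mul, fst_xiShift, smul_eq_mul,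
    MulOpposite.smul_eq_mul_unop, MulOpposite.unop_op]

theorem dXi_theta_mul (α β : Fin n) (u : SuperAlg m n) :
    dXi α (genTheta β * u) = genTheta β * dXi α u := by
  rw [dXi_mul]
  simp [dXi_apply, xiShift]

theorem dXi_e_mul (α : Fin n) (j : Fin m) (u : SuperAlg m n) :
    dXi α (genE j * u) = genE j * dXi α u := by
  rw [dXi_mul]
  simp [dXi_apply, xiShift]

theorem dXi_xi_mul (α β : Fin n) (u : SuperAlg m n) :
    dXi α (genXi β * u) = genXi β * dXi α u + if α = β then u else 0 := by
  rw [dXi_mul]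
  simp only [dXi_apply, xiShift, superLift_xi, TrivSqZeroExt.snd_add, TrivSqZeroExt.snd_inl,
    TrivSqZeroExt.snd_inr, zero_add, ite_mul, one_mul, zero_mul]

end FreeAlgebra

/-! ### Monomials and coefficients -/

section Operators
variable {m n : ℕ}

theorem dTheta_dTheta (α β : Fin n) (u : SuperAlg m n) :
    dTheta α (dTheta β u) = -dTheta β (dTheta α u) :=
  CliffordAlgebra.contractLeft_comm (Q := 0) _ _ u

theorem dE_dE (i j : Fin m) (u : SuperAlg m n) : dE i (dE j u) = -dE j (dE i u) :=
  CliffordAlgebra.contractLeft_comm (Q := 0) _ _ u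

theorem dE_dTheta (i : Fin m) (α : Fin n) (u : SuperAlg m n) :
    dE i (dTheta α u) = -dTheta α (dE i u) :=
  CliffordAlgebra.contractLeft_comm (Q := 0) _ _ u

theorem dXi_dTheta (α β : Fin n) (u : SuperAlg m n) :
    dXi α (dTheta β u) = dTheta β (dXi α u) := by
  refine linearMap_ext_gen (dXi α ∘ₗ dTheta β) (dTheta β ∘ₗ dXi α) (by simp) ?_ ?_ ?_ u
  all_goals
    intro γ a h
    simp only [LinearMap.comp_apply] at h ⊢
  · rw [dXi_theta_mul, dTheta_theta_mul, dTheta_theta_mul, map_sub, dXi_theta_mul, h]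
    split_ifs <;> simp
  · rw [dXi_e_mul, dTheta_e_mul, dTheta_e_mul, map_neg, dXi_e_mul, h]
  · rw [dXi_xi_mul, dTheta_xi_mul, dXi_xi_mul, map_add, dTheta_xi_mul, h]
    split_ifs <;> simp

theorem dXi_dE (α : Fin n) (i : Fin m) (u : SuperAlg m n) :
    dXi α (dE i u) = dE i (dXi α u) := by
  refine linearMap_ext_gen (dXi α ∘ₗ dE i) (dE i ∘ₗ dXi α) (by simp) ?_ ?_ ?_ u
  all_goals
    intro γ a h
    simp only [LinearMap.comp_apply] at h ⊢
  · rw [dXi_theta_mul, dE_theta_mul, dE_theta_mul, map_neg, dXi_theta_mul, h]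
  · rw [dXi_e_mul, dE_e_mul, dE_e_mul, map_sub, dXi_e_mul, h]
    split_ifs <;> simp
  · rw [dXi_xi_mul, dE_xi_mul, dXi_xi_mul, map_add, dE_xi_mul, h]
    split_ifs <;> simp

theorem dXi_dXi (α β : Fin n) (u : SuperAlg m n) :
    dXi α (dXi β u) = dXi β (dXi α u) := by
  refine linearMap_ext_gen (dXi α ∘ₗ dXi β) (dXi β ∘ₗ dXi α) (by simp) ?_ ?_ ?_ u
  all_goals
    intro γ a h
    simp only [LinearMap.comp_apply] at h ⊢
  · simp only [dXi_theta_mul, h]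
  · simp only [dXi_e_mul, h]
  · simp only [dXi_xi_mul, map_add, h]
    split_ifs <;> simp [add_right_comm]

end Operators

section OrderedProducts

variable {k : ℕ} {B : Type*} [Ring B]

/-- The increasing product of the elements `g a` for `a ∈ S`. -/
def oddProd (g : Fin k → B) (S : Finset (Fin k)) : B := ((S.sort (· ≤ ·)).map g).prod

@[simp]
theorem oddProd_empty (g : Fin k → B) : oddProd g ∅ = 1 := by simp [oddProd]

theorem oddProd_insert_min (g : Fin k → B) {S : Finset (Fin k)} {a : Fin k}
    (h : ∀ b ∈ S, a < b) : oddProd g (insert a S) = g a * oddProd g S := by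
  have ha : a ∉ S := fun h' => lt_irrefl _ (h a h')
  rw [oddProd, Finset.sort_insert _ (fun b hb => (h b hb).le) ha, List.map_cons, List.prod_cons,
    oddProd]

variable [Algebra ℝ B]

theorem map_oddProd {C : Type*} [Ring C] [Algebra ℝ C] (Φ : B →ₐ[ℝ] C) (g : Fin k → B)
    (S : Finset (Fin k)) : Φ (oddProd g S) = oddProd (fun a => Φ (g a)) S := by
  rw [oddProd, map_list_prod, List.map_map]
  rfl

theorem sgn_of_le {S : Finset (Fin k)} {a : Fin k} (h : ∀ b ∈ S, a ≤ b) : sgn S a = 1 := by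
  rw [sgn, Finset.filter_false_of_mem fun b hb => (h b hb).not_gt]
  simp

theorem sgn_insert_lt {S : Finset (Fin k)} {a b : Fin k} (ha : a ∉ S) (h : a < b) :
    sgn (insert a S) b = -sgn S b := by
  rw [sgn, Finset.filter_insert, if_pos h, Finset.card_insert_of_notMem (by simp [ha]), pow_succ,
    sgn]
  ring

theorem sgn_insert_self (S : Finset (Fin k)) (a : Fin k) : sgn (insert a S) a = sgn S a := by
  rw [sgn, sgn, Finset.filter_insert, if_neg (lt_irrefl a)]

theorem sgn_erase_self (S : Finset (Fin k)) (a : Fin k) : sgn (S.erase a) a = sgn S a := by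
  rw [sgn, sgn, ← Finset.erase_eq_of_notMem (s := S.filter (· < a)) (a := a) (by simp),
    Finset.filter_erase]

theorem sgn_mul_self (S : Finset (Fin k)) (a : Fin k) : sgn S a * sgn S a = 1 := by
  rw [sgn, ← mul_pow]
  simp

theorem mul_oddProd (g : Fin k → B) (hg : ∀ a b, g a * g b = -(g b * g a))
    (hg2 : ∀ a, g a * g a = 0) (b : Fin k) (S : Finset (Fin k)) :
    g b * oddProd g S = if b ∈ S then 0 else sgn S b • oddProd g (insert b S) := by
  induction S using Finset.induction_on_min with
  | empty => simp [oddProd, sgn]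
  | insert a S ha ih =>
    have ha' : a ∉ S := fun h' => lt_irrefl _ (ha a h')
    rw [oddProd_insert_min g ha]
    rcases lt_trichotomy b a with hb | rfl | hb
    · have hlt : ∀ c ∈ insert a S, b < c := by
        intro c hc
        rcases Finset.mem_insert.1 hc with rfl | hc
        exacts [hb, hb.trans (ha c hc)]
      rw [if_neg fun h => lt_irrefl _ (hlt b h), oddProd_insert_min g hlt, oddProd_insert_min g ha,
        sgn_of_le fun c hc => (hlt c hc).le, one_smul]
    · rw [← mul_assoc, hg2, zero_mul, if_pos (Finset.mem_insert_self _ _)]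
    · rw [← mul_assoc, hg, neg_mul, mul_assoc, ih]
      have hba : b ≠ a := hb.ne'
      by_cases hbS : b ∈ S
      · simp [hbS]
      · have hlt : ∀ c ∈ insert b S, a < c := by
          intro c hc
          rcases Finset.mem_insert.1 hc with rfl | hc
          exacts [hb, ha c hc]
        rw [if_neg hbS, if_neg (by simp [hbS, hba]), Finset.insert_comm, oddProd_insert_min g hlt,
          sgn_insert_lt ha' hb, mul_smul_comm, neg_smul]

/-- The Leibniz rule for an odd derivation acting on an increasing product of the variables. -/
theorem derivation_oddProd_mul (g : Fin k → B) (D : B →ₗ[ℝ] B) (b : Fin k)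
    (hD : ∀ a u, D (g a * u) = (if b = a then u else 0) - g a * D u)
    (S : Finset (Fin k)) (u : B) :
    D (oddProd g S * u) = (if b ∈ S then sgn S b • (oddProd g (S.erase b) * u) else 0) +
      (-1 : ℝ) ^ S.card • (oddProd g S * D u) := by
  induction S using Finset.induction_on_min with
  | empty => simp [oddProd]
  | insert a S ha ih =>
    have ha' : a ∉ S := fun h' => lt_irrefl _ (ha a h')
    rw [oddProd_insert_min g ha, mul_assoc, hD, ih, Finset.card_insert_of_notMem ha', pow_succ]
    rcases eq_or_ne b a with rfl | hb
    · rw [if_pos rfl, if_neg ha', if_pos (Finset.mem_insert_self _ _), Finset.erase_insert ha',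
        sgn_insert_self, sgn_of_le fun c hc => (ha c hc).le]
      simp [sub_eq_add_neg, mul_assoc]
    · rw [if_neg hb]
      by_cases hbS : b ∈ S
      · have hlt : ∀ c ∈ S.erase b, a < c := fun c hc => ha c (Finset.mem_of_mem_erase hc)
        rw [if_pos hbS, if_pos (Finset.mem_insert_of_mem hbS), sgn_insert_lt ha' (ha b hbS),
          Finset.erase_insert_of_ne hb.symm, oddProd_insert_min g hlt]
        simp [mul_add, mul_assoc]
        abel
      · rw [if_neg hbS, if_neg (by simp [hb, hbS])]
        simp [mul_assoc]

/-- An odd operator that anticommutes with all the factors of an increasing product. -/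
theorem anticomm_oddProd_mul (g : Fin k → B) (D : B →ₗ[ℝ] B)
    (hD : ∀ a u, D (g a * u) = -(g a * D u)) (S : Finset (Fin k)) (u : B) :
    D (oddProd g S * u) = (-1 : ℝ) ^ S.card • (oddProd g S * D u) := by
  induction S using Finset.induction_on_min with
  | empty => simp [oddProd]
  | insert a S ha ih =>
    have ha' : a ∉ S := fun h' => lt_irrefl _ (ha a h')
    rw [oddProd_insert_min g ha, mul_assoc, hD, ih, Finset.card_insert_of_notMem ha', pow_succ]
    simp [mul_assoc]

/-- An even operator that commutes with all the factors of an increasing product. -/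
theorem comm_oddProd_mul (g : Fin k → B) (D : B →ₗ[ℝ] B)
    (hD : ∀ a u, D (g a * u) = g a * D u) (S : Finset (Fin k)) (u : B) :
    D (oddProd g S * u) = oddProd g S * D u := by
  induction S using Finset.induction_on_min with
  | empty => simp [oddProd]
  | insert a S ha ih => rw [oddProd_insert_min g ha, mul_assoc, hD, ih, mul_assoc]

/-- A Berezin-type functional: if `K` kills all the multiples of the variables `g a`, then its
composition with the derivatives along `S` reads off the coefficient of the increasing product
over `S`. -/
theorem exists_coefficient {C : Type*} [AddCommGroup C] [Module ℝ C] (g : Fin k → B)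
    (D : Fin k → B →ₗ[ℝ] B)
    (hD : ∀ b a u, D b (g a * u) = (if b = a then u else 0) - g a * D b u)
    (K : B →ₗ[ℝ] C) (hK : ∀ a u, K (g a * u) = 0) (S : Finset (Fin k)) :
    ∀ T u, (∀ b, D b u = 0) →
      K ((S.sort (· ≤ ·)).foldl (fun v a => D a v) (oddProd g T * u)) =
        if T = S then K u else 0 := by
  induction S using Finset.induction_on_min with
  | empty =>
    intro T u _
    rcases T.eq_empty_or_nonempty with rfl | hT
    · simp
    · rw [if_neg hT.ne_empty, ← Finset.insert_erase (T.min'_mem hT), oddProd_insert_min g]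
      · simp [mul_assoc, hK]
      · exact fun b hb => T.min'_lt_of_mem_erase_min' hT hb
  | insert a S ha ih =>
    intro T u hu
    have ha' : a ∉ S := fun h' => lt_irrefl _ (ha a h')
    rw [Finset.sort_insert _ (fun b hb => (ha b hb).le) ha', List.foldl_cons,
      derivation_oddProd_mul g (D a) a (hD a), hu a, mul_zero, smul_zero, add_zero]
    by_cases haT : a ∈ T
    · rw [if_pos haT]
      have hlin : ∀ (l : List (Fin k)) (r : ℝ) (v : B),
          l.foldl (fun v a => D a v) (r • v) = r • l.foldl (fun v a => D a v) v := by
        intro l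
        induction l with
        | nil => simp
        | cons b l ihl => simp [ihl]
      rw [hlin, map_smul, ih _ u hu]
      by_cases hTS : T.erase a = S
      · have hT : T = insert a S := by rw [← hTS, Finset.insert_erase haT]
        rw [if_pos hTS, if_pos hT, hT, sgn_insert_self, sgn_of_le fun c hc => (ha c hc).le,
          one_smul]
      · rw [if_neg hTS, if_neg, smul_zero]
        rintro rfl
        exact hTS (Finset.erase_insert ha')
    · rw [if_neg haT, if_neg]
      · have hz : ∀ l : List (Fin k), l.foldl (fun v a => D a v) (0 : B) = 0 := by
          intro l
          induction l with
          | nil => simp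
          | cons b l ihl => simp [ihl]
        rw [hz, map_zero]
      · rintro rfl
        exact haT (Finset.mem_insert_self _ _)

end OrderedProducts

section Monomials
variable {m n : ℕ}

/-- The even monomial `ξ^κ`. -/
def xiPow (κ : Fin n → ℕ) : SuperAlg m n :=
  algebraMap (MvPolynomial (Fin n) ℝ) _ (∏ α, MvPolynomial.X α ^ κ α)

/-- The monomial `θ^S e^I ξ^κ`. -/
def mon (S : Finset (Fin n)) (I : Finset (Fin m)) (κ : Fin n → ℕ) : SuperAlg m n :=
  oddProd genTheta S * (oddProd genE I * xiPow κ)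

theorem monomialAt_gen (S : Finset (Fin n)) (I : Finset (Fin m)) (κ : Fin n → ℕ) :
    monomialAt genTheta genE genXi S I κ = (mon S I κ : SuperAlg m n) := by
  have h : ((List.finRange n).map fun α => (genXi α : SuperAlg m n) ^ κ α).prod = xiPow κ := by
    rw [xiPow, ← List.prod_ofFn, map_list_prod, List.ofFn_eq_map, List.map_map]
    congr 1
    refine List.map_congr_left fun α _ => ?_
    simp [genXi]
  rw [monomialAt, h, mul_assoc]
  rfl

theorem xiPow_add_single (κ : Fin n → ℕ) (α : Fin n) :
    (xiPow (κ + Pi.single α 1) : SuperAlg m n) = genXi α * xiPow κ := by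
  rw [xiPow, xiPow, genXi, ← map_mul]
  congr 1
  simp only [Pi.add_apply, pow_add, Finset.prod_mul_distrib]
  rw [mul_comm]
  congr 1
  rw [Finset.prod_eq_single α]
  · simp
  · intro β _ hβ
    simp [hβ]
  · simp

theorem dTheta_xiPow (α : Fin n) (κ : Fin n → ℕ) : dTheta α (xiPow κ : SuperAlg m n) = 0 :=
  CliffordAlgebra.contractLeft_algebraMap (Q := 0) _ _

theorem dE_xiPow (i : Fin m) (κ : Fin n → ℕ) : dE i (xiPow κ : SuperAlg m n) = 0 :=
  CliffordAlgebra.contractLeft_algebraMap (Q := 0) _ _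

theorem dXi_xiPow (α : Fin n) (κ : Fin n → ℕ) :
    dXi α (xiPow κ : SuperAlg m n) = (κ α : ℝ) • xiPow (κ - Pi.single α 1) := by
  -- induction on the exponent of the variable which is differentiated
  induction h : κ α generalizing κ with
  | zero =>
    have key : ∀ (l : List (Fin n)) , (∀ β ∈ l, β = α → κ β = 0) →
        dXi α ((l.map fun β => (genXi β : SuperAlg m n) ^ κ β).prod) = 0 := by
      intro l
      induction l with
      | nil => simp
      | cons β l ih =>
        intro hl
        have hp : ∀ k : ℕ, β ≠ α → dXi α ((genXi β : SuperAlg m n) ^ k) = 0 := by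
          intro k hβ
          induction k with
          | zero => simp
          | succ k ihk => rw [pow_succ', dXi_xi_mul, ihk, if_neg hβ.symm]; simp
        rw [List.map_cons, List.prod_cons, dXi_mul, ih fun γ hγ => hl γ (List.mem_cons_of_mem _ hγ)]
        by_cases hβ : β = α
        · simp [hl β List.mem_cons_self hβ]
        · simp [hp _ hβ]
    have h1 := key (List.finRange n) (fun β _ hβ => hβ ▸ h)
    have h2 : ((List.finRange n).map fun α => (genXi α : SuperAlg m n) ^ κ α).prod = xiPow κ := by
      have := monomialAt_gen (m := m) ∅ ∅ κ
      simpa [monomialAt, mon] using this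
    rw [← h2, h1]
    simp
  | succ k ih =>
    have h1 : κ = (κ - Pi.single α 1) + Pi.single α 1 := by
      funext β
      by_cases hβ : β = α
      · subst hβ; simp [h]
      · simp [hβ]
    have h2 : (κ - Pi.single α 1 : Fin n → ℕ) α = k := by simp [h]
    nth_rewrite 1 [h1]
    rw [xiPow_add_single, dXi_xi_mul, ih _ h2, if_pos rfl, mul_smul_comm, ← xiPow_add_single]
    rcases Nat.eq_zero_or_pos k with rfl | hk
    · simp
    · have h3 : κ - Pi.single α 1 - Pi.single α 1 + Pi.single α 1 = κ - Pi.single α 1 := by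
        funext β
        by_cases hβ : β = α
        · subst hβ; simp [h]; omega
        · simp [hβ]
      rw [h3]
      push_cast
      rw [add_smul, one_smul]

theorem xi_mul_mon (α : Fin n) (S : Finset (Fin n)) (I : Finset (Fin m)) (κ : Fin n → ℕ) :
    genXi α * (mon S I κ : SuperAlg m n) = mon S I (κ + Pi.single α 1) := by
  rw [mon, mon, xiPow_add_single, ← mul_assoc, genXi_comm, mul_assoc, ← mul_assoc (genXi α),
    genXi_comm α (oddProd _ _), mul_assoc]

theorem theta_mul_mon (α : Fin n) (S : Finset (Fin n)) (I : Finset (Fin m)) (κ : Fin n → ℕ) :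
    genTheta α * (mon S I κ : SuperAlg m n) =
      if α ∈ S then 0 else sgn S α • mon (insert α S) I κ := by
  rw [mon, ← mul_assoc, mul_oddProd _ genTheta_mul_genTheta genTheta_sq]
  split_ifs <;> simp [mon]

theorem mul_oddProd_of_anticomm {k : ℕ} {B : Type*} [Ring B] [Algebra ℝ B] (g : Fin k → B) (x : B)
    (h : ∀ a, x * g a = -(g a * x)) (S : Finset (Fin k)) (u : B) :
    x * (oddProd g S * u) = (-1 : ℝ) ^ S.card • (oddProd g S * (x * u)) :=
  anticomm_oddProd_mul g (LinearMap.mulLeft ℝ x)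
    (fun a u => by simp [← mul_assoc, h]) S u

theorem e_mul_mon (i : Fin m) (S : Finset (Fin n)) (I : Finset (Fin m)) (κ : Fin n → ℕ) :
    genE i * (mon S I κ : SuperAlg m n) =
      if i ∈ I then 0 else ((-1) ^ S.card * sgn I i) • mon S (insert i I) κ := by
  rw [mon, mul_oddProd_of_anticomm _ _ (genE_mul_genTheta i), ← mul_assoc (genE i),
    mul_oddProd _ genE_mul_genE genE_sq]
  split_ifs <;> simp [mon, smul_smul]

theorem dTheta_oddProd_genE (α : Fin n) (I : Finset (Fin m)) (κ : Fin n → ℕ) :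
    dTheta α (oddProd genE I * xiPow κ : SuperAlg m n) = 0 := by
  rw [anticomm_oddProd_mul _ _ (dTheta_e_mul α), dTheta_xiPow, mul_zero, smul_zero]

theorem dTheta_mon (α : Fin n) (S : Finset (Fin n)) (I : Finset (Fin m)) (κ : Fin n → ℕ) :
    dTheta α (mon S I κ : SuperAlg m n) =
      if α ∈ S then sgn S α • mon (S.erase α) I κ else 0 := by
  rw [mon, derivation_oddProd_mul _ _ α (dTheta_theta_mul α), dTheta_oddProd_genE]
  simp [mon]

theorem dE_mon (i : Fin m) (S : Finset (Fin n)) (I : Finset (Fin m)) (κ : Fin n → ℕ) :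
    dE i (mon S I κ : SuperAlg m n) =
      if i ∈ I then ((-1) ^ S.card * sgn I i) • mon S (I.erase i) κ else 0 := by
  rw [mon, anticomm_oddProd_mul _ _ (dE_theta_mul i), derivation_oddProd_mul _ _ i (dE_e_mul i),
    dE_xiPow]
  split_ifs <;> simp [mon, smul_smul]

theorem dXi_mon (α : Fin n) (S : Finset (Fin n)) (I : Finset (Fin m)) (κ : Fin n → ℕ) :
    dXi α (mon S I κ : SuperAlg m n) = (κ α : ℝ) • mon S I (κ - Pi.single α 1) := by
  rw [mon, comm_oddProd_mul _ _ (dXi_theta_mul α), comm_oddProd_mul _ _ (dXi_e_mul α), dXi_xiPow]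
  simp [mon]

/-- The coefficients of an element of the free supercommutative algebra with respect to the
monomials `θ^S e^I ξ^κ`. -/
theorem exists_coef (S : Finset (Fin n)) (I : Finset (Fin m)) (κ : Fin n → ℕ) :
    ∃ f : SuperAlg m n →ₗ[ℝ] ℝ, ∀ S' I' κ',
      f (mon S' I' κ') = if S' = S ∧ I' = I ∧ κ' = κ then 1 else 0 := by
  let K0 : SuperAlg m n →ₗ[ℝ] ℝ := (MvPolynomial.lcoeff ℝ (Finsupp.equivFunOnFinite.symm κ)) ∘ₗ
    ((ExteriorAlgebra.algebraMapInv (R := MvPolynomial (Fin n) ℝ)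
      (M := Fin n ⊕ Fin m → MvPolynomial (Fin n) ℝ)).restrictScalars ℝ).toLinearMap
  have inv_ι : ∀ v u, K0 (ExteriorAlgebra.ι _ v * u) = 0 := by
    intro v u
    simp [K0, ExteriorAlgebra.algebraMapInv]
  let fold : ∀ {k : ℕ} (D : Fin k → SuperAlg m n →ₗ[ℝ] SuperAlg m n) (l : List (Fin k)),
      SuperAlg m n →ₗ[ℝ] SuperAlg m n := fun D l => l.foldl (fun T a => D a ∘ₗ T) LinearMap.id
  have hfold' : ∀ {k : ℕ} (D : Fin k → SuperAlg m n →ₗ[ℝ] SuperAlg m n) (l : List (Fin k))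
      (T : SuperAlg m n →ₗ[ℝ] SuperAlg m n) u,
      (l.foldl (fun T a => D a ∘ₗ T) T) u = l.foldl (fun v a => D a v) (T u) := by
    intro k D l
    induction l with
    | nil => intro T u; rfl
    | cons a l ih => intro T u; rw [List.foldl_cons, ih]; rfl
  have hfold : ∀ {k : ℕ} (D : Fin k → SuperAlg m n →ₗ[ℝ] SuperAlg m n) (l : List (Fin k)) u,
      fold D l u = l.foldl (fun v a => D a v) u := fun D l u => hfold' D l _ u
  let K1 : SuperAlg m n →ₗ[ℝ] ℝ := K0 ∘ₗ fold dE (I.sort (· ≤ ·))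
  have hK1 : ∀ α u, K1 (genTheta α * u) = 0 := by
    intro α u
    have : ∀ (l : List (Fin m)) (r : ℝ) u, ∃ r' : ℝ, ∃ u',
        l.foldl (fun v a => dE a v) (r • (genTheta α * u)) = r' • (genTheta α * u') := by
      intro l
      induction l with
      | nil => exact fun r u => ⟨r, u, rfl⟩
      | cons a l ih =>
        intro r u
        rw [List.foldl_cons, map_smul, dE_theta_mul, smul_neg, ← neg_smul]
        exact ih _ _
    obtain ⟨r', u', h⟩ := this (I.sort (· ≤ ·)) 1 u
    rw [one_smul] at h
    rw [LinearMap.comp_apply, hfold, h, map_smul, genTheta, inv_ι, smul_zero]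
  refine ⟨K1 ∘ₗ fold dTheta (S.sort (· ≤ ·)), fun S' I' κ' => ?_⟩
  rw [LinearMap.comp_apply, hfold, mon,
    exists_coefficient genTheta dTheta dTheta_theta_mul K1 hK1 S S' _
      (fun b => dTheta_oddProd_genE b I' κ')]
  have h2 : K1 (oddProd genE I' * xiPow κ') = if I' = I then K0 (xiPow κ') else 0 := by
    rw [LinearMap.comp_apply, hfold]
    exact exists_coefficient genE dE dE_e_mul K0 (fun a u => inv_ι _ u) I I' _
      (fun b => dE_xiPow b κ')
  have h3 : K0 (xiPow κ') = if κ' = κ then 1 else 0 := by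
    have h4 : (∏ α, (MvPolynomial.X α : MvPolynomial (Fin n) ℝ) ^ κ' α) =
        MvPolynomial.monomial (Finsupp.equivFunOnFinite.symm κ') 1 := by
      rw [MvPolynomial.monomial_eq, Finsupp.prod_fintype]
      · simp
      · simp
    have h5 : (ExteriorAlgebra.algebraMapInv (R := MvPolynomial (Fin n) ℝ)
      (M := Fin n ⊕ Fin m → MvPolynomial (Fin n) ℝ)) (xiPow κ') =
        MvPolynomial.monomial (Finsupp.equivFunOnFinite.symm κ') 1 := by
      rw [xiPow, h4]
      exact ExteriorAlgebra.algebraMap_leftInverse _ _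
    change MvPolynomial.coeff _ (ExteriorAlgebra.algebraMapInv (xiPow κ')) = _
    rw [h5, MvPolynomial.coeff_monomial]
    simp
  rw [h2, h3]
  split_ifs <;> simp_all

end Monomials

/-! ### Values of local forms -/

section Families

variable {m n : ℕ} {U : TopologicalSpace.Opens (EuclideanSpace ℝ (Fin m))}

/-- The coefficient of every monomial in which some even generator has an exponent larger
than `Q` vanishes. -/
def ExpBounded (Q : ℕ) (c : LocalForm n U) : Prop :=
  ∀ S I κ, (∃ α, Q < κ α) → c S I κ = 0

theorem ExpBounded.mono {Q Q' : ℕ} {c : LocalForm n U} (h : ExpBounded Q c) (hQ : Q ≤ Q') :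
    ExpBounded Q' c :=
  fun S I κ ⟨α, hα⟩ => h S I κ ⟨α, hQ.trans_lt hα⟩

theorem ExpBounded.add {Q : ℕ} {c c' : LocalForm n U} (h : ExpBounded Q c)
    (h' : ExpBounded Q c') : ExpBounded Q (c + c') :=
  fun S I κ hκ => by simp only [Pi.add_apply, h S I κ hκ, h' S I κ hκ, add_zero]

theorem ExpBounded.smul {Q : ℕ} {c : LocalForm n U} (h : ExpBounded Q c) (r : ℝ) :
    ExpBounded Q (r • c) :=
  fun S I κ hκ => by simp only [Pi.smul_apply, h S I κ hκ, smul_zero]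

theorem ExpBounded.sub {Q : ℕ} {c c' : LocalForm n U} (h : ExpBounded Q c)
    (h' : ExpBounded Q c') : ExpBounded Q (c - c') :=
  fun S I κ hκ => by simp only [Pi.sub_apply, h S I κ hκ, h' S I κ hκ, sub_zero]

theorem ExpBounded.sum {Q : ℕ} {ι : Type*} (s : Finset ι) {c : ι → LocalForm n U}
    (h : ∀ i ∈ s, ExpBounded Q (c i)) : ExpBounded Q (∑ i ∈ s, c i) :=
  fun S I κ hκ => by
    simp only [Finset.sum_apply]
    exact Finset.sum_eq_zero fun i hi => h i hi S I κ hκ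

/-- The value of an exponentially bounded family does not depend on the range of summation. -/
theorem evalAt_of_le {Q Q' : ℕ} {c : LocalForm n U} (hc : ExpBounded Q c) (hQ : Q ≤ Q')
    (x : EuclideanSpace ℝ (Fin m)) (t : Fin n → SuperAlg m n) (h : Fin m → SuperAlg m n)
    (z : Fin n → SuperAlg m n) : evalAt Q' c x t h z = evalAt Q c x t h z := by
  unfold evalAt
  refine Finset.sum_congr rfl fun S _ => Finset.sum_congr rfl fun I _ => ?_
  symm
  refine Finset.sum_subset ?_ ?_
  · intro κ hκ
    rw [Fintype.mem_piFinset] at hκ ⊢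
    exact fun α => Finset.mem_range.2 ((Finset.mem_range.1 (hκ α)).trans_le (by omega))
  · intro κ _ hκ
    rw [Fintype.mem_piFinset] at hκ
    push Not at hκ
    obtain ⟨α, hα⟩ := hκ
    rw [Finset.mem_range] at hα
    rw [hc S I κ ⟨α, by omega⟩]
    simp

/-- The value of a coefficient family at a point, as an element of the free supercommutative
algebra. -/
def genEval (Q : ℕ) (x : EuclideanSpace ℝ (Fin m)) : LocalForm n U →ₗ[ℝ] SuperAlg m n where
  toFun c := evalAt Q c x genTheta genE genXi
  map_add' c c' := evalAt_add Q c c' x _ _ _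
  map_smul' r c := evalAt_smul Q r c x _ _ _

/-- The exponents with all entries at most `Q`. -/
abbrev expBox (n Q : ℕ) : Finset (Fin n → ℕ) :=
  Fintype.piFinset fun _ : Fin n => Finset.range (Q + 1)

theorem mem_expBox {Q : ℕ} {κ : Fin n → ℕ} : κ ∈ expBox n Q ↔ ∀ α, κ α ≤ Q := by
  simp [Fintype.mem_piFinset]

theorem genEval_apply (Q : ℕ) (x : EuclideanSpace ℝ (Fin m)) (c : LocalForm n U) :
    genEval Q x c = ∑ S, ∑ I, ∑ κ ∈ expBox n Q,
      (c S I κ : EuclideanSpace ℝ (Fin m) → ℝ) x • (mon S I κ : SuperAlg m n) := by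
  simp only [← monomialAt_gen]
  rfl

/-- Evaluation with other values of the generators is composition with an algebra
homomorphism. -/
theorem evalAt_eq_map (Q : ℕ) (x : EuclideanSpace ℝ (Fin m)) (c : LocalForm n U)
    (Φ : SuperAlg m n →ₐ[ℝ] SuperAlg m n) :
    evalAt Q c x (fun α => Φ (genTheta α)) (fun i => Φ (genE i)) (fun α => Φ (genXi α)) =
      Φ (genEval Q x c) := by
  simp only [genEval, evalAt, LinearMap.coe_mk, AddHom.coe_mk, map_sum, map_smul, monomialAt,
    map_mul, map_list_prod, List.map_map, Function.comp_def, map_pow]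

theorem genEval_injective {Q : ℕ} {c c' : LocalForm n U} (hc : ExpBounded Q c)
    (hc' : ExpBounded Q c') (h : ∀ x, genEval Q x c = genEval Q x c') : c = c' := by
  funext S I κ
  by_cases hκ : ∃ α, Q < κ α
  · rw [hc S I κ hκ, hc' S I κ hκ]
  · push Not at hκ
    ext x
    obtain ⟨f, hf⟩ := exists_coef S I κ
    have key : ∀ d : LocalForm n U,
        f (genEval Q x d) = (d S I κ : EuclideanSpace ℝ (Fin m) → ℝ) x := by
      intro d
      rw [genEval_apply]
      simp only [map_sum, map_smul, hf]
      rw [Finset.sum_eq_single S, Finset.sum_eq_single I, Finset.sum_eq_single κ]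
      · simp
      · intro κ' _ h'
        simp [h']
      · intro h'
        exact absurd (mem_expBox.2 hκ) h'
      · intro I' _ h'
        simp [h']
      · simp
      · intro S' _ h'
        simp [h']
      · simp
    rw [← key c, h x, key c']

/-! ### Operators on coefficient families -/

/-- Multiplication by `θ^α`. -/
def cTheta (α : Fin n) : LocalForm n U →ₗ[ℝ] LocalForm n U where
  toFun c S I κ := if α ∈ S then sgn S α • c (S.erase α) I κ else 0
  map_add' c c' := by funext S I κ; by_cases h : α ∈ S <;> simp [h]
  map_smul' r c := by funext S I κ; by_cases h : α ∈ S <;> simp [h, smul_comm _ r]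

/-- The derivative `∂/∂θ^α`. -/
def cDTheta (α : Fin n) : LocalForm n U →ₗ[ℝ] LocalForm n U where
  toFun c S I κ := if α ∈ S then 0 else sgn S α • c (insert α S) I κ
  map_add' c c' := by funext S I κ; by_cases h : α ∈ S <;> simp [h]
  map_smul' r c := by funext S I κ; by_cases h : α ∈ S <;> simp [h, smul_comm _ r]

/-- Multiplication by `e_i`. -/
def cE (i : Fin m) : LocalForm n U →ₗ[ℝ] LocalForm n U where
  toFun c S I κ := if i ∈ I then ((-1) ^ S.card * sgn I i) • c S (I.erase i) κ else 0
  map_add' c c' := by funext S I κ; by_cases h : i ∈ I <;> simp [h]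
  map_smul' r c := by funext S I κ; by_cases h : i ∈ I <;> simp [h, smul_comm _ r]

/-- The derivative `∂/∂e_i`. -/
def cDE (i : Fin m) : LocalForm n U →ₗ[ℝ] LocalForm n U where
  toFun c S I κ := if i ∈ I then 0 else ((-1) ^ S.card * sgn I i) • c S (insert i I) κ
  map_add' c c' := by funext S I κ; by_cases h : i ∈ I <;> simp [h]
  map_smul' r c := by funext S I κ; by_cases h : i ∈ I <;> simp [h, smul_comm _ r]

/-- Multiplication by `ξ^α`. -/
def cXi (α : Fin n) : LocalForm n U →ₗ[ℝ] LocalForm n U where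
  toFun c S I κ := if κ α = 0 then 0 else c S I (κ - Pi.single α 1)
  map_add' c c' := by funext S I κ; by_cases h : κ α = 0 <;> simp [h]
  map_smul' r c := by funext S I κ; by_cases h : κ α = 0 <;> simp [h]

/-- The derivative `∂/∂ξ^α`. -/
def cDXi (α : Fin n) : LocalForm n U →ₗ[ℝ] LocalForm n U where
  toFun c S I κ := (κ α + 1 : ℝ) • c S I (κ + Pi.single α 1)
  map_add' c c' := by funext S I κ; simp
  map_smul' r c := by funext S I κ; simp [smul_comm _ r]

/-- The derivative `∂/∂x^i` of the coefficients. -/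
def cPartial (i : Fin m) : LocalForm n U →ₗ[ℝ] LocalForm n U where
  toFun c S I κ := partialDeriv i (c S I κ)
  map_add' c c' := by funext S I κ; simp
  map_smul' r c := by funext S I κ; simp

/-- Adding or removing the element `a`. -/
def toggle {k : ℕ} (a : Fin k) : Equiv.Perm (Finset (Fin k)) :=
  Function.Involutive.toPerm (fun S => if a ∈ S then S.erase a else insert a S) (by
    intro S
    by_cases h : a ∈ S <;> simp [h])

theorem sum_toggle {k : ℕ} (a : Fin k) {B : Type*} [AddCommMonoid B] (f : Finset (Fin k) → B) :
    ∑ S, f (if a ∈ S then S.erase a else insert a S) = ∑ S, f S :=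
  Equiv.sum_comp (toggle a) f

theorem genEval_cTheta (Q : ℕ) (x : EuclideanSpace ℝ (Fin m)) (α : Fin n) (c : LocalForm n U) :
    genEval Q x (cTheta α c) = genTheta α * genEval Q x c := by
  simp only [genEval_apply, Finset.mul_sum, mul_smul_comm, theta_mul_mon]
  rw [← sum_toggle α]
  refine Finset.sum_congr rfl fun S _ => Finset.sum_congr rfl fun I _ =>
    Finset.sum_congr rfl fun κ _ => ?_
  by_cases h : α ∈ S
  · simp [cTheta, h]
  · simp [cTheta, h, sgn_insert_self, smul_smul, mul_comm]

theorem genEval_cDTheta (Q : ℕ) (x : EuclideanSpace ℝ (Fin m)) (α : Fin n) (c : LocalForm n U) :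
    genEval Q x (cDTheta α c) = dTheta α (genEval Q x c) := by
  simp only [genEval_apply, map_sum, map_smul, dTheta_mon]
  rw [← sum_toggle α]
  refine Finset.sum_congr rfl fun S _ => Finset.sum_congr rfl fun I _ =>
    Finset.sum_congr rfl fun κ _ => ?_
  by_cases h : α ∈ S
  · simp [cDTheta, h, sgn_erase_self, smul_smul, mul_comm]
  · simp [cDTheta, h]

theorem genEval_cE (Q : ℕ) (x : EuclideanSpace ℝ (Fin m)) (i : Fin m) (c : LocalForm n U) :
    genEval Q x (cE i c) = genE i * genEval Q x c := by
  simp only [genEval_apply, Finset.mul_sum, mul_smul_comm, e_mul_mon]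
  refine Finset.sum_congr rfl fun S _ => ?_
  rw [← sum_toggle i]
  refine Finset.sum_congr rfl fun I _ => Finset.sum_congr rfl fun κ _ => ?_
  by_cases h : i ∈ I
  · simp [cE, h]
  · simp [cE, h, sgn_insert_self, smul_smul, mul_comm]

theorem genEval_cDE (Q : ℕ) (x : EuclideanSpace ℝ (Fin m)) (i : Fin m) (c : LocalForm n U) :
    genEval Q x (cDE i c) = dE i (genEval Q x c) := by
  simp only [genEval_apply, map_sum, map_smul, dE_mon]
  refine Finset.sum_congr rfl fun S _ => ?_
  rw [← sum_toggle i]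
  refine Finset.sum_congr rfl fun I _ => Finset.sum_congr rfl fun κ _ => ?_
  by_cases h : i ∈ I
  · simp [cDE, h, sgn_erase_self, smul_smul, mul_comm]
  · simp [cDE, h]

/-- Shifting one exponent in a sum over a box; the terms at the boundary have to vanish. -/
theorem sum_expBox_shift {B : Type*} [AddCommMonoid B] (Q : ℕ) (α : Fin n)
    (f g : (Fin n → ℕ) → B) (hf : ∀ κ, κ α = Q → f κ = 0) (hg : ∀ κ, κ α = 0 → g κ = 0)
    (h : ∀ κ, f κ = g (κ + Pi.single α 1)) :
    ∑ κ ∈ expBox n Q, f κ = ∑ κ ∈ expBox n Q, g κ := by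
  rw [← Finset.sum_filter_of_ne (p := fun κ : Fin n → ℕ => κ α ≠ Q)
      fun κ _ hne hκ => hne (hf κ hκ),
    ← Finset.sum_filter_of_ne (f := g) (p := fun κ : Fin n → ℕ => κ α ≠ 0)
      fun κ _ hne hκ => hne (hg κ hκ)]
  refine Finset.sum_nbij' (fun κ => κ + Pi.single α 1) (fun κ => κ - Pi.single α 1) ?_ ?_ ?_ ?_ ?_
  · intro κ hκ
    rw [Finset.mem_filter, mem_expBox] at hκ ⊢
    refine ⟨fun β => ?_, by simp⟩
    have := hκ.1 β
    by_cases hβ : β = α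
    · subst hβ
      simp
      omega
    · simpa [hβ] using this
  · intro κ hκ
    rw [Finset.mem_filter, mem_expBox] at hκ ⊢
    refine ⟨fun β => ?_, ?_⟩
    · have := hκ.1 β
      simp only [Pi.sub_apply]
      omega
    · have := hκ.1 α
      have := hκ.2
      simp
      omega
  · intro κ _
    funext β
    simp
  · intro κ hκ
    rw [Finset.mem_filter] at hκ
    funext β
    by_cases hβ : β = α
    · subst hβ
      simp
      omega
    · simp [hβ]
  · intro κ _
    exact h κ

theorem genEval_cXi {Q Q' : ℕ} (x : EuclideanSpace ℝ (Fin m)) (α : Fin n) {c : LocalForm n U}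
    (hc : ExpBounded Q c) (hQ : Q < Q') :
    genEval Q' x (cXi α c) = genXi α * genEval Q' x c := by
  simp only [genEval_apply, Finset.mul_sum, mul_smul_comm, xi_mul_mon]
  refine Finset.sum_congr rfl fun S _ => Finset.sum_congr rfl fun I _ => ?_
  symm
  refine sum_expBox_shift Q' α _ _ ?_ ?_ ?_
  · intro κ hκ
    rw [hc S I κ ⟨α, by omega⟩]
    simp
  · intro κ hκ
    simp [cXi, hκ]
  · intro κ
    simp [cXi]

theorem genEval_cDXi {Q Q' : ℕ} (x : EuclideanSpace ℝ (Fin m)) (α : Fin n) {c : LocalForm n U}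
    (hc : ExpBounded Q c) (hQ : Q ≤ Q') :
    genEval Q' x (cDXi α c) = dXi α (genEval Q' x c) := by
  simp only [genEval_apply, map_sum, map_smul, dXi_mon]
  refine Finset.sum_congr rfl fun S _ => Finset.sum_congr rfl fun I _ => ?_
  refine sum_expBox_shift Q' α _ _ ?_ ?_ ?_
  · intro κ hκ
    have : c S I (κ + Pi.single α 1) = 0 := hc S I _ ⟨α, by simp; omega⟩
    simp [cDXi, this]
  · intro κ hκ
    simp [hκ]
  · intro κ
    simp [cDXi, smul_smul, mul_comm]

theorem ExpBounded.cTheta {Q : ℕ} {c : LocalForm n U} (hc : ExpBounded Q c) (α : Fin n) :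
    ExpBounded Q (cTheta α c) := by
  intro S I κ h
  simp [PictureChanging.cTheta, hc _ _ κ h]

theorem ExpBounded.cDTheta {Q : ℕ} {c : LocalForm n U} (hc : ExpBounded Q c) (α : Fin n) :
    ExpBounded Q (cDTheta α c) := by
  intro S I κ h
  simp [PictureChanging.cDTheta, hc _ _ κ h]

theorem ExpBounded.cE {Q : ℕ} {c : LocalForm n U} (hc : ExpBounded Q c) (i : Fin m) :
    ExpBounded Q (cE i c) := by
  intro S I κ h
  simp [PictureChanging.cE, hc _ _ κ h]

theorem ExpBounded.cDE {Q : ℕ} {c : LocalForm n U} (hc : ExpBounded Q c) (i : Fin m) :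
    ExpBounded Q (cDE i c) := by
  intro S I κ h
  simp [PictureChanging.cDE, hc _ _ κ h]

theorem ExpBounded.cPartial {Q : ℕ} {c : LocalForm n U} (hc : ExpBounded Q c) (i : Fin m) :
    ExpBounded Q (cPartial i c) := by
  intro S I κ h
  simp [PictureChanging.cPartial, hc _ _ κ h]

theorem ExpBounded.cXi {Q : ℕ} {c : LocalForm n U} (hc : ExpBounded Q c) (α : Fin n) :
    ExpBounded (Q + 1) (cXi α c) := by
  rintro S I κ ⟨β, h⟩
  have : c S I (κ - Pi.single α 1) = 0 := hc _ _ _ ⟨β, by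
    by_cases hβ : β = α
    · subst hβ; simp; omega
    · simp [hβ]; omega⟩
  simp [PictureChanging.cXi, this]

theorem ExpBounded.cDXi {Q : ℕ} {c : LocalForm n U} (hc : ExpBounded Q c) (α : Fin n) :
    ExpBounded Q (cDXi α c) := by
  rintro S I κ ⟨β, h⟩
  have : c S I (κ + Pi.single α 1) = 0 := hc _ _ _ ⟨β, by
    simp only [Pi.add_apply]; omega⟩
  simp [PictureChanging.cDXi, this]

theorem localD_eq (c : LocalForm n U) :
    localD c = ∑ i, cE i (cPartial i c) + ∑ α, cXi α (cDTheta α c) := by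
  funext S I κ
  simp only [localD, LinearMap.coe_mk, AddHom.coe_mk, Pi.add_apply, Finset.sum_apply]
  congr 1
  · rw [← Finset.sum_filter_add_sum_filter_not Finset.univ (fun i => i ∈ I)]
    rw [Finset.sum_eq_zero (s := Finset.univ.filter (fun i => i ∉ I)), add_zero]
    · refine Finset.sum_congr (by simp) fun i hi => ?_
      simp [cE, cPartial, (by simpa using hi : i ∈ I)]
    · intro i hi
      simp [cE, (by simpa using hi : i ∉ I)]
  · rw [Finset.sum_filter]
    refine Finset.sum_congr rfl fun α _ => ?_
    by_cases h1 : α ∈ S <;> by_cases h2 : κ α = 0 <;> simp [cXi, cDTheta, h1, h2]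

theorem localDelta_eq (c : LocalForm n U) :
    localDelta c = (-1 : ℝ) ^ n • ∑ i, cDE i (cPartial i c) - ∑ α, cDXi α (cDTheta α c) := by
  funext S I κ
  simp only [localDelta, LinearMap.coe_mk, AddHom.coe_mk, Pi.sub_apply, Pi.smul_apply,
    Finset.sum_apply, Finset.smul_sum]
  congr 1
  · rw [← Finset.sum_subset (Finset.subset_univ Iᶜ)]
    · refine Finset.sum_congr rfl fun i hi => ?_
      have : i ∉ I := by simpa using hi
      simp only [cDE, cPartial, this, LinearMap.coe_mk, AddHom.coe_mk, if_false, smul_smul]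
      congr 1
      ring
    · intro i _ hi
      have : i ∈ I := by simpa using hi
      simp [cDE, this]
  · rw [← Finset.sum_subset (Finset.subset_univ Sᶜ)]
    · refine Finset.sum_congr rfl fun i hi => ?_
      have : i ∉ S := by simpa using hi
      simp only [cDXi, cDTheta, this, LinearMap.coe_mk, AddHom.coe_mk, if_false, smul_smul]
      congr 1
      ring
    · intro i _ hi
      have : i ∈ S := by simpa using hi
      simp [cDXi, cDTheta, this]

theorem ExpBounded.localD {Q : ℕ} {c : LocalForm n U} (hc : ExpBounded Q c) :
    ExpBounded (Q + 1) (localD c) := by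
  rw [localD_eq]
  exact (ExpBounded.sum _ fun i _ => ((hc.cPartial i).cE i).mono (Nat.le_succ Q)).add
    (ExpBounded.sum _ fun α _ => (hc.cDTheta α).cXi α)

theorem ExpBounded.localDelta {Q : ℕ} {c : LocalForm n U} (hc : ExpBounded Q c) :
    ExpBounded Q (localDelta c) := by
  rw [localDelta_eq]
  exact ((ExpBounded.sum _ fun i _ => (hc.cPartial i).cDE i).smul _).sub
    (ExpBounded.sum _ fun α _ => (hc.cDTheta α).cDXi α)

theorem genEval_localD {Q Q' : ℕ} (x : EuclideanSpace ℝ (Fin m)) {c : LocalForm n U}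
    (hc : ExpBounded Q c) (hQ : Q < Q') :
    genEval Q' x (localD c) = ∑ i, genE i * genEval Q' x (cPartial i c) +
      ∑ α, genXi α * dTheta α (genEval Q' x c) := by
  rw [localD_eq, map_add, map_sum, map_sum]
  congr 1
  · exact Finset.sum_congr rfl fun i _ => genEval_cE _ _ _ _
  · exact Finset.sum_congr rfl fun α _ => by
      rw [genEval_cXi x α (hc.cDTheta α) hQ, genEval_cDTheta]

theorem genEval_localDelta {Q Q' : ℕ} (x : EuclideanSpace ℝ (Fin m)) {c : LocalForm n U}
    (hc : ExpBounded Q c) (hQ : Q ≤ Q') :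
    genEval Q' x (localDelta c) = (-1 : ℝ) ^ n • ∑ i, dE i (genEval Q' x (cPartial i c)) -
      ∑ α, dXi α (dTheta α (genEval Q' x c)) := by
  rw [localDelta_eq, map_sub, map_smul, map_sum, map_sum]
  congr 1
  · congr 1
    exact Finset.sum_congr rfl fun i _ => genEval_cDE _ _ _ _
  · exact Finset.sum_congr rfl fun α _ => by
      rw [genEval_cDXi x α (hc.cDTheta α) hQ, genEval_cDTheta]

theorem partialDeriv_comm (i j : Fin m) (g : smoothFunctions U) :
    partialDeriv i (partialDeriv j g) = partialDeriv j (partialDeriv i g) := by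
  ext x
  by_cases hx : x ∈ U
  · have hU := U.isOpen.mem_nhds hx
    have hg : ContDiffAt ℝ ∞ (g : EuclideanSpace ℝ (Fin m) → ℝ) x := g.2.1.contDiffAt hU
    have hd : DifferentiableAt ℝ (fderiv ℝ (g : EuclideanSpace ℝ (Fin m) → ℝ)) x :=
      (hg.fderiv_right (m := 1) (by norm_cast)).differentiableAt (by simp)
    have key : ∀ a b : Fin m, ((partialDeriv a (partialDeriv b g) : smoothFunctions U) :
        EuclideanSpace ℝ (Fin m) → ℝ) x = fderiv ℝ (fderiv ℝ (g : EuclideanSpace ℝ (Fin m) → ℝ)) x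
          (EuclideanSpace.single a 1) (EuclideanSpace.single b 1) := by
      intro a b
      have h1 : ((partialDeriv b g : smoothFunctions U) : EuclideanSpace ℝ (Fin m) → ℝ) =ᶠ[nhds x]
          fun y => fderiv ℝ (g : EuclideanSpace ℝ (Fin m) → ℝ) y (EuclideanSpace.single b 1) := by
        filter_upwards [hU] with y hy
        exact if_pos hy
      refine (if_pos hx).trans ?_
      rw [h1.fderiv_eq, fderiv_clm_apply hd (differentiableAt_const _)]
      simp
    rw [key, key]
    exact (hg.isSymmSndFDerivAt (by
      rw [minSmoothness_of_isRCLikeNormedField]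
      exact WithTop.coe_le_coe.2 le_top)) _ _
  · exact (if_neg hx).trans (if_neg hx).symm

theorem cPartial_comm (i j : Fin m) (c : LocalForm n U) :
    cPartial i (cPartial j c) = cPartial j (cPartial i c) := by
  funext S I κ
  exact partialDeriv_comm i j _

end Families

/-! ### The local complexes and their homotopies -/

/-- A double sum of terms that are antisymmetric in the two indices vanishes. -/
theorem sum_sum_antisymm {ι B : Type*} [Fintype ι] [AddCommGroup B] [Module ℝ B] (f : ι → ι → B)
    (h : ∀ i j, f i j = -f j i) : ∑ i, ∑ j, f i j = 0 := by
  have h1 : ∑ i, ∑ j, f i j = -∑ i, ∑ j, f i j := by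
    nth_rewrite 1 [Finset.sum_comm]
    simp only [← Finset.sum_neg_distrib]
    exact Finset.sum_congr rfl fun i _ => Finset.sum_congr rfl fun j _ => h j i
  have h2 : (2 : ℝ) • ∑ i, ∑ j, f i j = 0 := by
    rw [two_smul]
    nth_rewrite 1 [h1]
    exact neg_add_cancel _
  exact (smul_eq_zero.1 h2).resolve_left two_ne_zero

section LocalIdentities

variable {m n : ℕ} {U : TopologicalSpace.Opens (EuclideanSpace ℝ (Fin m))}

theorem cPartial_cTheta (i : Fin m) (α : Fin n) (c : LocalForm n U) :
    cPartial i (cTheta α c) = cTheta α (cPartial i c) := by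
  funext S I κ
  by_cases h : α ∈ S <;> simp [cPartial, cTheta, h]

theorem cPartial_cDTheta (i : Fin m) (α : Fin n) (c : LocalForm n U) :
    cPartial i (cDTheta α c) = cDTheta α (cPartial i c) := by
  funext S I κ
  by_cases h : α ∈ S <;> simp [cPartial, cDTheta, h]

theorem cPartial_cE (i j : Fin m) (c : LocalForm n U) :
    cPartial i (cE j c) = cE j (cPartial i c) := by
  funext S I κ
  by_cases h : j ∈ I <;> simp [cPartial, cE, h]

theorem cPartial_cDE (i j : Fin m) (c : LocalForm n U) :
    cPartial i (cDE j c) = cDE j (cPartial i c) := by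
  funext S I κ
  by_cases h : j ∈ I <;> simp [cPartial, cDE, h]

theorem cPartial_cXi (i : Fin m) (α : Fin n) (c : LocalForm n U) :
    cPartial i (cXi α c) = cXi α (cPartial i c) := by
  funext S I κ
  by_cases h : κ α = 0 <;> simp [cPartial, cXi, h]

theorem cPartial_cDXi (i : Fin m) (α : Fin n) (c : LocalForm n U) :
    cPartial i (cDXi α c) = cDXi α (cPartial i c) := by
  funext S I κ
  simp [cPartial, cDXi]

theorem cPartial_localD (i : Fin m) (c : LocalForm n U) :
    cPartial i (localD c) = localD (cPartial i c) := by
  simp only [localD_eq, map_add, map_sum, cPartial_cE, cPartial_cXi, cPartial_cDTheta,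
    cPartial_comm i]

theorem cPartial_localDelta (i : Fin m) (c : LocalForm n U) :
    cPartial i (localDelta c) = localDelta (cPartial i c) := by
  simp only [localDelta_eq, map_sub, map_smul, map_sum, cPartial_cDE, cPartial_cDXi,
    cPartial_cDTheta, cPartial_comm i]

theorem localD_localD {Q : ℕ} {c : LocalForm n U} (hc : ExpBounded Q c) :
    localD (localD c) = 0 := by
  refine genEval_injective (Q := Q + 2) hc.localD.localD (fun _ _ _ _ => rfl) fun x => ?_
  rw [map_zero, genEval_localD x hc.localD (by omega)]
  simp only [cPartial_localD, genEval_localD x (hc.cPartial _) (by omega : Q < Q + 2),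
    genEval_localD x hc (by omega : Q < Q + 2)]
  generalize genEval (Q + 2) x c = u
  have hsym : ∀ i j, genEval (Q + 2) x (cPartial i (cPartial j c)) =
      genEval (Q + 2) x (cPartial j (cPartial i c)) := fun i j => by rw [cPartial_comm]
  have h1 : ∑ i, ∑ j, (genE i : SuperAlg m n) *
      (genE j * genEval (Q + 2) x (cPartial j (cPartial i c))) = 0 := by
    refine sum_sum_antisymm _ fun i j => ?_
    rw [hsym j i, ← mul_assoc, genE_mul_genE, neg_mul, mul_assoc]
  have h2 : ∑ α, ∑ β, (genXi α : SuperAlg m n) * (genXi β * dTheta α (dTheta β u)) = 0 := by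
    refine sum_sum_antisymm _ fun α β => ?_
    rw [dTheta_dTheta, mul_neg, mul_neg, ← mul_assoc, genXi_comm α, mul_assoc]
  simp only [mul_add, Finset.sum_add_distrib, Finset.mul_sum, map_add, map_sum, h1, zero_add,
    dTheta_xi_mul, h2, add_zero]
  rw [Finset.sum_comm, ← Finset.sum_add_distrib]
  refine Finset.sum_eq_zero fun α _ => ?_
  rw [← Finset.sum_add_distrib]
  refine Finset.sum_eq_zero fun i _ => ?_
  rw [dTheta_e_mul, mul_neg, ← mul_assoc, ← mul_assoc, genXi_comm, add_neg_cancel]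

theorem localDelta_localDelta {Q : ℕ} {c : LocalForm n U} (hc : ExpBounded Q c) :
    localDelta (localDelta c) = 0 := by
  refine genEval_injective (Q := Q) hc.localDelta.localDelta (fun _ _ _ _ => rfl) fun x => ?_
  rw [map_zero, genEval_localDelta x hc.localDelta le_rfl]
  simp only [cPartial_localDelta, genEval_localDelta x (hc.cPartial _) le_rfl,
    genEval_localDelta x hc le_rfl]
  generalize genEval Q x c = u
  have hsym : ∀ i j, genEval Q x (cPartial i (cPartial j c)) =
      genEval Q x (cPartial j (cPartial i c)) := fun i j => by rw [cPartial_comm]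
  have h1 : ∑ i, ∑ j, dE i (dE j (genEval Q x (cPartial j (cPartial i c)))) = 0 := by
    refine sum_sum_antisymm _ fun i j => ?_
    rw [hsym j i, dE_dE]
  have h2 : ∑ α, ∑ β, dXi α (dTheta α (dXi β (dTheta β u))) = 0 := by
    refine sum_sum_antisymm _ fun α β => ?_
    rw [← dXi_dTheta, dTheta_dTheta, map_neg, map_neg, dXi_dXi, dXi_dTheta α]
  simp only [map_sub, map_smul, map_sum, Finset.sum_sub_distrib, ← Finset.smul_sum, h1, h2,
    smul_zero, zero_sub, sub_zero, smul_neg]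
  rw [← neg_add', neg_eq_zero, ← smul_add, Finset.sum_comm, ← Finset.sum_add_distrib]
  refine smul_eq_zero_of_right _ (Finset.sum_eq_zero fun α _ => ?_)
  rw [← Finset.sum_add_distrib]
  refine Finset.sum_eq_zero fun i _ => ?_
  rw [← dXi_dE, dE_dTheta, map_neg, neg_add_cancel]

/-! ### The contraction with the Euler vector field and the weights -/

/-- The contraction `∑ θ^α ∂/∂(dθ^α)` of superforms with the Euler vector field `∑ θ^α ∂/∂θ^α`. -/
def localIota : LocalForm n U →ₗ[ℝ] LocalForm n U := ∑ α, cTheta α ∘ₗ cDXi α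

/-- The product of integral forms with `∑ θ^α π∂_{θ^α}`, the Euler vector field. -/
def localEuler : LocalForm n U →ₗ[ℝ] LocalForm n U := ∑ α, cTheta α ∘ₗ cXi α

theorem localIota_apply (c : LocalForm n U) : localIota c = ∑ α, cTheta α (cDXi α c) := by
  simp [localIota]

theorem localEuler_apply (c : LocalForm n U) : localEuler c = ∑ α, cTheta α (cXi α c) := by
  simp [localEuler]

theorem ExpBounded.localIota {Q : ℕ} {c : LocalForm n U} (hc : ExpBounded Q c) :
    ExpBounded Q (localIota c) := by
  rw [localIota_apply]
  exact ExpBounded.sum _ fun α _ => (hc.cDXi α).cTheta α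

theorem ExpBounded.localEuler {Q : ℕ} {c : LocalForm n U} (hc : ExpBounded Q c) :
    ExpBounded (Q + 1) (localEuler c) := by
  rw [localEuler_apply]
  exact ExpBounded.sum _ fun α _ => (hc.cXi α).cTheta α

theorem genEval_localIota {Q Q' : ℕ} (x : EuclideanSpace ℝ (Fin m)) {c : LocalForm n U}
    (hc : ExpBounded Q c) (hQ : Q ≤ Q') :
    genEval Q' x (localIota c) = ∑ α, genTheta α * dXi α (genEval Q' x c) := by
  simp only [localIota_apply, map_sum, genEval_cTheta, genEval_cDXi x _ hc hQ]

theorem genEval_localEuler {Q Q' : ℕ} (x : EuclideanSpace ℝ (Fin m)) {c : LocalForm n U}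
    (hc : ExpBounded Q c) (hQ : Q < Q') :
    genEval Q' x (localEuler c) = ∑ α, genTheta α * (genXi α * genEval Q' x c) := by
  simp only [localEuler_apply, map_sum, genEval_cTheta, genEval_cXi x _ hc hQ]

theorem cPartial_localIota (i : Fin m) (c : LocalForm n U) :
    cPartial i (localIota c) = localIota (cPartial i c) := by
  simp only [localIota_apply, map_sum, cPartial_cTheta, cPartial_cDXi]

theorem cPartial_localEuler (i : Fin m) (c : LocalForm n U) :
    cPartial i (localEuler c) = localEuler (cPartial i c) := by
  simp only [localEuler_apply, map_sum, cPartial_cTheta, cPartial_cXi]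

theorem cTheta_cDTheta (α : Fin n) (c : LocalForm n U) (S : Finset (Fin n)) (I : Finset (Fin m))
    (κ : Fin n → ℕ) : cTheta α (cDTheta α c) S I κ = if α ∈ S then c S I κ else 0 := by
  by_cases h : α ∈ S
  · simp [cTheta, cDTheta, h, sgn_erase_self, smul_smul, sgn_mul_self]
  · simp [cTheta, h]

theorem cXi_cDXi (α : Fin n) (c : LocalForm n U) (S : Finset (Fin n)) (I : Finset (Fin m))
    (κ : Fin n → ℕ) : cXi α (cDXi α c) S I κ = (κ α : ℝ) • c S I κ := by
  by_cases h : κ α = 0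
  · simp [cXi, h]
  · have h1 : κ - Pi.single α 1 + Pi.single α 1 = κ := by
      funext β
      by_cases hβ : β = α
      · subst hβ; simp; omega
      · simp [hβ]
    have h2 : ((κ α - 1 : ℕ) : ℝ) + 1 = κ α := by
      rw [Nat.cast_sub (by omega)]
      simp
    simp [cXi, cDXi, h, h1, h2]

/-- The Euler operators `∑ θ^α ∂/∂θ^α` and `∑ ξ^α ∂/∂ξ^α` multiply each monomial by its degree in
`θ` and in `ξ`, respectively. -/
theorem sum_weights (c : LocalForm n U) (S : Finset (Fin n)) (I : Finset (Fin m))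
    (κ : Fin n → ℕ) : (∑ α, cTheta α (cDTheta α c)) S I κ = (S.card : ℝ) • c S I κ ∧
      (∑ α, cXi α (cDXi α c)) S I κ = (∑ α, (κ α : ℝ)) • c S I κ := by
  constructor
  · simp only [Finset.sum_apply, cTheta_cDTheta]
    rw [Finset.sum_ite_mem, Finset.univ_inter, Finset.sum_const, ← Nat.cast_smul_eq_nsmul ℝ]
  · simp only [Finset.sum_apply, cXi_cDXi, Finset.sum_smul]

/-- Cartan's formula for the Euler vector field on superforms: the Lie derivative multiplies each
monomial by its total degree in `θ` and `dθ`. -/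
theorem localD_localIota {Q : ℕ} {c : LocalForm n U} (hc : ExpBounded Q c)
    (S : Finset (Fin n)) (I : Finset (Fin m)) (κ : Fin n → ℕ) :
    (localD (localIota c) + localIota (localD c)) S I κ =
      ((S.card : ℝ) + ∑ α, (κ α : ℝ)) • c S I κ := by
  have key : localD (localIota c) + localIota (localD c) =
      ∑ α, cTheta α (cDTheta α c) + ∑ α, cXi α (cDXi α c) := by
    refine genEval_injective (Q := Q + 1) (hc.localIota.localD.add hc.localD.localIota)
      (((ExpBounded.sum _ fun α _ => (hc.cDTheta α).cTheta α).mono (Nat.le_succ Q)).add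
        (ExpBounded.sum _ fun α _ => (hc.cDXi α).cXi α)) fun x => ?_
    rw [map_add, map_add, map_sum, map_sum, genEval_localD x hc.localIota (by omega),
      genEval_localIota x hc.localD le_rfl]
    simp only [cPartial_localIota, genEval_localD x hc (Nat.lt_succ_self Q),
      genEval_localIota x hc (Nat.le_succ Q), genEval_localIota x (hc.cPartial _) (Nat.le_succ Q),
      genEval_cTheta, genEval_cDTheta, genEval_cXi x _ (hc.cDXi _) (Nat.lt_succ_self Q),
      genEval_cDXi x _ hc (Nat.le_succ Q)]
    generalize genEval (Q + 1) x c = u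
    simp only [map_add, map_sum, Finset.mul_sum, mul_add, Finset.sum_add_distrib, dXi_e_mul,
      dXi_xi_mul, dTheta_theta_mul, mul_sub, Finset.sum_sub_distrib,
      Finset.sum_ite_eq, Finset.mem_univ, if_true, ← mul_assoc, genE_mul_genTheta, neg_mul,
      Finset.sum_neg_distrib, dXi_dTheta, xi_theta]
    rw [Finset.sum_comm (f := fun i α => genTheta α * genE i * _),
      Finset.sum_comm (f := fun β α => genTheta α * genXi β * _)]
    abel
  rw [key, Pi.add_apply, Pi.add_apply, Pi.add_apply, (sum_weights c S I κ).1,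
    (sum_weights c S I κ).2, add_smul]

/-- Cartan's formula for the Euler vector field on integral forms: the Lie derivative multiplies
`θ^S 𝒟 ⊗ (π∂_x)^I (π∂_θ)^κ` by `|S| - n - |κ|`. -/
theorem localDelta_localEuler {Q : ℕ} {c : LocalForm n U} (hc : ExpBounded Q c)
    (S : Finset (Fin n)) (I : Finset (Fin m)) (κ : Fin n → ℕ) :
    (localDelta (localEuler c) + localEuler (localDelta c)) S I κ =
      ((S.card : ℝ) - n - ∑ α, (κ α : ℝ)) • c S I κ := by
  have key : localDelta (localEuler c) + localEuler (localDelta c) =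
      ∑ α, cTheta α (cDTheta α c) - ∑ α, cXi α (cDXi α c) - (n : ℝ) • c := by
    have hQ : Q < Q + 1 := Nat.lt_succ_self Q
    refine genEval_injective (Q := Q + 1) (hc.localEuler.localDelta.add hc.localDelta.localEuler)
      ((((ExpBounded.sum _ fun α _ => (hc.cDTheta α).cTheta α).mono (Nat.le_succ Q)).sub
        (ExpBounded.sum _ fun α _ => (hc.cDXi α).cXi α)).sub ((hc.smul n).mono hQ.le)) fun x => ?_
    rw [map_add, map_sub, map_sub, map_sum, map_sum, map_smul,
      genEval_localDelta x hc.localEuler le_rfl, genEval_localEuler x hc.localDelta hQ]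
    simp only [cPartial_localEuler, genEval_localDelta x hc hQ.le,
      genEval_localEuler x hc hQ, genEval_localEuler x (hc.cPartial _) hQ,
      genEval_cTheta, genEval_cDTheta, genEval_cXi x _ (hc.cDXi _) hQ,
      genEval_cDXi x _ hc hQ.le]
    generalize genEval (Q + 1) x c = u
    have hn : (n : ℝ) • u = ∑ _α : Fin n, u := by
      rw [Finset.sum_const, Finset.card_univ, Fintype.card_fin, ← Nat.cast_smul_eq_nsmul ℝ]
    rw [hn]
    simp only [map_sum, Finset.mul_sum, mul_sub, Finset.sum_sub_distrib, mul_smul_comm,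
      dE_theta_mul, dE_xi_mul, dTheta_theta_mul, dTheta_xi_mul, map_sub, dXi_theta_mul, dXi_xi_mul,
      mul_add, Finset.sum_add_distrib, Finset.sum_ite_eq,
      Finset.mem_univ, if_true, mul_ite, mul_zero, Finset.sum_neg_distrib, ← Finset.smul_sum,
      smul_neg]
    rw [Finset.sum_comm (f := fun i α => genTheta α * (genXi α * dE i _)),
      Finset.sum_comm (f := fun i α => genTheta α * (genXi α * dXi i _))]
    abel
  rw [key, Pi.sub_apply, Pi.sub_apply, Pi.sub_apply, Pi.sub_apply, Pi.sub_apply, Pi.sub_apply,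
    (sum_weights c S I κ).1, (sum_weights c S I κ).2, Pi.smul_apply, Pi.smul_apply, Pi.smul_apply]
  module

end LocalIdentities

/-! ### Contraction with multivectors and top forms -/

section Contraction

variable {m n : ℕ}

theorem isSuperSystem_contraction :
    IsSuperSystem (B := Module.End ℝ (SuperAlg m n))
      (Sum.elim (fun _ => 0) dE) (fun _ : Fin n => 0) where
  anticomm := by
    rintro (a | a) (b | b)
    · simp
    · simp
    · simp
    · ext u
      exact dE_dE a b u
  central := by simp

/-- The action by contraction: `e_{i_1} ⋯ e_{i_k}` acts as `∂/∂e_{i_1} ∘ ⋯ ∘ ∂/∂e_{i_k}`, and `θ`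
and `ξ` act as `0`. -/
def contraction : SuperAlg m n →ₐ[ℝ] Module.End ℝ (SuperAlg m n) :=
  superLift _ _ isSuperSystem_contraction

@[simp]
theorem contraction_theta (α : Fin n) : contraction (genTheta α : SuperAlg m n) = 0 :=
  superLift_theta _ _ isSuperSystem_contraction α

@[simp]
theorem contraction_e (i : Fin m) : contraction (genE i : SuperAlg m n) = dE i :=
  superLift_e _ _ isSuperSystem_contraction i

@[simp]
theorem contraction_xi (α : Fin n) : contraction (genXi α : SuperAlg m n) = 0 :=
  superLift_xi _ _ isSuperSystem_contraction α

theorem isSuperSystem_body :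
    IsSuperSystem (B := SuperAlg m n) (Sum.elim (fun _ => 0) genE) (fun _ : Fin n => 0) where
  anticomm := by
    rintro (a | a) (b | b) <;> simp [genE_mul_genE a]
  central := by simp

/-- The projection that sets all `θ` and `ξ` to `0`. -/
def body : SuperAlg m n →ₐ[ℝ] SuperAlg m n := superLift _ _ isSuperSystem_body

@[simp]
theorem body_theta (α : Fin n) : body (genTheta α : SuperAlg m n) = 0 :=
  superLift_theta _ _ isSuperSystem_body α

@[simp]
theorem body_e (i : Fin m) : body (genE i : SuperAlg m n) = genE i :=
  superLift_e _ _ isSuperSystem_body i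

@[simp]
theorem body_xi (α : Fin n) : body (genXi α : SuperAlg m n) = 0 :=
  superLift_xi _ _ isSuperSystem_body α

/-- The increasing product of all the `e_i`. -/
def eTop : SuperAlg m n := oddProd genE Finset.univ

/-- The increasing product of all the `θ^α`. -/
def thetaTop : SuperAlg m n := oddProd genTheta Finset.univ

theorem e_mul_eTop (i : Fin m) : genE i * (eTop : SuperAlg m n) = 0 := by
  rw [eTop, mul_oddProd _ genE_mul_genE genE_sq, if_pos (Finset.mem_univ i)]

theorem theta_mul_thetaTop (α : Fin n) : genTheta α * (thetaTop : SuperAlg m n) = 0 := by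
  rw [thetaTop, mul_oddProd _ genTheta_mul_genTheta genTheta_sq, if_pos (Finset.mem_univ α)]

/-- Contraction of the top form turns derivatives into products. -/
theorem contraction_dE_eTop (i : Fin m) (u : SuperAlg m n) :
    contraction (dE i u) eTop = genE i * contraction u eTop := by
  refine linearMap_ext_gen
    ((LinearMap.applyₗ (eTop : SuperAlg m n)) ∘ₗ contraction.toLinearMap ∘ₗ dE i)
    (LinearMap.mulLeft ℝ (genE i) ∘ₗ (LinearMap.applyₗ (eTop : SuperAlg m n)) ∘ₗ
      contraction.toLinearMap) ?_ ?_ ?_ ?_ u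
  · simp [e_mul_eTop]
  · intro α a h
    simp [dE_theta_mul]
  · intro j a h
    simp only [LinearMap.comp_apply, LinearMap.applyₗ_apply_apply, AlgHom.toLinearMap_apply,
      LinearMap.mulLeft_apply] at h ⊢
    rw [dE_e_mul, map_sub, map_mul, map_mul, LinearMap.sub_apply, Module.End.mul_apply,
      Module.End.mul_apply, h, contraction_e, dE_e_mul, sub_sub_eq_add_sub]
    rw [show (if i = j then a else 0 : SuperAlg m n) = if j = i then a else 0 by
      simp only [eq_comm]]
    split_ifs <;> simp
  · intro α a h
    simp [dE_xi_mul]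

/-- Contraction preserves the kernel of `D` if every derivative `∂/∂e_i` does. -/
theorem map_contraction_eq_zero (D : SuperAlg m n →ₗ[ℝ] SuperAlg m n)
    (h : ∀ i u, D u = 0 → D (dE i u) = 0) (u v : SuperAlg m n) (hv : D v = 0) :
    D (contraction u v) = 0 := by
  induction u using gen_induction with
  | one => simpa using hv
  | smul r a ha => simp [ha]
  | add a b ha hb => simp [ha, hb]
  | theta α a ha => simp
  | e i a ha => simpa using h i _ ha
  | xi α a ha => simp

theorem dTheta_contraction (α : Fin n) (u v : SuperAlg m n) (hv : dTheta α v = 0) :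
    dTheta α (contraction u v) = 0 :=
  map_contraction_eq_zero _ (fun i u hu => by
    rw [← neg_neg (dTheta α _), ← dE_dTheta, hu, map_zero, neg_zero]) u v hv

theorem dXi_contraction (α : Fin n) (u v : SuperAlg m n) (hv : dXi α v = 0) :
    dXi α (contraction u v) = 0 :=
  map_contraction_eq_zero _ (fun i u hu => by rw [dXi_dE, hu, map_zero]) u v hv

theorem dTheta_eTop (α : Fin n) : dTheta α (eTop : SuperAlg m n) = 0 := by
  have := anticomm_oddProd_mul (B := SuperAlg m n) genE (dTheta α) (dTheta_e_mul α) Finset.univ 1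
  simpa [eTop] using this

theorem dXi_eTop (α : Fin n) : dXi α (eTop : SuperAlg m n) = 0 := by
  have := comm_oddProd_mul (B := SuperAlg m n) genE (dXi α) (dXi_e_mul α) Finset.univ 1
  simpa [eTop] using this

theorem contraction_oddProd_e_mul (a : Fin m) (T : Finset (Fin m)) (ha : a ∉ T)
    (u : SuperAlg m n) : contraction (oddProd genE T) (genE a * u) =
      (-1 : ℝ) ^ T.card • (genE a * contraction (oddProd genE T) u) := by
  induction T using Finset.induction_on_min with
  | empty => simp
  | insert b T hb ih =>
    have hb' : b ∉ T := fun h => lt_irrefl _ (hb b h)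
    rw [Finset.mem_insert, not_or] at ha
    rw [oddProd_insert_min _ hb, map_mul contraction, Module.End.mul_apply, ih ha.2, contraction_e,
      map_smul,
      dE_e_mul, if_neg (Ne.symm ha.1), Finset.card_insert_of_notMem hb', pow_succ]
    simp

theorem contraction_oddProd_self (S : Finset (Fin m)) :
    contraction (oddProd genE S) (oddProd genE S : SuperAlg m n) =
      (-1 : ℝ) ^ (S.card * (S.card - 1) / 2) • 1 := by
  induction S using Finset.induction_on_min with
  | empty => simp
  | insert a T ha ih =>
    have ha' : a ∉ T := fun h => lt_irrefl _ (ha a h)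
    have h1 : contraction (oddProd genE (insert a T)) (oddProd genE (insert a T) : SuperAlg m n) =
        dE a ((-1 : ℝ) ^ T.card • (genE a * ((-1 : ℝ) ^ (T.card * (T.card - 1) / 2) • 1))) := by
      rw [oddProd_insert_min _ ha, map_mul contraction, Module.End.mul_apply,
        contraction_oddProd_e_mul a T ha',
        ih, contraction_e]
    have h2 : (T.card + 1) * (T.card + 1 - 1) / 2 = T.card + T.card * (T.card - 1) / 2 := by
      rw [Nat.triangle_succ, add_comm]
    rw [h1, Finset.card_insert_of_notMem ha', h2, pow_add, map_smul, mul_smul_comm, map_smul,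
      dE_e_mul, if_pos rfl, dE_one, mul_zero, sub_zero, smul_smul]

/-- Contracting twice with top forms which are dual to each other is the projection `body`. -/
theorem contraction_contraction (v v' : SuperAlg m n) (h1 : contraction v' v = 1)
    (h2 : ∀ i u, contraction (dE i u) v = genE i * contraction u v) (u : SuperAlg m n) :
    contraction (contraction u v') v = body u := by
  refine linearMap_ext_gen
    ((LinearMap.applyₗ v) ∘ₗ contraction.toLinearMap ∘ₗ (LinearMap.applyₗ v') ∘ₗ
      contraction.toLinearMap) body.toLinearMap ?_ ?_ ?_ ?_ u
  · simpa using h1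
  · intro α a h
    simp
  · intro i a h
    simp only [LinearMap.comp_apply, LinearMap.applyₗ_apply_apply, AlgHom.toLinearMap_apply]
      at h ⊢
    rw [map_mul, Module.End.mul_apply, contraction_e, h2, h, map_mul, body_e]
  · intro α a h
    simp

/-! ### Forms in the odd generators `e_i` only -/

/-- The element `∑ P J e^J`. -/
def evalE (P : Finset (Fin m) → ℝ) : SuperAlg m n := ∑ J, P J • oddProd genE J

theorem oddProd_genE_eq_mon (J : Finset (Fin m)) : (oddProd genE J : SuperAlg m n) = mon ∅ J 0 := by
  simp [mon, xiPow]

theorem evalE_injective {P P' : Finset (Fin m) → ℝ}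
    (h : (evalE P : SuperAlg m n) = evalE P') : P = P' := by
  funext J
  obtain ⟨f, hf⟩ := exists_coef (m := m) (n := n) ∅ J 0
  have key : ∀ P : Finset (Fin m) → ℝ, f (evalE P) = P J := by
    intro P
    simp [evalE, oddProd_genE_eq_mon, hf]
  rw [← key P, h, key]

theorem evalE_contract (i : Fin m) (P : Finset (Fin m) → ℝ) :
    (evalE (contract i P) : SuperAlg m n) = dE i (evalE P) := by
  simp only [evalE, map_sum, map_smul, oddProd_genE_eq_mon, dE_mon]
  rw [← sum_toggle i]
  refine Finset.sum_congr rfl fun J _ => ?_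
  by_cases h : i ∈ J
  · simp [contract, h, sgn_erase_self, smul_smul, mul_comm]
  · simp [contract, h]

theorem evalE_contractAll (I : Finset (Fin m)) (P : Finset (Fin m) → ℝ) :
    (evalE (contractAll I P) : SuperAlg m n) = contraction (oddProd genE I) (evalE P) := by
  rw [contractAll, oddProd]
  induction I.sort (· ≤ ·) with
  | nil => simp
  | cons i l ih =>
    rw [List.foldr_cons, evalE_contract, ih, List.map_cons, List.prod_cons, map_mul,
      Module.End.mul_apply, contraction_e]

theorem evalE_increasingTop : (evalE increasingTop : SuperAlg m n) = eTop := by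
  simp [evalE, increasingTop, eTop]

theorem evalE_decreasingTop :
    (evalE decreasingTop : SuperAlg m n) = (-1 : ℝ) ^ (m * (m - 1) / 2) • eTop := by
  rw [← evalE_increasingTop, evalE, evalE, Finset.smul_sum]
  simp only [smul_smul, decreasingTop]

theorem contraction_eTop_eTop :
    contraction (eTop : SuperAlg m n) eTop = (-1 : ℝ) ^ (m * (m - 1) / 2) • 1 := by
  have := contraction_oddProd_self (n := n) (Finset.univ : Finset (Fin m))
  simpa [eTop] using this

/-- Contraction with a top form `P` and contraction with a dual top form `P'`, in terms of
coefficients, are inverse to each other. The conditions are those of `contraction_contraction`. -/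
theorem sum_contractAll_mul {P P' : Finset (Fin m) → ℝ}
    (h1 : contraction (evalE P' : SuperAlg m 0) (evalE P) = 1)
    (h2 : ∀ i u, contraction (dE i u) (evalE P : SuperAlg m 0) = genE i * contraction u (evalE P))
    (J K : Finset (Fin m)) :
    ∑ I, contractAll I P J * contractAll K P' I = if J = K then 1 else 0 := by
  have key : (evalE (fun J => ∑ I, contractAll I P J * contractAll K P' I) : SuperAlg m 0) =
      evalE (fun J => if J = K then 1 else 0) := by
    have h3 : (evalE (fun J => if J = K then 1 else 0) : SuperAlg m 0) = oddProd genE K := by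
      simp [evalE]
    have h4 : body (oddProd genE K : SuperAlg m 0) = oddProd genE K := by
      rw [map_oddProd]
      simp
    rw [h3, ← h4, ← contraction_contraction _ _ h1 h2, ← evalE_contractAll]
    conv_rhs => rw [evalE, map_sum, LinearMap.sum_apply]
    simp only [map_smul, LinearMap.smul_apply, ← evalE_contractAll]
    simp only [evalE, Finset.smul_sum, Finset.sum_smul, smul_smul]
    rw [Finset.sum_comm]
    simp only [mul_comm]
  exact congrFun (evalE_injective key) J

theorem neg_one_pow_smul_self {W : Type*} [AddCommGroup W] [Module ℝ W] (k : ℕ) (w : W) :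
    (-1 : ℝ) ^ k • (-1 : ℝ) ^ k • w = w := by
  rw [smul_smul, ← mul_pow]
  simp

theorem sum_increasing_decreasing (J K : Finset (Fin m)) :
    ∑ I, contractAll I increasingTop J * contractAll K decreasingTop I =
      if J = K then 1 else 0 := by
  refine sum_contractAll_mul ?_ ?_ J K
  · rw [evalE_increasingTop, evalE_decreasingTop, map_smul, LinearMap.smul_apply,
      contraction_eTop_eTop, neg_one_pow_smul_self]
  · rw [evalE_increasingTop]
    exact contraction_dE_eTop

theorem sum_decreasing_increasing (J K : Finset (Fin m)) :
    ∑ I, contractAll I decreasingTop J * contractAll K increasingTop I =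
      if J = K then 1 else 0 := by
  refine sum_contractAll_mul ?_ ?_ J K
  · rw [evalE_increasingTop, evalE_decreasingTop, map_smul,
      contraction_eTop_eTop, neg_one_pow_smul_self]
  · intro i u
    rw [evalE_decreasingTop, map_smul, contraction_dE_eTop, map_smul, mul_smul_comm]

theorem contract_card {i : Fin m} {P : Finset (Fin m) → ℝ} {k : ℕ}
    (hP : ∀ J, P J ≠ 0 → J.card + k = m) (J : Finset (Fin m)) (hJ : contract i P J ≠ 0) :
    J.card + (k + 1) = m := by
  by_cases h : i ∈ J
  · simp [contract, h] at hJ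
  · simp only [contract, h, if_false] at hJ
    have := hP _ (right_ne_zero_of_mul hJ)
    rw [Finset.card_insert_of_notMem h] at this
    omega

/-- Contracting a top form with `I` yields terms of the complementary degree only. -/
theorem card_of_contractAll_ne_zero {P : Finset (Fin m) → ℝ}
    (hP : ∀ J, P J ≠ 0 → J = Finset.univ) (I J : Finset (Fin m)) (h : contractAll I P J ≠ 0) :
    J.card + I.card = m := by
  have key : ∀ (l : List (Fin m)) (J : Finset (Fin m)), l.foldr contract P J ≠ 0 →
      J.card + l.length = m := by
    intro l
    induction l with
    | nil =>
      intro J hJ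
      rw [hP J hJ]
      simp
    | cons i l ih => exact fun J hJ => contract_card ih J hJ
  have := key _ J h
  rwa [Finset.length_sort] at this

theorem increasingTop_ne_zero (J : Finset (Fin m)) (h : increasingTop J ≠ 0) :
    J = Finset.univ := by
  by_contra h'
  simp [increasingTop, h'] at h

theorem decreasingTop_ne_zero (J : Finset (Fin m)) (h : decreasingTop J ≠ 0) :
    J = Finset.univ :=
  increasingTop_ne_zero J (right_ne_zero_of_mul h)

end Contraction

section LocalMaps

variable {m n : ℕ} {U : TopologicalSpace.Opens (EuclideanSpace ℝ (Fin m))}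

/-- The family `a` as coefficients of the pure products `e^I`. -/
def pureE (a : Finset (Fin m) → smoothFunctions U) : LocalForm n U :=
  fun S I κ => if S = ∅ ∧ κ = 0 then a I else 0

theorem ExpBounded.pureE (Q : ℕ) (a : Finset (Fin m) → smoothFunctions U) :
    ExpBounded Q (pureE a : LocalForm n U) := by
  rintro S I κ ⟨α, hα⟩
  have : κ ≠ 0 := by
    rintro rfl
    simp at hα
  simp [PictureChanging.pureE, this]

theorem sum_expBox_zero {B : Type*} [AddCommMonoid B] (Q : ℕ) (f : (Fin n → ℕ) → B)
    (hf : ∀ κ, κ ≠ 0 → f κ = 0) : ∑ κ ∈ expBox n Q, f κ = f 0 :=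
  Finset.sum_eq_single 0 (fun κ _ hκ => hf κ hκ) fun h => absurd (mem_expBox.2 (by simp)) h

theorem genEval_pureE (Q : ℕ) (x : EuclideanSpace ℝ (Fin m))
    (a : Finset (Fin m) → smoothFunctions U) :
    genEval Q x (pureE a : LocalForm n U) =
      ∑ I, (a I : EuclideanSpace ℝ (Fin m) → ℝ) x • oddProd genE I := by
  rw [genEval_apply, Finset.sum_eq_single ∅]
  · refine Finset.sum_congr rfl fun I _ => ?_
    rw [sum_expBox_zero, oddProd_genE_eq_mon]
    · simp [pureE]
    · intro κ hκ
      simp [pureE, hκ]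
  · intro S _ hS
    simp [pureE, hS]
  · simp

theorem mon_eq_theta_mul (S : Finset (Fin n)) (hS : S ≠ ∅) (I : Finset (Fin m)) (κ : Fin n → ℕ) :
    ∃ α u, (mon S I κ : SuperAlg m n) = genTheta α * u := by
  have hT := Finset.nonempty_iff_ne_empty.2 hS
  refine ⟨S.min' hT, oddProd genTheta (S.erase (S.min' hT)) * (oddProd genE I * xiPow κ), ?_⟩
  rw [← mul_assoc (genTheta _), ← oddProd_insert_min, Finset.insert_erase (S.min'_mem hT), mon]
  exact fun b hb => S.min'_lt_of_mem_erase_min' hT hb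

theorem mon_eq_xi_mul (S : Finset (Fin n)) (I : Finset (Fin m)) (κ : Fin n → ℕ) (hκ : κ ≠ 0) :
    ∃ α u, (mon S I κ : SuperAlg m n) = genXi α * u := by
  obtain ⟨α, hα⟩ := Function.ne_iff.1 hκ
  refine ⟨α, mon S I (κ - Pi.single α 1), ?_⟩
  rw [xi_mul_mon]
  congr 1
  funext β
  by_cases hβ : β = α
  · subst hβ
    simp at hα ⊢
    omega
  · simp [hβ]

/-- Homomorphisms that kill `θ` and `ξ` only see the coefficients of the pure products `e^I`. -/
theorem map_genEval_pure {B : Type*} [Ring B] [Algebra ℝ B] (Φ : SuperAlg m n →ₐ[ℝ] B)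
    (hθ : ∀ α, Φ (genTheta α) = 0) (hξ : ∀ α, Φ (genXi α) = 0) (Q : ℕ)
    (x : EuclideanSpace ℝ (Fin m)) (w : LocalForm n U) :
    Φ (genEval Q x w) = Φ (genEval Q x (pureE (fun I => w ∅ I 0) : LocalForm n U)) := by
  rw [genEval_pureE, genEval_apply, map_sum, Finset.sum_eq_single ∅, map_sum, map_sum]
  · refine Finset.sum_congr rfl fun I _ => ?_
    rw [map_sum, sum_expBox_zero, oddProd_genE_eq_mon]
    intro κ hκ
    obtain ⟨α, u, h⟩ := mon_eq_xi_mul (m := m) ∅ I κ hκ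
    rw [map_smul, h, map_mul, hξ, zero_mul, smul_zero]
  · intro S _ hS
    simp only [map_sum]
    refine Finset.sum_eq_zero fun I _ => Finset.sum_eq_zero fun κ _ => ?_
    obtain ⟨α, u, h⟩ := mon_eq_theta_mul S hS I κ
    rw [map_smul, h, map_mul, hθ, zero_mul, smul_zero]
  · simp

theorem genEval_contractAll (Q : ℕ) (x : EuclideanSpace ℝ (Fin m)) (P : Finset (Fin m) → ℝ)
    (a : Finset (Fin m) → smoothFunctions U) :
    genEval Q x (pureE (fun J => ∑ I, contractAll I P J • a I) : LocalForm n U) =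
      contraction (genEval Q x (pureE a : LocalForm n U)) (evalE P) := by
  rw [genEval_pureE, genEval_pureE, map_sum, LinearMap.sum_apply]
  simp only [map_smul, LinearMap.smul_apply, ← evalE_contractAll]
  simp only [evalE, Finset.smul_sum, AddSubmonoidClass.coe_finsetSum, Finset.sum_apply,
    Submodule.coe_smul, Pi.smul_apply, Finset.sum_smul, smul_smul, smul_eq_mul]
  rw [Finset.sum_comm]
  simp only [mul_comm]

/-- The family obtained from `a` by multiplication with `θ^1 ⋯ θ^n`. -/
def topE (a : Finset (Fin m) → smoothFunctions U) : LocalForm n U :=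
  fun S I κ => if S = Finset.univ ∧ κ = 0 then a I else 0

theorem ExpBounded.topE (Q : ℕ) (a : Finset (Fin m) → smoothFunctions U) :
    ExpBounded Q (topE a : LocalForm n U) := by
  rintro S I κ ⟨α, hα⟩
  have : κ ≠ 0 := by
    rintro rfl
    simp at hα
  simp [PictureChanging.topE, this]

theorem genEval_topE (Q : ℕ) (x : EuclideanSpace ℝ (Fin m))
    (a : Finset (Fin m) → smoothFunctions U) :
    genEval Q x (topE a : LocalForm n U) =
      thetaTop * genEval Q x (pureE a : LocalForm n U) := by
  rw [genEval_pureE, genEval_apply, Finset.mul_sum, Finset.sum_eq_single Finset.univ]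
  · refine Finset.sum_congr rfl fun I _ => ?_
    rw [sum_expBox_zero]
    · simp [topE, mon, xiPow, thetaTop]
    · intro κ hκ
      simp [topE, hκ]
  · intro S _ hS
    simp [topE, hS]
  · simp

theorem localPCO_eq (w : LocalForm n U) :
    localPCO w = topE (fun J => ∑ I, contractAll I decreasingTop J • w ∅ I 0) := rfl

theorem localZ_eq (σ : LocalForm n U) :
    localZ σ = pureE (fun J => ∑ I, contractAll I increasingTop J • σ Finset.univ I 0) := rfl

theorem ExpBounded.localPCO (Q : ℕ) (w : LocalForm n U) : ExpBounded Q (localPCO w) :=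
  ExpBounded.topE Q _

theorem ExpBounded.localZ (Q : ℕ) (σ : LocalForm n U) : ExpBounded Q (localZ σ) :=
  ExpBounded.pureE Q _

theorem genEval_localPCO (Q : ℕ) (x : EuclideanSpace ℝ (Fin m)) (w : LocalForm n U) :
    genEval Q x (localPCO w) = thetaTop *
      contraction (genEval Q x w) ((-1 : ℝ) ^ (m * (m - 1) / 2) • eTop) := by
  rw [localPCO_eq, genEval_topE, genEval_contractAll, evalE_decreasingTop,
    ← map_genEval_pure contraction contraction_theta contraction_xi]

theorem genEval_localZ (Q : ℕ) (x : EuclideanSpace ℝ (Fin m)) (σ : LocalForm n U) :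
    genEval Q x (localZ σ) =
      contraction (genEval Q x (pureE (fun I => σ Finset.univ I 0) : LocalForm n U)) eTop := by
  rw [localZ_eq, genEval_contractAll, evalE_increasingTop]

/-- `Z ∘ f` is the projection to the terms without `θ` and `dθ`. -/
theorem localZ_localPCO (w : LocalForm n U) :
    localZ (localPCO w) = pureE (fun I => w ∅ I 0) := by
  rw [localZ_eq]
  congr 1
  funext J
  have : ∀ I, localPCO w Finset.univ I 0 = ∑ K, contractAll K decreasingTop I • w ∅ K 0 :=
    fun I => if_pos ⟨rfl, rfl⟩
  simp only [this, Finset.smul_sum, smul_smul]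
  rw [Finset.sum_comm]
  simp only [← Finset.sum_smul, sum_increasing_decreasing]
  simp

/-- `f ∘ Z` is the projection to the terms with top degree in `θ` and without `π∂_θ`. -/
theorem localPCO_localZ (σ : LocalForm n U) :
    localPCO (localZ σ) = topE (fun I => σ Finset.univ I 0) := by
  rw [localPCO_eq]
  congr 1
  funext J
  have : ∀ I, localZ σ ∅ I 0 = ∑ K, contractAll K increasingTop I • σ Finset.univ K 0 :=
    fun I => if_pos ⟨rfl, rfl⟩
  simp only [this, Finset.smul_sum, smul_smul]
  rw [Finset.sum_comm]
  simp only [← Finset.sum_smul, sum_decreasing_increasing]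
  simp

theorem localPCO_localZ_localPCO (w : LocalForm n U) :
    localPCO (localZ (localPCO w)) = localPCO w := by
  rw [localZ_localPCO]
  funext S I κ
  simp [localPCO, pureE]

theorem localZ_localPCO_localZ (σ : LocalForm n U) :
    localZ (localPCO (localZ σ)) = localZ σ := by
  rw [localPCO_localZ]
  funext S I κ
  simp [localZ, topE]

theorem cPartial_localPCO (i : Fin m) (w : LocalForm n U) :
    cPartial i (localPCO w) = localPCO (cPartial i w) := by
  funext S J κ
  by_cases h : S = Finset.univ ∧ κ = 0 <;> simp [cPartial, localPCO, h]

theorem cPartial_localZ (i : Fin m) (w : LocalForm n U) :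
    cPartial i (localZ w) = localZ (cPartial i w) := by
  funext S J κ
  by_cases h : S = ∅ ∧ κ = 0 <;> simp [cPartial, localZ, h]

/-- The PCO map is a cochain map: contraction turns the product with `dx^i` into
`∂/∂(π∂_{x^i})`, and the sign `(-1)^n` of `δ` is cancelled by the parity `n` of `θ^1 ⋯ θ^n`. -/
theorem localPCO_localD {Q : ℕ} {w : LocalForm n U} (hw : ExpBounded Q w) :
    localPCO (localD w) = localDelta (localPCO w) := by
  refine genEval_injective (Q := Q + 1) (ExpBounded.localPCO _ _)
    (ExpBounded.localPCO _ _).localDelta fun x => ?_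
  rw [genEval_localPCO, genEval_localD x hw (Nat.lt_succ_self Q),
    genEval_localDelta x (ExpBounded.localPCO (Q + 1) w) le_rfl]
  simp only [cPartial_localPCO, genEval_localPCO]
  have h1 : ∀ α, dXi α (dTheta α (thetaTop * contraction (genEval (Q + 1) x w)
      ((-1 : ℝ) ^ (m * (m - 1) / 2) • eTop))) = 0 := by
    intro α
    rw [dXi_dTheta, thetaTop, comm_oddProd_mul _ _ (dXi_theta_mul α), map_smul, map_smul,
      dXi_contraction _ _ _ (dXi_eTop α), smul_zero, mul_zero, map_zero]
  have h2 : ∀ i u, dE i (thetaTop * u : SuperAlg m n) = (-1 : ℝ) ^ n • (thetaTop * dE i u) := by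
    intro i u
    rw [thetaTop, anticomm_oddProd_mul _ _ (dE_theta_mul i)]
    simp
  simp only [h1, Finset.sum_const_zero, sub_zero, h2, ← Finset.smul_sum, neg_one_pow_smul_self]
  rw [map_add, map_sum, map_sum, LinearMap.add_apply, LinearMap.sum_apply, LinearMap.sum_apply,
    ← Finset.mul_sum]
  simp

/-- The map `Z` is a cochain map: contraction turns `∂/∂(π∂_{x^i})` into the product with
`dx^i`, by `contraction_dE_eTop`. -/
theorem localZ_localDelta (σ : LocalForm n U) : localZ (localDelta σ) = localD (localZ σ) := by
  refine genEval_injective (Q := 1) (ExpBounded.localZ _ _)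
    (ExpBounded.localZ 0 _).localD fun x => ?_
  rw [genEval_localZ, genEval_localD x (ExpBounded.localZ 0 σ) Nat.zero_lt_one]
  simp only [cPartial_localZ, genEval_localZ, dTheta_contraction _ _ _ (dTheta_eTop _), mul_zero,
    Finset.sum_const_zero, add_zero, ← contraction_dE_eTop]
  rw [← LinearMap.sum_apply, ← map_sum]
  simp only [← genEval_cDE]
  rw [← map_sum]
  congr 3
  funext S I κ
  rw [Finset.sum_apply, Finset.sum_apply, Finset.sum_apply]
  by_cases h : S = ∅ ∧ κ = 0
  · rw [pureE, if_pos h]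
    have h3 : ∀ i, cDE i (pureE (fun I => cPartial i σ Finset.univ I 0) : LocalForm n U) S I κ =
        if i ∈ I then 0 else sgn I i • partialDeriv i (σ Finset.univ (insert i I) 0) := by
      intro i
      simp [cDE, pureE, h, cPartial]
    rw [Finset.sum_congr rfl fun i _ => h3 i]
    simp only [localDelta, LinearMap.coe_mk, AddHom.coe_mk, Finset.compl_univ, Finset.sum_empty,
      sub_zero, Finset.card_univ, Fintype.card_fin, ← mul_pow, pow_add, neg_mul_neg, one_mul,
      one_pow]
    rw [← Finset.sum_subset (Finset.subset_univ Iᶜ)]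
    · refine Finset.sum_congr rfl fun i hi => ?_
      rw [if_neg (by simpa using hi)]
    · intro i _ hi
      rw [if_pos (by simpa using hi)]
  · rw [pureE, if_neg h]
    refine (Finset.sum_eq_zero fun i _ => ?_).symm
    simp [cDE, pureE, h]

end LocalMaps

/-! ### Derivatives of maps to an algebra -/

section Calculus

variable {m : ℕ} {B : Type*} [Ring B] [Algebra ℝ B]

/-- The partial derivative `∂f/∂x^i` at `x`. -/
def pd (i : Fin m) (f : EuclideanSpace ℝ (Fin m) → ℝ) (x : EuclideanSpace ℝ (Fin m)) : ℝ :=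
  fderiv ℝ f x (EuclideanSpace.single i 1)

theorem pd_mul {x : EuclideanSpace ℝ (Fin m)} {f g : EuclideanSpace ℝ (Fin m) → ℝ}
    (hf : DifferentiableAt ℝ f x) (hg : DifferentiableAt ℝ g x) (i : Fin m) :
    pd i (fun y => f y * g y) x = pd i f x * g x + f x * pd i g x := by
  simp [pd, fderiv_fun_mul hf hg]
  ring

theorem pd_sum {x : EuclideanSpace ℝ (Fin m)} {ι : Type*} (s : Finset ι)
    {f : ι → EuclideanSpace ℝ (Fin m) → ℝ} (hf : ∀ a ∈ s, DifferentiableAt ℝ (f a) x) (i : Fin m) :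
    pd i (fun y => ∑ a ∈ s, f a y) x = ∑ a ∈ s, pd i (f a) x := by
  simp [pd, fderiv_fun_sum hf]

theorem pd_congr {x : EuclideanSpace ℝ (Fin m)} {f g : EuclideanSpace ℝ (Fin m) → ℝ}
    (h : f =ᶠ[nhds x] g) (i : Fin m) : pd i f x = pd i g x := by
  rw [pd, pd, h.fderiv_eq]

theorem pd_const (x : EuclideanSpace ℝ (Fin m)) (r : ℝ) (i : Fin m) :
    pd i (fun _ => r) x = 0 := by
  simp [pd]

theorem pd_comp {x : EuclideanSpace ℝ (Fin m)} {f : EuclideanSpace ℝ (Fin m) → ℝ}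
    {φ : EuclideanSpace ℝ (Fin m) → EuclideanSpace ℝ (Fin m)} (hφ : DifferentiableAt ℝ φ x)
    (hf : DifferentiableAt ℝ f (φ x)) (i : Fin m) :
    pd i (fun y => f (φ y)) x =
      ∑ j, fderiv ℝ φ x (EuclideanSpace.single i 1) j * pd j f (φ x) := by
  have h1 : fderiv ℝ (fun y => f (φ y)) x = (fderiv ℝ f (φ x)).comp (fderiv ℝ φ x) :=
    fderiv_comp x hf hφ
  have h2 : ∀ v : EuclideanSpace ℝ (Fin m),
      fderiv ℝ f (φ x) v = ∑ j, v j * pd j f (φ x) := by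
    intro v
    have hv : v = ∑ j, v j • EuclideanSpace.single j (1 : ℝ) := by
      ext k
      simp [Pi.single_apply]
    conv_lhs => rw [hv]
    simp [pd]
  rw [pd, h1, ContinuousLinearMap.comp_apply, h2]

/-- `HasDer x F F'` says that the function `F` with values in the algebra `B`, which carries no
topology, is near `x` a combination of fixed elements of `B` with coefficients differentiable
at `x`, and that `F' i` is its partial derivative `∂F/∂x^i` at `x`. -/
inductive HasDer (x : EuclideanSpace ℝ (Fin m)) :
    (EuclideanSpace ℝ (Fin m) → B) → (Fin m → B) → Prop
  | smul_const (f : EuclideanSpace ℝ (Fin m) → ℝ) (v : B) (hf : DifferentiableAt ℝ f x) :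
      HasDer x (fun y => f y • v) (fun i => pd i f x • v)
  | add {F G : EuclideanSpace ℝ (Fin m) → B} {F' G' : Fin m → B} (hF : HasDer x F F')
      (hG : HasDer x G G') : HasDer x (fun y => F y + G y) (fun i => F' i + G' i)
  | congr {F G : EuclideanSpace ℝ (Fin m) → B} {F' : Fin m → B} (hF : HasDer x F F')
      (h : G =ᶠ[nhds x] F) : HasDer x G F'

namespace HasDer

variable {x : EuclideanSpace ℝ (Fin m)} {F G : EuclideanSpace ℝ (Fin m) → B} {F' G' : Fin m → B}

theorem congr_der (hF : HasDer x F F') (h : ∀ i, F' i = G' i) : HasDer x F G' := by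
  rwa [← funext h]

theorem const (v : B) : HasDer x (fun _ => v) (fun _ => 0) := by
  refine ((HasDer.smul_const (fun _ => 1) v (differentiableAt_const _)).congr
    (Filter.Eventually.of_forall fun y => ?_)).congr_der fun i => ?_
  · simp
  · rw [pd_const, zero_smul]

theorem sum {ι : Type*} (s : Finset ι) {F : ι → EuclideanSpace ℝ (Fin m) → B}
    {F' : ι → Fin m → B} (h : ∀ a ∈ s, HasDer x (F a) (F' a)) :
    HasDer x (fun y => ∑ a ∈ s, F a y) (fun i => ∑ a ∈ s, F' a i) := by
  classical
  induction s using Finset.induction_on with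
  | empty => simpa using HasDer.const (x := x) (0 : B)
  | insert a s ha ih =>
    simp only [Finset.sum_insert ha]
    exact (h a (Finset.mem_insert_self _ _)).add
      (ih fun b hb => h b (Finset.mem_insert_of_mem hb))

theorem map {C : Type*} [Ring C] [Algebra ℝ C] (hF : HasDer x F F') (L : B →ₗ[ℝ] C) :
    HasDer x (fun y => L (F y)) (fun i => L (F' i)) := by
  induction hF with
  | smul_const f v hf =>
    simp only [map_smul]
    exact HasDer.smul_const f (L v) hf
  | add _ _ h1 h2 =>
    simp only [map_add]
    exact h1.add h2
  | congr _ h ih => exact ih.congr (h.mono fun y hy => by simp only [hy])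

theorem smul (hF : HasDer x F F') {f : EuclideanSpace ℝ (Fin m) → ℝ}
    (hf : DifferentiableAt ℝ f x) :
    HasDer x (fun y => f y • F y) (fun i => pd i f x • F x + f x • F' i) := by
  induction hF with
  | smul_const g v hg =>
    simp only [smul_smul]
    refine (HasDer.smul_const (fun y => f y * g y) v (hf.mul hg)).congr_der fun i => ?_
    rw [pd_mul hf hg, add_smul]
  | add _ _ h1 h2 =>
    simp only [smul_add]
    exact (h1.add h2).congr_der fun i => by abel
  | congr _ h ih =>
    refine (ih.congr (h.mono fun y hy => by simp only [hy])).congr_der fun i => ?_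
    rw [h.self_of_nhds]

/-- The product rule for a variable linear map applied to a variable vector. -/
theorem apply {C : Type*} [Ring C] [Algebra ℝ C] (hF : HasDer x F F')
    {T : EuclideanSpace ℝ (Fin m) → B →ₗ[ℝ] C} {T' : Fin m → B →ₗ[ℝ] C}
    (hT : ∀ u, HasDer x (fun y => T y u) (fun i => T' i u)) :
    HasDer x (fun y => T y (F y)) (fun i => T' i (F x) + T x (F' i)) := by
  induction hF with
  | smul_const f v hf =>
    simp only [map_smul]
    exact ((hT v).smul hf).congr_der fun i => by abel
  | add _ _ h1 h2 =>
    simp only [map_add]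
    exact (h1.add h2).congr_der fun i => by abel
  | congr _ h ih =>
    refine (ih.congr (h.mono fun y hy => by simp only [hy])).congr_der fun i => ?_
    rw [h.self_of_nhds]

theorem mul (hF : HasDer x F F') (hG : HasDer x G G') :
    HasDer x (fun y => F y * G y) (fun i => F' i * G x + F x * G' i) :=
  hG.apply (T := fun y => LinearMap.mulLeft ℝ (F y)) (T' := fun i => LinearMap.mulLeft ℝ (F' i))
    fun u => hF.map (LinearMap.mulRight ℝ u)

theorem comp {φ : EuclideanSpace ℝ (Fin m) → EuclideanSpace ℝ (Fin m)}
    (hφ : DifferentiableAt ℝ φ x) (hF : HasDer (φ x) F F') :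
    HasDer x (fun y => F (φ y))
      (fun i => ∑ j, fderiv ℝ φ x (EuclideanSpace.single i 1) j • F' j) := by
  induction hF with
  | smul_const f v hf =>
    refine (HasDer.smul_const (fun y => f (φ y)) v (hf.comp x hφ)).congr_der fun i => ?_
    rw [pd_comp hφ hf, Finset.sum_smul]
    simp only [smul_smul]
  | add _ _ h1 h2 =>
    refine (h1.add h2).congr_der fun i => ?_
    simp only [smul_add, Finset.sum_add_distrib]
  | congr _ h ih => exact ih.congr (hφ.continuousAt.eventually h)

theorem functional (hF : HasDer x F F') (l : B →ₗ[ℝ] ℝ) :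
    DifferentiableAt ℝ (fun y => l (F y)) x ∧ ∀ i, pd i (fun y => l (F y)) x = l (F' i) := by
  induction hF with
  | smul_const f v hf =>
    simp only [map_smul, smul_eq_mul]
    refine ⟨hf.mul_const _, fun i => ?_⟩
    rw [pd_mul hf (differentiableAt_const _), pd_const, mul_zero, add_zero]
  | add _ _ h1 h2 =>
    simp only [map_add]
    refine ⟨h1.1.add h2.1, fun i => ?_⟩
    rw [← h1.2 i, ← h2.2 i, pd, fderiv_fun_add h1.1 h2.1]
    rfl
  | @congr F G F' _ h ih =>
    have h' : (fun y => l (G y)) =ᶠ[nhds x] fun y => l (F y) := h.mono fun y hy => congrArg l hy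
    exact ⟨ih.1.congr_of_eventuallyEq h', fun i => (pd_congr h' i).trans (ih.2 i)⟩

theorem unique (h1 : HasDer x F F') (h2 : HasDer x F G') (i : Fin m) : F' i = G' i := by
  rw [← sub_eq_zero, ← Module.forall_dual_apply_eq_zero_iff ℝ]
  intro l
  rw [map_sub, ← (h1.functional l).2 i, ← (h2.functional l).2 i, sub_self]

end HasDer

/-- If all the evaluations of a variable linear map have a derivative, then the derivatives depend
linearly on the argument. -/
theorem exists_derivative_linearMap {C : Type*} [Ring C] [Algebra ℝ C]
    {x : EuclideanSpace ℝ (Fin m)} {T : EuclideanSpace ℝ (Fin m) → B →ₗ[ℝ] C}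
    (hT : ∀ u, ∃ u', HasDer x (fun y => T y u) u') :
    ∃ T' : Fin m → B →ₗ[ℝ] C, ∀ u, HasDer x (fun y => T y u) (fun i => T' i u) := by
  choose T' hT' using hT
  refine ⟨fun i => { toFun := fun u => T' u i, map_add' := ?_, map_smul' := ?_ }, hT'⟩
  · intro u v
    refine (hT' (u + v)).unique ?_ i (G' := fun i => T' u i + T' v i)
    simp only [map_add]
    exact (hT' u).add (hT' v)
  · intro r u
    refine (hT' (r • u)).unique ?_ i (G' := fun i => r • T' u i)
    exact (HasDer.map (hT' u) (LinearMap.lsmul ℝ C r)).congr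
      (Filter.Eventually.of_forall fun y => by simp)

variable {n : ℕ} {U : TopologicalSpace.Opens (EuclideanSpace ℝ (Fin m))}

theorem hasDer_genEval (Q : ℕ) (c : LocalForm n U) {x : EuclideanSpace ℝ (Fin m)} (hx : x ∈ U) :
    HasDer x (fun y => genEval Q y c) (fun i => genEval Q x (cPartial i c)) := by
  simp only [genEval_apply]
  refine HasDer.sum _ fun S _ => HasDer.sum _ fun I _ => HasDer.sum _ fun κ _ => ?_
  refine (HasDer.smul_const _ _ (smoothFunctions.differentiableAt _ hx)).congr_der fun i => ?_
  congr 1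
  exact (if_pos hx).symm

end Calculus

section Images

variable {m n : ℕ}

/-! ### Images of the generators under a change of coordinates -/

/-- A linear change `∑ χ^α_β θ^β` of the generators `θ`. -/
def thetaIm (χ : Matrix (Fin n) (Fin n) ℝ) (α : Fin n) : SuperAlg m n := ∑ β, χ α β • genTheta β

/-- A linear change `∑ J^i_j e_j` of the generators `e`. -/
def eIm (J : Matrix (Fin m) (Fin m) ℝ) (i : Fin m) : SuperAlg m n := ∑ j, J i j • genE j

/-- The change `∑ χ^α_β ξ^β + ∑ χ_{i, β}^α e_i θ^β` of the generators `ξ^α = dθ^α` of superforms. -/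
def dthetaIm (χ : Matrix (Fin n) (Fin n) ℝ) (dχ : Fin m → Matrix (Fin n) (Fin n) ℝ) (α : Fin n) :
    SuperAlg m n :=
  ∑ β, χ α β • genXi β + ∑ i, ∑ β, dχ i α β • (genE i * genTheta β)

/-- The change `∑ K^i_k e_i ± ∑ N_k^β_γ θ^γ ξ^β` of the generators `e_k = π∂_{x^k}` of integral
forms. -/
def pieIm (K : Matrix (Fin m) (Fin m) ℝ) (N : Fin m → Matrix (Fin n) (Fin n) ℝ) (k : Fin m) :
    SuperAlg m n :=
  ∑ i, K i k • genE i + (-1 : ℝ) ^ n • ∑ β, ∑ γ, N k β γ • (genTheta γ * genXi β)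

/-- The change `∑ c^β_α ξ^β` of the generators `ξ^α = π∂_{θ^α}` of integral forms. -/
def pixiIm (c : Matrix (Fin n) (Fin n) ℝ) (α : Fin n) : SuperAlg m n := ∑ β, c β α • genXi β

/-- The space of the odd elements `ι v`, which anticommute with each other. -/
def oddLinear (m n : ℕ) : Submodule ℝ (SuperAlg m n) :=
  (LinearMap.range (ExteriorAlgebra.ι (MvPolynomial (Fin n) ℝ)
    (M := Fin n ⊕ Fin m → MvPolynomial (Fin n) ℝ))).restrictScalars ℝ

theorem oddLinear_anticomm {u v : SuperAlg m n} (hu : u ∈ oddLinear m n)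
    (hv : v ∈ oddLinear m n) : u * v = -(v * u) := by
  obtain ⟨a, rfl⟩ := hu
  obtain ⟨b, rfl⟩ := hv
  exact eq_neg_of_add_eq_zero_left (ExteriorAlgebra.ι_add_mul_swap _ _)

theorem genTheta_mem (α : Fin n) : genTheta α ∈ oddLinear m n := ⟨_, rfl⟩

theorem genE_mem (i : Fin m) : genE i ∈ oddLinear m n := ⟨_, rfl⟩

theorem genTheta_mul_genXi_mem (α β : Fin n) :
    (genTheta α * genXi β : SuperAlg m n) ∈ oddLinear m n := by
  refine ⟨(MvPolynomial.X β : MvPolynomial (Fin n) ℝ) •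
    (Pi.single (Sum.inl α) 1 : Fin n ⊕ Fin m → MvPolynomial (Fin n) ℝ), ?_⟩
  rw [map_smul, Algebra.smul_def]
  exact genXi_comm β (genTheta α)

theorem thetaIm_mem (χ : Matrix (Fin n) (Fin n) ℝ) (α : Fin n) :
    thetaIm χ α ∈ oddLinear m n :=
  Submodule.sum_mem _ fun β _ => Submodule.smul_mem _ _ (genTheta_mem β)

theorem eIm_mem (J : Matrix (Fin m) (Fin m) ℝ) (i : Fin m) : eIm J i ∈ oddLinear m n :=
  Submodule.sum_mem _ fun j _ => Submodule.smul_mem _ _ (genE_mem j)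

theorem pieIm_mem (K : Matrix (Fin m) (Fin m) ℝ) (N : Fin m → Matrix (Fin n) (Fin n) ℝ)
    (k : Fin m) : pieIm K N k ∈ oddLinear m n :=
  Submodule.add_mem _ (Submodule.sum_mem _ fun j _ => Submodule.smul_mem _ _ (genE_mem j))
    (Submodule.smul_mem _ _ (Submodule.sum_mem _ fun β _ => Submodule.sum_mem _ fun γ _ =>
      Submodule.smul_mem _ _ (genTheta_mul_genXi_mem γ β)))

theorem genE_mul_genTheta_comm (i : Fin m) (α : Fin n) (u : SuperAlg m n) :
    genE i * genTheta α * u = u * (genE i * genTheta α) := by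
  refine linearMap_ext_gen (LinearMap.mulLeft ℝ (genE i * genTheta α : SuperAlg m n))
    (LinearMap.mulRight ℝ (genE i * genTheta α)) ?_ ?_ ?_ ?_ u
  · simp
  · intro β a h
    simp only [LinearMap.mulLeft_apply, LinearMap.mulRight_apply] at h ⊢
    rw [mul_assoc (genTheta β), ← h, ← mul_assoc, mul_assoc (genE i), genTheta_mul_genTheta α,
      mul_neg, ← mul_assoc, genE_mul_genTheta]
    simp only [neg_mul, neg_neg, mul_assoc]
  · intro j a h
    simp only [LinearMap.mulLeft_apply, LinearMap.mulRight_apply] at h ⊢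
    rw [mul_assoc (genE j), ← h, ← mul_assoc, mul_assoc (genE i), ← neg_neg (genTheta α * genE j),
      ← genE_mul_genTheta, mul_neg, ← mul_assoc, genE_mul_genE]
    simp only [neg_mul, neg_neg, mul_assoc]
  · intro β a h
    simp only [LinearMap.mulLeft_apply, LinearMap.mulRight_apply] at h ⊢
    rw [mul_assoc (genXi β), ← h, ← mul_assoc, ← mul_assoc, genXi_comm β]

theorem dthetaIm_comm (χ : Matrix (Fin n) (Fin n) ℝ) (dχ : Fin m → Matrix (Fin n) (Fin n) ℝ)
    (α : Fin n) (u : SuperAlg m n) : dthetaIm χ dχ α * u = u * dthetaIm χ dχ α := by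
  simp only [dthetaIm, add_mul, mul_add, Finset.sum_mul, Finset.mul_sum, smul_mul_assoc,
    mul_smul_comm, genXi_comm _ u, genE_mul_genTheta_comm]

theorem pixiIm_comm (c : Matrix (Fin n) (Fin n) ℝ) (α : Fin n) (u : SuperAlg m n) :
    pixiIm c α * u = u * pixiIm c α := by
  simp only [pixiIm, Finset.sum_mul, Finset.mul_sum, smul_mul_assoc, mul_smul_comm,
    genXi_comm _ u]

theorem isSuperSystem_formMap (χ : Matrix (Fin n) (Fin n) ℝ)
    (dχ : Fin m → Matrix (Fin n) (Fin n) ℝ) (J : Matrix (Fin m) (Fin m) ℝ) :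
    IsSuperSystem (B := SuperAlg m n) (Sum.elim (thetaIm χ) (eIm J)) (dthetaIm χ dχ) where
  anticomm := by
    have h : ∀ a, (Sum.elim (thetaIm χ) (eIm J) a : SuperAlg m n) ∈ oddLinear m n := by
      rintro (a | a)
      exacts [thetaIm_mem χ a, eIm_mem J a]
    exact fun a b => oddLinear_anticomm (h a) (h b)
  central := dthetaIm_comm χ dχ

theorem isSuperSystem_intMap (χ c : Matrix (Fin n) (Fin n) ℝ) (K : Matrix (Fin m) (Fin m) ℝ)
    (N : Fin m → Matrix (Fin n) (Fin n) ℝ) :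
    IsSuperSystem (B := SuperAlg m n) (Sum.elim (thetaIm χ) (pieIm K N)) (pixiIm c) where
  anticomm := by
    have h : ∀ a, (Sum.elim (thetaIm χ) (pieIm K N) a : SuperAlg m n) ∈ oddLinear m n := by
      rintro (a | a)
      exacts [thetaIm_mem χ a, pieIm_mem K N a]
    exact fun a b => oddLinear_anticomm (h a) (h b)
  central := pixiIm_comm c

/-- The change of coordinates of superforms at a point. -/
def formMap (χ : Matrix (Fin n) (Fin n) ℝ) (dχ : Fin m → Matrix (Fin n) (Fin n) ℝ)
    (J : Matrix (Fin m) (Fin m) ℝ) : SuperAlg m n →ₐ[ℝ] SuperAlg m n :=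
  superLift _ _ (isSuperSystem_formMap χ dχ J)

/-- The change of coordinates of integral forms at a point, without the Berezinian. -/
def intMap (χ c : Matrix (Fin n) (Fin n) ℝ) (K : Matrix (Fin m) (Fin m) ℝ)
    (N : Fin m → Matrix (Fin n) (Fin n) ℝ) : SuperAlg m n →ₐ[ℝ] SuperAlg m n :=
  superLift _ _ (isSuperSystem_intMap χ c K N)

section FormMap

variable (χ : Matrix (Fin n) (Fin n) ℝ) (dχ : Fin m → Matrix (Fin n) (Fin n) ℝ)
  (J : Matrix (Fin m) (Fin m) ℝ)

@[simp]
theorem formMap_theta (α : Fin n) : formMap χ dχ J (genTheta α) = thetaIm χ α :=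
  superLift_theta _ _ _ α

@[simp]
theorem formMap_e (i : Fin m) : formMap χ dχ J (genE i) = eIm J i :=
  superLift_e _ _ _ i

@[simp]
theorem formMap_xi (α : Fin n) : formMap χ dχ J (genXi α) = dthetaIm χ dχ α :=
  superLift_xi _ _ _ α

end FormMap

section IntMap

variable (χ c : Matrix (Fin n) (Fin n) ℝ) (K : Matrix (Fin m) (Fin m) ℝ)
  (N : Fin m → Matrix (Fin n) (Fin n) ℝ)

@[simp]
theorem intMap_theta (α : Fin n) : intMap χ c K N (genTheta α) = thetaIm χ α :=
  superLift_theta _ _ _ α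

@[simp]
theorem intMap_e (i : Fin m) : intMap χ c K N (genE i) = pieIm K N i :=
  superLift_e _ _ _ i

@[simp]
theorem intMap_xi (α : Fin n) : intMap χ c K N (genXi α) = pixiIm c α :=
  superLift_xi _ _ _ α

end IntMap

/-! ### Derivatives of products with the images of the generators -/

section Rules

variable (χ c : Matrix (Fin n) (Fin n) ℝ) (dχ N : Fin m → Matrix (Fin n) (Fin n) ℝ)
  (J K : Matrix (Fin m) (Fin m) ℝ) (u : SuperAlg m n)

theorem dTheta_thetaIm_mul (γ α : Fin n) :
    dTheta γ (thetaIm χ α * u) = χ α γ • u - thetaIm χ α * dTheta γ u := by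
  simp only [thetaIm, Finset.sum_mul, smul_mul_assoc, map_sum, map_smul, dTheta_theta_mul,
    smul_sub, Finset.sum_sub_distrib, smul_ite, smul_zero, Finset.sum_ite_eq, Finset.mem_univ,
    if_true]

theorem dE_thetaIm_mul (i : Fin m) (α : Fin n) :
    dE i (thetaIm χ α * u) = -(thetaIm χ α * dE i u) := by
  simp only [thetaIm, Finset.sum_mul, smul_mul_assoc, map_sum, map_smul, dE_theta_mul,
    smul_neg, Finset.sum_neg_distrib]

theorem dXi_thetaIm_mul (γ α : Fin n) :
    dXi γ (thetaIm χ α * u) = thetaIm χ α * dXi γ u := by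
  simp only [thetaIm, Finset.sum_mul, smul_mul_assoc, map_sum, map_smul, dXi_theta_mul]

theorem dTheta_eIm_mul (γ : Fin n) (i : Fin m) :
    dTheta γ (eIm J i * u) = -(eIm J i * dTheta γ u) := by
  simp only [eIm, Finset.sum_mul, smul_mul_assoc, map_sum, map_smul, dTheta_e_mul,
    smul_neg, Finset.sum_neg_distrib]

theorem dE_eIm_mul (j i : Fin m) :
    dE j (eIm J i * u) = J i j • u - eIm J i * dE j u := by
  simp only [eIm, Finset.sum_mul, smul_mul_assoc, map_sum, map_smul, dE_e_mul,
    smul_sub, Finset.sum_sub_distrib, smul_ite, smul_zero, Finset.sum_ite_eq, Finset.mem_univ,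
    if_true]

theorem dXi_eIm_mul (γ : Fin n) (i : Fin m) :
    dXi γ (eIm J i * u) = eIm J i * dXi γ u := by
  simp only [eIm, Finset.sum_mul, smul_mul_assoc, map_sum, map_smul, dXi_e_mul]

theorem dTheta_pixiIm_mul (γ α : Fin n) :
    dTheta γ (pixiIm c α * u) = pixiIm c α * dTheta γ u := by
  simp only [pixiIm, Finset.sum_mul, smul_mul_assoc, map_sum, map_smul, dTheta_xi_mul]

theorem dE_pixiIm_mul (i : Fin m) (α : Fin n) :
    dE i (pixiIm c α * u) = pixiIm c α * dE i u := by
  simp only [pixiIm, Finset.sum_mul, smul_mul_assoc, map_sum, map_smul, dE_xi_mul]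

theorem dXi_pixiIm_mul (γ α : Fin n) :
    dXi γ (pixiIm c α * u) = pixiIm c α * dXi γ u + c γ α • u := by
  simp only [pixiIm, Finset.sum_mul, smul_mul_assoc, map_sum, map_smul, dXi_xi_mul,
    smul_add, Finset.sum_add_distrib, smul_ite, smul_zero, Finset.sum_ite_eq, Finset.mem_univ,
    if_true]

theorem dTheta_dthetaIm_mul (γ α : Fin n) :
    dTheta γ (dthetaIm χ dχ α * u) = dthetaIm χ dχ α * dTheta γ u -
      (∑ i, dχ i α γ • genE i) * u := by
  simp only [dthetaIm, add_mul, Finset.sum_mul, smul_mul_assoc, map_add, map_sum, map_smul,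
    dTheta_xi_mul, mul_assoc, dTheta_e_mul, dTheta_theta_mul, mul_sub, neg_sub, smul_sub,
    Finset.sum_sub_distrib, mul_ite, smul_ite, mul_zero, smul_zero, Finset.sum_ite_eq,
    Finset.mem_univ, if_true]
  abel

theorem dXi_dthetaIm_mul (γ α : Fin n) :
    dXi γ (dthetaIm χ dχ α * u) = dthetaIm χ dχ α * dXi γ u + χ α γ • u := by
  simp only [dthetaIm, add_mul, Finset.sum_mul, smul_mul_assoc, map_add, map_sum, map_smul,
    dXi_xi_mul, mul_assoc, dXi_e_mul, dXi_theta_mul, smul_add, Finset.sum_add_distrib, smul_ite,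
    smul_zero, Finset.sum_ite_eq, Finset.mem_univ, if_true]
  abel

theorem dE_pieIm_mul (i k : Fin m) :
    dE i (pieIm K N k * u) = K i k • u - pieIm K N k * dE i u := by
  simp only [pieIm, add_mul, Finset.sum_mul, smul_mul_assoc, map_add, map_sum, map_smul,
    dE_e_mul, mul_assoc, dE_theta_mul, dE_xi_mul, smul_sub, Finset.sum_sub_distrib, smul_ite,
    smul_zero, Finset.sum_ite_eq, Finset.mem_univ, if_true, smul_neg, Finset.sum_neg_distrib]
  abel

theorem dTheta_pieIm_mul (α : Fin n) (k : Fin m) :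
    dTheta α (pieIm K N k * u) = (-1 : ℝ) ^ n • (pixiIm (N k) α * u) -
      pieIm K N k * dTheta α u := by
  simp only [pieIm, pixiIm, add_mul, Finset.sum_mul, smul_mul_assoc, map_add, map_sum, map_smul,
    dTheta_e_mul, mul_assoc, dTheta_theta_mul, dTheta_xi_mul, smul_sub, Finset.sum_sub_distrib,
    smul_ite, smul_zero, Finset.sum_ite_eq, Finset.mem_univ, if_true, smul_neg,
    Finset.sum_neg_distrib]
  abel

theorem dXi_pieIm_mul (α : Fin n) (k : Fin m) :
    dXi α (pieIm K N k * u) = (-1 : ℝ) ^ n • (thetaIm (N k) α * u) +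
      pieIm K N k * dXi α u := by
  simp only [pieIm, thetaIm, add_mul, Finset.sum_mul, smul_mul_assoc, map_add, map_sum, map_smul,
    dXi_e_mul, mul_assoc, dXi_theta_mul, dXi_xi_mul, mul_add, smul_add, Finset.sum_add_distrib,
    mul_ite, smul_ite, mul_zero, smul_zero]
  rw [Finset.sum_comm (f := fun β γ => if α = β then N k β γ • (genTheta γ * u) else 0)]
  simp only [Finset.sum_ite_eq, Finset.mem_univ, if_true]
  abel

end Rules
end Images

section Naturality

variable {m n : ℕ}

/-- The entrywise partial derivative of a matrix-valued function. -/
def pdMat {k : ℕ} (i : Fin m) (M : EuclideanSpace ℝ (Fin m) → Matrix (Fin k) (Fin k) ℝ)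
    (x : EuclideanSpace ℝ (Fin m)) : Matrix (Fin k) (Fin k) ℝ :=
  Matrix.of fun a b => pd i (fun y => M y a b) x

theorem hasDer_thetaIm {x : EuclideanSpace ℝ (Fin m)}
    {χ : EuclideanSpace ℝ (Fin m) → Matrix (Fin n) (Fin n) ℝ}
    (hχ : ∀ α β, DifferentiableAt ℝ (fun y => χ y α β) x) (α : Fin n) :
    HasDer x (fun y => (thetaIm (χ y) α : SuperAlg m n))
      (fun i => thetaIm (pdMat i χ x) α) :=
  HasDer.sum _ fun β _ => HasDer.smul_const _ _ (hχ α β)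

theorem hasDer_eIm {x : EuclideanSpace ℝ (Fin m)}
    {J : EuclideanSpace ℝ (Fin m) → Matrix (Fin m) (Fin m) ℝ}
    (hJ : ∀ i j, DifferentiableAt ℝ (fun y => J y i j) x) (j : Fin m) :
    HasDer x (fun y => (eIm (J y) j : SuperAlg m n)) (fun i => eIm (pdMat i J x) j) :=
  HasDer.sum _ fun k _ => HasDer.smul_const _ _ (hJ j k)

theorem hasDer_dthetaIm {x : EuclideanSpace ℝ (Fin m)}
    {χ : EuclideanSpace ℝ (Fin m) → Matrix (Fin n) (Fin n) ℝ}
    {dχ : EuclideanSpace ℝ (Fin m) → Fin m → Matrix (Fin n) (Fin n) ℝ}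
    (hχ : ∀ α β, DifferentiableAt ℝ (fun y => χ y α β) x)
    (hdχ : ∀ i α β, DifferentiableAt ℝ (fun y => dχ y i α β) x) (α : Fin n) :
    HasDer x (fun y => (dthetaIm (χ y) (dχ y) α : SuperAlg m n))
      (fun i => dthetaIm (pdMat i χ x) (fun j => pdMat i (fun y => dχ y j) x) α) :=
  (HasDer.sum _ fun β _ => HasDer.smul_const _ _ (hχ α β)).add
    (HasDer.sum _ fun j _ => HasDer.sum _ fun β _ => HasDer.smul_const _ _ (hdχ j α β))

theorem hasDer_pieIm {x : EuclideanSpace ℝ (Fin m)}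
    {K : EuclideanSpace ℝ (Fin m) → Matrix (Fin m) (Fin m) ℝ}
    {N : EuclideanSpace ℝ (Fin m) → Fin m → Matrix (Fin n) (Fin n) ℝ}
    (hK : ∀ i j, DifferentiableAt ℝ (fun y => K y i j) x)
    (hN : ∀ k α β, DifferentiableAt ℝ (fun y => N y k α β) x) (k : Fin m) :
    HasDer x (fun y => (pieIm (K y) (N y) k : SuperAlg m n))
      (fun i => pieIm (pdMat i K x) (fun j => pdMat i (fun y => N y j) x) k) :=
  (HasDer.sum _ fun i _ => HasDer.smul_const _ _ (hK i k)).add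
    ((HasDer.sum _ fun β _ => HasDer.sum _ fun γ _ =>
      HasDer.smul_const _ _ (hN k β γ)).map (LinearMap.lsmul ℝ _ ((-1 : ℝ) ^ n)))

theorem hasDer_pixiIm {x : EuclideanSpace ℝ (Fin m)}
    {c : EuclideanSpace ℝ (Fin m) → Matrix (Fin n) (Fin n) ℝ}
    (hc : ∀ α β, DifferentiableAt ℝ (fun y => c y α β) x) (α : Fin n) :
    HasDer x (fun y => (pixiIm (c y) α : SuperAlg m n))
      (fun i => pixiIm (pdMat i c x) α) :=
  HasDer.sum _ fun β _ => HasDer.smul_const _ _ (hc β α)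

/-! ### Naturality on superforms -/

/-- The Euler vector field does not depend on the coordinates, as the `θ'` are linear in the `θ`;
here for the contraction with it. -/
theorem formMap_iota (χ : Matrix (Fin n) (Fin n) ℝ) (dχ : Fin m → Matrix (Fin n) (Fin n) ℝ)
    (J : Matrix (Fin m) (Fin m) ℝ) (u : SuperAlg m n) :
    ∑ α, genTheta α * dXi α (formMap χ dχ J u) = formMap χ dχ J (∑ α, genTheta α * dXi α u) := by
  have anti : ∀ v ∈ oddLinear m n, ∀ w, ∑ α, genTheta α * (v * dXi α w) =
      -(v * ∑ α, genTheta α * dXi α w) := by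
    intro v hv w
    rw [Finset.mul_sum, ← Finset.sum_neg_distrib]
    refine Finset.sum_congr rfl fun α _ => ?_
    rw [← mul_assoc, oddLinear_anticomm (genTheta_mem α) hv, neg_mul, mul_assoc]
  induction u using gen_induction with
  | one => simp
  | smul r a h => simp only [map_smul, mul_smul_comm, ← Finset.smul_sum, h]
  | add a b ha hb => simp only [map_add, mul_add, Finset.sum_add_distrib, ha, hb]
  | theta β a h =>
    simp only [map_mul, formMap_theta, dXi_thetaIm_mul, dXi_theta_mul]
    rw [anti _ (thetaIm_mem χ β), anti _ (genTheta_mem β), h, map_neg, map_mul, formMap_theta]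
  | e i a h =>
    simp only [map_mul, formMap_e, dXi_eIm_mul, dXi_e_mul]
    rw [anti _ (eIm_mem J i), anti _ (genE_mem i), h, map_neg, map_mul, formMap_e]
  | xi β a h =>
    have h1 : ∀ w : SuperAlg m n, ∑ α, genTheta α * (genXi β * dXi α w) =
        genXi β * ∑ α, genTheta α * dXi α w := by
      intro w
      rw [Finset.mul_sum]
      refine Finset.sum_congr rfl fun α _ => ?_
      rw [← mul_assoc, ← genXi_comm, mul_assoc]
    have h2 : ∀ w : SuperAlg m n, ∑ α, genTheta α * (dthetaIm χ dχ β * dXi α w) =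
        dthetaIm χ dχ β * ∑ α, genTheta α * dXi α w := by
      intro w
      rw [Finset.mul_sum]
      refine Finset.sum_congr rfl fun α _ => ?_
      rw [← mul_assoc, ← dthetaIm_comm, mul_assoc]
    simp only [map_mul, formMap_xi, dXi_dthetaIm_mul, dXi_xi_mul, mul_add,
      Finset.sum_add_distrib, mul_ite, mul_zero, Finset.sum_ite_eq',
      Finset.mem_univ, if_true]
    rw [h1, h2, h, map_add, map_mul, map_mul, formMap_xi, formMap_theta, thetaIm,
      Finset.sum_mul]
    simp only [mul_smul_comm, smul_mul_assoc]

/-- The generators `dx'^j` are closed. -/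
theorem sum_e_mul_eIm (J' : Fin m → Matrix (Fin m) (Fin m) ℝ) (j : Fin m)
    (h : ∀ i k, J' i j k = J' k j i) : ∑ i, (genE i : SuperAlg m n) * eIm (J' i) j = 0 := by
  simp only [eIm, Finset.mul_sum, mul_smul_comm]
  refine sum_sum_antisymm _ fun i k => ?_
  rw [h, genE_mul_genE, smul_neg]

theorem sum_e_mul_dthetaIm (χ' : Fin m → Matrix (Fin n) (Fin n) ℝ)
    (χ'' : Fin m → Fin m → Matrix (Fin n) (Fin n) ℝ) (α : Fin n)
    (h : ∀ i j β, χ'' i j α β = χ'' j i α β) :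
    ∑ i, (genE i : SuperAlg m n) * dthetaIm (χ' i) (χ'' i) α =
      ∑ γ, genXi γ * ∑ i, χ' i α γ • genE i := by
  have h1 : ∑ i, ∑ j, ∑ β, χ'' i j α β • ((genE i : SuperAlg m n) * (genE j * genTheta β)) = 0 := by
    refine sum_sum_antisymm _ fun i j => ?_
    rw [← Finset.sum_neg_distrib]
    refine Finset.sum_congr rfl fun β _ => ?_
    rw [h, ← mul_assoc, genE_mul_genE, neg_mul, smul_neg, mul_assoc]
  simp only [dthetaIm, mul_add, Finset.mul_sum, mul_smul_comm, Finset.sum_add_distrib, h1,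
    add_zero, xi_e]
  rw [Finset.sum_comm]

/-- The de Rham differential commutes with changes of coordinates, for forms with constant
coefficients: as all the generators `dx'` and `dθ'` are closed, the differential of the transformed
form consists of the terms `dθ'^α ∂/∂θ'^α` only. -/
theorem formMap_natural {x : EuclideanSpace ℝ (Fin m)}
    {χ : EuclideanSpace ℝ (Fin m) → Matrix (Fin n) (Fin n) ℝ}
    {dχ : EuclideanSpace ℝ (Fin m) → Fin m → Matrix (Fin n) (Fin n) ℝ}
    {J : EuclideanSpace ℝ (Fin m) → Matrix (Fin m) (Fin m) ℝ}
    (hχ : ∀ α β, DifferentiableAt ℝ (fun y => χ y α β) x)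
    (hχ' : ∀ i, pdMat i χ x = dχ x i)
    (hdχ : ∀ i α β, DifferentiableAt ℝ (fun y => dχ y i α β) x)
    (hdχ' : ∀ i j, pdMat i (fun y => dχ y j) x = pdMat j (fun y => dχ y i) x)
    (hJ : ∀ i j, DifferentiableAt ℝ (fun y => J y i j) x)
    (hJ' : ∀ i j k, pdMat i J x j k = pdMat k J x j i) (u : SuperAlg m n) :
    ∃ u', HasDer x (fun y => formMap (χ y) (dχ y) (J y) u) u' ∧
      ∑ i, genE i * u' i + ∑ α, genXi α * dTheta α (formMap (χ x) (dχ x) (J x) u) =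
        formMap (χ x) (dχ x) (J x) (∑ α, genXi α * dTheta α u) := by
  have anti : ∀ v ∈ oddLinear m n, ∀ w : Fin m → SuperAlg m n, ∑ i, genE i * (v * w i) =
      -(v * ∑ i, genE i * w i) := by
    intro v hv w
    rw [Finset.mul_sum, ← Finset.sum_neg_distrib]
    refine Finset.sum_congr rfl fun α _ => ?_
    rw [← mul_assoc, oddLinear_anticomm (genE_mem α) hv, neg_mul, mul_assoc]
  have comm : ∀ v : SuperAlg m n, ∀ w : Fin n → SuperAlg m n, ∑ α, genXi α * (v * w α) =
      v * ∑ α, genXi α * w α := by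
    intro v w
    rw [Finset.mul_sum]
    refine Finset.sum_congr rfl fun α _ => ?_
    rw [← mul_assoc, genXi_comm, mul_assoc]
  induction u using gen_induction with
  | one => exact ⟨_, (HasDer.const 1).congr (Filter.Eventually.of_forall fun y => map_one _),
      by simp⟩
  | smul r a h =>
    obtain ⟨a', h1, h2⟩ := h
    refine ⟨_, (h1.map (LinearMap.lsmul ℝ _ r)).congr
      (Filter.Eventually.of_forall fun y => by simp), ?_⟩
    simp only [map_smul, mul_smul_comm, LinearMap.lsmul_apply, ← Finset.smul_sum, ← h2, smul_add]
  | add a b ha hb =>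
    obtain ⟨a', h1, h2⟩ := ha
    obtain ⟨b', h3, h4⟩ := hb
    refine ⟨_, (h1.add h3).congr (Filter.Eventually.of_forall fun y => map_add _ _ _), ?_⟩
    simp only [map_add, mul_add, Finset.sum_add_distrib] at h2 h4 ⊢
    rw [← h2, ← h4]
    abel
  | theta α a h =>
    obtain ⟨a', h1, h2⟩ := h
    refine ⟨_, ((hasDer_thetaIm hχ α).mul h1).congr (Filter.Eventually.of_forall fun y => by
      simp only [map_mul, formMap_theta]), ?_⟩
    simp only [map_mul, formMap_theta, dTheta_thetaIm_mul, dTheta_theta_mul, mul_add, mul_sub,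
      Finset.sum_add_distrib, Finset.sum_sub_distrib, comm, mul_ite, mul_zero, Finset.sum_ite_eq',
      Finset.mem_univ, if_true, map_sub, formMap_xi]
    rw [anti _ (thetaIm_mem _ _), ← h2, mul_add]
    -- `dθ'^α = ∑ (dχ^α_β) θ^β + ∑ χ^α_β dθ^β` is by definition the image of the generator `ξ^α`
    have h3 : ∑ i, genE i * (thetaIm (pdMat i χ x) α * formMap (χ x) (dχ x) (J x) a) +
        ∑ γ, genXi γ * (χ x α γ • formMap (χ x) (dχ x) (J x) a) =
        dthetaIm (χ x) (dχ x) α * formMap (χ x) (dχ x) (J x) a := by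
      simp only [hχ', dthetaIm, thetaIm, ← mul_assoc, ← Finset.sum_mul, add_mul, Finset.mul_sum,
        mul_smul_comm]
      rw [add_comm]
      refine congrArg₂ (· + ·) ?_ rfl
      simp only [Finset.sum_mul, smul_mul_assoc]
    rw [← h3]
    abel
  | e j a h =>
    obtain ⟨a', h1, h2⟩ := h
    refine ⟨_, ((hasDer_eIm hJ j).mul h1).congr (Filter.Eventually.of_forall fun y => by
      simp only [map_mul, formMap_e]), ?_⟩
    simp only [map_mul, formMap_e, dTheta_eIm_mul, dTheta_e_mul, mul_add, mul_neg,
      Finset.sum_add_distrib, Finset.sum_neg_distrib, comm, map_neg]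
    rw [anti _ (eIm_mem _ _), ← h2, mul_add]
    have h3 : ∑ i, genE i * (eIm (pdMat i J x) j * formMap (χ x) (dχ x) (J x) a) = 0 := by
      simp only [← mul_assoc, ← Finset.sum_mul]
      rw [sum_e_mul_eIm _ _ fun i k => hJ' i j k, zero_mul]
    rw [h3]
    abel
  | xi α a h =>
    obtain ⟨a', h1, h2⟩ := h
    refine ⟨_, ((hasDer_dthetaIm hχ hdχ α).mul h1).congr (Filter.Eventually.of_forall fun y => by
      simp only [map_mul, formMap_xi]), ?_⟩
    have h4 : ∑ i, genE i * (dthetaIm (χ x) (dχ x) α * a' i) =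
        dthetaIm (χ x) (dχ x) α * ∑ i, genE i * a' i := by
      rw [Finset.mul_sum]
      refine Finset.sum_congr rfl fun i _ => ?_
      rw [← mul_assoc, ← dthetaIm_comm, mul_assoc]
    simp only [map_mul, formMap_xi, dTheta_dthetaIm_mul, dTheta_xi_mul, mul_add, mul_sub,
      Finset.sum_add_distrib, Finset.sum_sub_distrib, comm]
    rw [h4, ← h2, mul_add]
    have h3 : ∑ i, genE i * (dthetaIm (pdMat i χ x) (fun j => pdMat i (fun y => dχ y j) x) α *
          formMap (χ x) (dχ x) (J x) a) =
        ∑ γ, genXi γ * ((∑ i, dχ x i α γ • genE i) * formMap (χ x) (dχ x) (J x) a) := by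
      simp only [← mul_assoc, ← Finset.sum_mul]
      rw [sum_e_mul_dthetaIm (fun i => pdMat i χ x) (fun i j => pdMat i (fun y => dχ y j) x) α
        fun i j β => by rw [hdχ' i j]]
      simp only [hχ']
    rw [h3]
    abel

/-! ### Pure forms and the determinants -/

theorem oddProd_univ {k : ℕ} {B : Type*} [Ring B] (g : Fin k → B) :
    oddProd g Finset.univ = (List.ofFn g).prod := by
  rw [oddProd, Fin.sort_univ, List.ofFn_eq_map]

/-- The top product of linear combinations of anticommuting elements. -/
theorem oddProd_linearCombination {k : ℕ} {B : Type*} [Ring B] [Algebra ℝ B] (g : Fin k → B)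
    (hg : ∀ a b, g a * g b = -(g b * g a)) (A : Matrix (Fin k) (Fin k) ℝ) :
    oddProd (fun a => ∑ b, A a b • g b) Finset.univ = A.det • oddProd g Finset.univ := by
  -- it suffices to consider the exterior algebra of `ℝ^k`, where alternating maps of top degree
  -- are multiples of the determinant
  let L : (Fin k → ℝ) →ₗ[ℝ] B := Fintype.linearCombination ℝ g
  have hL : ∀ v, L v = ∑ b, v b • g b := fun v => Fintype.linearCombination_apply _ _ _
  have hsq : ∀ v, L v * L v = 0 := by
    intro v
    rw [hL, Finset.sum_mul_sum]
    refine sum_sum_antisymm _ fun a b => ?_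
    rw [smul_mul_smul_comm, smul_mul_smul_comm, hg, smul_neg, mul_comm]
  let Φ := ExteriorAlgebra.lift ℝ ⟨L, hsq⟩
  have hΦ : ∀ v : Fin k → Fin k → ℝ,
      Φ (ExteriorAlgebra.ιMulti ℝ k v) = oddProd (fun a => ∑ b, v a b • g b) Finset.univ := by
    intro v
    rw [ExteriorAlgebra.ιMulti_apply, map_list_prod, List.map_ofFn, oddProd_univ]
    congr 2
    funext a
    rw [Function.comp_apply, ExteriorAlgebra.lift_ι_apply, hL]
  have h1 : ExteriorAlgebra.ιMulti ℝ k (M := Fin k → ℝ) =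
      (LinearMap.toSpanSingleton ℝ _ (ExteriorAlgebra.ιMulti ℝ k
        (Pi.basisFun ℝ (Fin k)))).compAlternatingMap (Pi.basisFun ℝ (Fin k)).det := by
    refine Module.Basis.ext_alternating (Pi.basisFun ℝ (Fin k)) fun i hi => ?_
    let σ : Equiv.Perm (Fin k) := Equiv.ofBijective i (Finite.injective_iff_bijective.1 hi)
    change ExteriorAlgebra.ιMulti ℝ k (Pi.basisFun ℝ (Fin k) ∘ σ) =
      ((LinearMap.toSpanSingleton ℝ _ (ExteriorAlgebra.ιMulti ℝ k
        (Pi.basisFun ℝ (Fin k)))).compAlternatingMap (Pi.basisFun ℝ (Fin k)).det)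
          (Pi.basisFun ℝ (Fin k) ∘ σ)
    rw [AlternatingMap.map_perm, AlternatingMap.map_perm]
    rw [LinearMap.compAlternatingMap_apply, Module.Basis.det_self, LinearMap.toSpanSingleton_apply,
      one_smul]
  have h2 : ExteriorAlgebra.ιMulti ℝ k A =
      A.det • ExteriorAlgebra.ιMulti ℝ k (Pi.basisFun ℝ (Fin k)) := by
    have h3 := congrArg (fun f => f A) h1
    rw [Pi.basisFun_det] at h3
    exact h3
  rw [← hΦ A, h2, map_smul, hΦ]
  simp [Pi.single_apply]

end Naturality

/-! ### Naturality of the odd Euler field and of the derivations -/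

section IntNaturality

variable {m n : ℕ}

/-- The Euler vector field does not depend on the coordinates, as the `θ'` are linear in the `θ`;
here for its image `∑ θ^α π∂_{θ^α}` among the multivector fields. -/
theorem intMap_euler {χ c : Matrix (Fin n) (Fin n) ℝ} (K : Matrix (Fin m) (Fin m) ℝ)
    (N : Fin m → Matrix (Fin n) (Fin n) ℝ) (hcχ : c * χ = 1) :
    intMap χ c K N (∑ α, genTheta α * genXi α) = ∑ α, genTheta α * genXi α := by
  simp only [map_sum, map_mul, intMap_theta, intMap_xi, thetaIm, pixiIm, Finset.sum_mul_sum,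
    smul_mul_smul_comm]
  rw [Finset.sum_comm]
  refine Finset.sum_congr rfl fun β _ => ?_
  rw [Finset.sum_comm]
  have h : ∀ γ, ∑ α, (χ α β * c γ α) • ((genTheta β : SuperAlg m n) * genXi γ) =
      (1 : Matrix (Fin n) (Fin n) ℝ) γ β • (genTheta β * genXi γ) := by
    intro γ
    rw [← Finset.sum_smul, ← hcχ, Matrix.mul_apply]
    simp only [mul_comm]
  simp only [h, Matrix.one_apply, ite_smul, one_smul, zero_smul, Finset.sum_ite_eq',
    Finset.mem_univ, if_true]

/-- The derivatives with respect to `π∂_{x}` are dual to the `π∂_x`, whence they transform like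
the `dx`. -/
theorem dE_intMap (χ c : Matrix (Fin n) (Fin n) ℝ) {J K : Matrix (Fin m) (Fin m) ℝ}
    (N : Fin m → Matrix (Fin n) (Fin n) ℝ) (hJK : J * K = 1) (j : Fin m) (u : SuperAlg m n) :
    ∑ i, J j i • dE i (intMap χ c K N u) = intMap χ c K N (dE j u) := by
  induction u using gen_induction with
  | one => simp
  | smul r a h => simp only [map_smul, smul_comm _ r, ← Finset.smul_sum, h]
  | add a b ha hb => simp only [map_add, smul_add, Finset.sum_add_distrib, ha, hb]
  | theta α a h =>
    simp only [map_mul, intMap_theta, dE_thetaIm_mul, dE_theta_mul, map_neg, smul_neg,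
      Finset.sum_neg_distrib, ← mul_smul_comm, ← Finset.mul_sum, h]
  | e k a h =>
    simp only [map_mul, intMap_e, dE_pieIm_mul, dE_e_mul, map_sub, smul_sub,
      Finset.sum_sub_distrib, ← mul_smul_comm, ← Finset.mul_sum, h, smul_smul, ← Finset.sum_smul]
    rw [← Matrix.mul_apply, hJK, Matrix.one_apply]
    split_ifs <;> simp
  | xi α a h =>
    simp only [map_mul, intMap_xi, dE_pixiIm_mul, dE_xi_mul, ← mul_smul_comm, ← Finset.mul_sum, h]

theorem dE_formMap_zero {J K : Matrix (Fin m) (Fin m) ℝ} (hJK : J * K = 1) (j : Fin m)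
    (u : SuperAlg m n) :
    ∑ i, K i j • dE i (formMap 0 0 J u) = formMap 0 0 J (dE j u) := by
  have h0 : ∀ α, (thetaIm 0 α : SuperAlg m n) = 0 := fun α => by simp [thetaIm]
  have h1 : ∀ α, (dthetaIm 0 0 α : SuperAlg m n) = 0 := fun α => by simp [dthetaIm]
  induction u using gen_induction with
  | one => simp
  | smul r a h => simp only [map_smul, smul_comm _ r, ← Finset.smul_sum, h]
  | add a b ha hb => simp only [map_add, smul_add, Finset.sum_add_distrib, ha, hb]
  | theta α a h => simp [h0, dE_theta_mul]
  | e k a h =>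
    simp only [map_mul, formMap_e, dE_eIm_mul, dE_e_mul, map_sub, smul_sub,
      Finset.sum_sub_distrib, ← mul_smul_comm, ← Finset.mul_sum, h, smul_smul, ← Finset.sum_smul]
    simp only [mul_comm (K _ _)]
    rw [← Matrix.mul_apply, hJK, Matrix.one_apply]
    simp only [eq_comm (a := k)]
    split_ifs <;> simp
  | xi α a h => simp [h1, dE_xi_mul]

theorem thetaIm_sum {ι : Type*} (s : Finset ι) (r : ι → ℝ) (χ : ι → Matrix (Fin n) (Fin n) ℝ)
    (α : Fin n) : (thetaIm (∑ i ∈ s, r i • χ i) α : SuperAlg m n) =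
      ∑ i ∈ s, r i • thetaIm (χ i) α := by
  simp only [thetaIm, Matrix.sum_apply, Matrix.smul_apply, Finset.sum_smul, Finset.smul_sum,
    smul_smul, smul_eq_mul]
  rw [Finset.sum_comm]

theorem pixiIm_sum {ι : Type*} (s : Finset ι) (r : ι → ℝ) (χ : ι → Matrix (Fin n) (Fin n) ℝ)
    (α : Fin n) : (pixiIm (∑ i ∈ s, r i • χ i) α : SuperAlg m n) =
      ∑ i ∈ s, r i • pixiIm (χ i) α := by
  simp only [pixiIm, Matrix.sum_apply, Matrix.smul_apply, Finset.sum_smul, Finset.smul_sum,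
    smul_smul, smul_eq_mul]
  rw [Finset.sum_comm]

theorem thetaIm_mul (χ N : Matrix (Fin n) (Fin n) ℝ) (α : Fin n) :
    (thetaIm (χ * N) α : SuperAlg m n) = ∑ β, χ α β • thetaIm N β := by
  simp only [thetaIm, Matrix.mul_apply, Finset.sum_smul, Finset.smul_sum, smul_smul]
  rw [Finset.sum_comm]

theorem pixiIm_mul (N c : Matrix (Fin n) (Fin n) ℝ) (α : Fin n) :
    (pixiIm (N * c) α : SuperAlg m n) = ∑ β, c β α • pixiIm N β := by
  simp only [pixiIm, Matrix.mul_apply, Finset.sum_smul, Finset.smul_sum, smul_smul]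
  rw [Finset.sum_comm]
  simp only [mul_comm]

theorem thetaIm_neg (χ : Matrix (Fin n) (Fin n) ℝ) (α : Fin n) :
    (thetaIm (-χ) α : SuperAlg m n) = -thetaIm χ α := by
  simp [thetaIm]

/-- The bracket with `θ'^α` of the odd symplectic structure, in terms of the old coordinates. -/
theorem intMap_bracket_theta {χ c : Matrix (Fin n) (Fin n) ℝ} {K : Matrix (Fin m) (Fin m) ℝ}
    {N χ' : Fin m → Matrix (Fin n) (Fin n) ℝ} (hχc : χ * c = 1)
    (hχN : ∀ k, ∑ i, K i k • χ' i = -(χ * N k)) (α : Fin n) (u : SuperAlg m n) :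
    ∑ β, χ α β • dXi β (intMap χ c K N u) +
      (-1 : ℝ) ^ n • ∑ i, thetaIm (χ' i) α * dE i (intMap χ c K N u) =
        intMap χ c K N (dXi α u) := by
  have anti : ∀ v ∈ oddLinear m n, ∀ w : Fin m → SuperAlg m n,
      ∑ i, thetaIm (χ' i) α * (v * w i) = -(v * ∑ i, thetaIm (χ' i) α * w i) := by
    intro v hv w
    rw [Finset.mul_sum, ← Finset.sum_neg_distrib]
    refine Finset.sum_congr rfl fun i _ => ?_
    rw [← mul_assoc, oddLinear_anticomm (thetaIm_mem _ _) hv, neg_mul, mul_assoc]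
  have comm : ∀ (v : SuperAlg m n) (w : Fin m → SuperAlg m n),
      (∀ w, v * w = w * v) → ∑ i, thetaIm (χ' i) α * (v * w i) =
        v * ∑ i, thetaIm (χ' i) α * w i := by
    intro v w hv
    rw [Finset.mul_sum]
    refine Finset.sum_congr rfl fun i _ => ?_
    rw [← mul_assoc, ← hv, mul_assoc]
  induction u using gen_induction with
  | one => simp
  | smul r a h =>
    simp only [map_smul, smul_comm _ r, mul_smul_comm, ← Finset.smul_sum, ← smul_add, h]
  | add a b ha hb =>
    simp only [map_add, smul_add, mul_add, Finset.sum_add_distrib, ← ha, ← hb]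
    abel
  | theta β a h =>
    simp only [map_mul, intMap_theta, dXi_thetaIm_mul, dXi_theta_mul, dE_thetaIm_mul, mul_neg,
      Finset.sum_neg_distrib, ← mul_smul_comm, ← Finset.mul_sum, ← h]
    rw [anti _ (thetaIm_mem _ _), neg_neg, mul_add, mul_smul_comm]
  | e k a h =>
    have h1 : ∑ i, thetaIm (χ' i) α * (K i k • intMap χ c K N a) =
        -∑ β, χ α β • (thetaIm (N k) β * intMap χ c K N a) := by
      simp only [mul_smul_comm, ← smul_mul_assoc, ← Finset.sum_mul]
      rw [← thetaIm_sum, hχN, thetaIm_neg, thetaIm_mul, neg_mul]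
    simp only [map_mul, intMap_e, dXi_pieIm_mul, dXi_e_mul, dE_pieIm_mul, mul_sub, smul_add,
      Finset.sum_sub_distrib, Finset.sum_add_distrib, h1, smul_comm (_ : ℝ) ((-1 : ℝ) ^ n),
      ← Finset.smul_sum, ← h]
    rw [anti _ (pieIm_mem _ _ _)]
    simp only [mul_add, mul_smul_comm, Finset.mul_sum]
    module
  | xi β a h =>
    have h1 : ∑ γ, χ α γ • (c γ β • intMap χ c K N a) = if α = β then intMap χ c K N a else 0 := by
      simp only [smul_smul, ← Finset.sum_smul]
      rw [← Matrix.mul_apply, hχc, Matrix.one_apply]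
      split_ifs <;> simp
    simp only [map_mul, map_add, intMap_xi, dXi_pixiIm_mul, dXi_xi_mul, dE_pixiIm_mul, smul_add,
      Finset.sum_add_distrib, h1, ← h, apply_ite (intMap χ c K N), map_zero]
    rw [comm _ _ (pixiIm_comm c β)]
    simp only [mul_add, mul_smul_comm, Finset.mul_sum]
    module

/-- The bracket with `π∂_{θ'^α}` of the odd symplectic structure, in terms of the old
coordinates. -/
theorem intMap_bracket_xi {χ c : Matrix (Fin n) (Fin n) ℝ} {K : Matrix (Fin m) (Fin m) ℝ}
    {N c' : Fin m → Matrix (Fin n) (Fin n) ℝ} (hχc : χ * c = 1)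
    (hcN : ∀ k, ∑ i, K i k • c' i = N k * c) (α : Fin n) (u : SuperAlg m n) :
    ∑ β, c β α • dTheta β (intMap χ c K N u) -
      (-1 : ℝ) ^ n • ∑ i, pixiIm (c' i) α * dE i (intMap χ c K N u) =
        intMap χ c K N (dTheta α u) := by
  have comm : ∀ (v : SuperAlg m n) (w : Fin m → SuperAlg m n),
      ∑ i, pixiIm (c' i) α * (v * w i) = v * ∑ i, pixiIm (c' i) α * w i := by
    intro v w
    rw [Finset.mul_sum]
    refine Finset.sum_congr rfl fun i _ => ?_
    rw [← mul_assoc, pixiIm_comm, mul_assoc]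
  induction u using gen_induction with
  | one => simp
  | smul r a h =>
    simp only [map_smul, smul_comm _ r, mul_smul_comm, ← Finset.smul_sum, ← smul_sub, h]
  | add a b ha hb =>
    simp only [map_add, smul_add, mul_add, Finset.sum_add_distrib, ← ha, ← hb]
    abel
  | theta β a h =>
    have h1 : ∑ γ, c γ α • (χ β γ • intMap χ c K N a) = if α = β then intMap χ c K N a else 0 := by
      simp only [smul_smul, ← Finset.sum_smul, mul_comm (c _ _)]
      rw [← Matrix.mul_apply, hχc, Matrix.one_apply]
      simp only [eq_comm (a := β)]
      split_ifs <;> simp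
    simp only [map_mul, map_sub, intMap_theta, dTheta_thetaIm_mul, dTheta_theta_mul,
      dE_thetaIm_mul, mul_neg, Finset.sum_neg_distrib, smul_sub, Finset.sum_sub_distrib, h1, comm,
      ← h, apply_ite (intMap χ c K N), map_zero, mul_sub, mul_smul_comm, Finset.mul_sum]
    module
  | e k a h =>
    have h1 : ∑ i, pixiIm (c' i) α * (K i k • intMap χ c K N a) =
        ∑ β, c β α • (pixiIm (N k) β * intMap χ c K N a) := by
      simp only [mul_smul_comm, ← smul_mul_assoc, ← Finset.sum_mul]
      rw [← pixiIm_sum, hcN, pixiIm_mul]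
    simp only [map_mul, map_neg, intMap_e, dTheta_pieIm_mul, dTheta_e_mul, dE_pieIm_mul, mul_sub,
      smul_sub, Finset.sum_sub_distrib, h1, smul_comm (_ : ℝ) ((-1 : ℝ) ^ n),
      ← Finset.smul_sum, ← h, comm]
    simp only [mul_smul_comm, Finset.mul_sum]
    module
  | xi β a h =>
    simp only [map_mul, intMap_xi, dTheta_pixiIm_mul, dTheta_xi_mul, dE_pixiIm_mul, comm, ← h,
      mul_sub, mul_smul_comm, Finset.mul_sum]

end IntNaturality

/-! ### Naturality of the differential of integral forms -/

section DeltaNaturality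

variable {m n : ℕ}

/-- The data of a change of coordinates of integral forms near `x`: the matrix `χ` and its inverse
`c`, the inverse `K` of the Jacobian matrix, the matrices `N k = (∂c/∂x'^k) χ`, and the logarithmic
derivatives `l` of the Berezinian at `x`. The conditions are: `N` is as stated, the
coordinate vector fields `∂/∂x'^k` commute (`K_symm` and `flat`), and the Berezinian is the
factor by which the coordinate volume elements differ (`divergence`). -/
structure IsIntChange (x : EuclideanSpace ℝ (Fin m))
    (χ c : EuclideanSpace ℝ (Fin m) → Matrix (Fin n) (Fin n) ℝ)
    (K : EuclideanSpace ℝ (Fin m) → Matrix (Fin m) (Fin m) ℝ)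
    (N : EuclideanSpace ℝ (Fin m) → Fin m → Matrix (Fin n) (Fin n) ℝ)
    (l : Fin m → ℝ) : Prop where
  diff_χ : ∀ α β, DifferentiableAt ℝ (fun y => χ y α β) x
  diff_c : ∀ α β, DifferentiableAt ℝ (fun y => c y α β) x
  diff_K : ∀ i j, DifferentiableAt ℝ (fun y => K y i j) x
  diff_N : ∀ k α β, DifferentiableAt ℝ (fun y => N y k α β) x
  χ_mul_c : χ x * c x = 1
  pd_χ : ∀ k, ∑ i, K x i k • pdMat i χ x = -(χ x * N x k)
  pd_c : ∀ k, ∑ i, K x i k • pdMat i c x = N x k * c x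
  K_symm : ∀ j k l, ∑ i, K x i k * pdMat i K x j l = ∑ i, K x i l * pdMat i K x j k
  flat : ∀ k l, ∑ i, K x i k • pdMat i (fun y => N y l) x -
    ∑ i, K x i l • pdMat i (fun y => N y k) x = N x k * N x l - N x l * N x k
  divergence : ∀ k, ∑ i, pdMat i K x i k + ∑ i, l i * K x i k = (N x k).trace

variable {x : EuclideanSpace ℝ (Fin m)}
  {χ c : EuclideanSpace ℝ (Fin m) → Matrix (Fin n) (Fin n) ℝ}
  {K : EuclideanSpace ℝ (Fin m) → Matrix (Fin m) (Fin m) ℝ}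
  {N : EuclideanSpace ℝ (Fin m) → Fin m → Matrix (Fin n) (Fin n) ℝ}
  {l : Fin m → ℝ}

/-- The partial derivative of `π∂_{x'^k}` with respect to `x^i`. -/
def dpie (K : EuclideanSpace ℝ (Fin m) → Matrix (Fin m) (Fin m) ℝ)
    (N : EuclideanSpace ℝ (Fin m) → Fin m → Matrix (Fin n) (Fin n) ℝ)
    (x : EuclideanSpace ℝ (Fin m)) (i k : Fin m) : SuperAlg m n :=
  pieIm (pdMat i K x) (fun j => pdMat i (fun y => N y j) x) k

/-- The Lie derivative along the coordinate vector field `∂/∂x'^k`, of a multivector field with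
value `F` and partial derivatives `F'` at `x`. -/
def lieAt (K : EuclideanSpace ℝ (Fin m) → Matrix (Fin m) (Fin m) ℝ)
    (N : EuclideanSpace ℝ (Fin m) → Fin m → Matrix (Fin n) (Fin n) ℝ)
    (x : EuclideanSpace ℝ (Fin m)) (k : Fin m) (F : SuperAlg m n) (F' : Fin m → SuperAlg m n) :
    SuperAlg m n :=
  ∑ i, K x i k • F' i - ∑ i, dpie K N x i k * dE i F - ∑ α, pixiIm (N x k) α * dXi α F +
    ∑ α, thetaIm (N x k) α * dTheta α F

theorem sum_mul_of_comm {ι B : Type*} [Fintype ι] [Ring B] (p : B) (q w : ι → B)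
    (h : ∀ i, q i * p = p * q i) : ∑ i, q i * (p * w i) = p * ∑ i, q i * w i := by
  rw [Finset.mul_sum]
  exact Finset.sum_congr rfl fun i _ => by rw [← mul_assoc, h, mul_assoc]

theorem sum_mul_of_anticomm {ι B : Type*} [Fintype ι] [Ring B] (p : B) (q w : ι → B)
    (h : ∀ i, q i * p = -(p * q i)) : ∑ i, q i * (p * w i) = -(p * ∑ i, q i * w i) := by
  rw [Finset.mul_sum, ← Finset.sum_neg_distrib]
  exact Finset.sum_congr rfl fun i _ => by rw [← mul_assoc, h, neg_mul, mul_assoc]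

theorem dpie_mem (i k : Fin m) : dpie K N x i k ∈ oddLinear m n := pieIm_mem _ _ _

/-- The Lie derivative along `∂/∂x'^k` annihilates `θ'^α`. -/
theorem lieAt_theta (h : IsIntChange x χ c K N l) (k : Fin m) (α : Fin n)
    (F : SuperAlg m n) (F' : Fin m → SuperAlg m n) :
    lieAt K N x k (thetaIm (χ x) α * F)
      (fun i => thetaIm (pdMat i χ x) α * F + thetaIm (χ x) α * F' i) =
      thetaIm (χ x) α * lieAt K N x k F F' := by
  have h1 : ∑ i, K x i k • ((thetaIm (pdMat i χ x) α : SuperAlg m n) * F) =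
      -∑ β, χ x α β • (thetaIm (N x k) β * F) := by
    simp only [← smul_mul_assoc, ← Finset.sum_mul]
    rw [← thetaIm_sum, h.pd_χ, thetaIm_neg, thetaIm_mul, neg_mul]
  simp only [lieAt, smul_add, Finset.sum_add_distrib, h1, dE_thetaIm_mul, dXi_thetaIm_mul,
    dTheta_thetaIm_mul, mul_sub, mul_neg, Finset.sum_sub_distrib, Finset.sum_neg_distrib]
  rw [sum_mul_of_anticomm _ _ _ fun i => oddLinear_anticomm (dpie_mem i k) (thetaIm_mem _ _),
    sum_mul_of_comm _ _ _ fun β => pixiIm_comm _ _ _,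
    sum_mul_of_anticomm _ _ _ fun i => oddLinear_anticomm (thetaIm_mem _ _) (thetaIm_mem _ _)]
  simp only [mul_add, mul_sub, mul_smul_comm, Finset.mul_sum]
  module

/-- The Lie derivative along `∂/∂x'^k` annihilates `π∂_{θ'^α}`. -/
theorem lieAt_xi (h : IsIntChange x χ c K N l) (k : Fin m) (α : Fin n)
    (F : SuperAlg m n) (F' : Fin m → SuperAlg m n) :
    lieAt K N x k (pixiIm (c x) α * F)
      (fun i => pixiIm (pdMat i c x) α * F + pixiIm (c x) α * F' i) =
      pixiIm (c x) α * lieAt K N x k F F' := by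
  have h1 : ∑ i, K x i k • ((pixiIm (pdMat i c x) α : SuperAlg m n) * F) =
      ∑ β, c x β α • (pixiIm (N x k) β * F) := by
    simp only [← smul_mul_assoc, ← Finset.sum_mul]
    rw [← pixiIm_sum, h.pd_c, pixiIm_mul]
  simp only [lieAt, smul_add, Finset.sum_add_distrib, h1, dE_pixiIm_mul, dXi_pixiIm_mul,
    dTheta_pixiIm_mul, mul_add]
  rw [sum_mul_of_comm _ _ _ fun i => (pixiIm_comm _ _ _).symm,
    sum_mul_of_comm _ _ _ fun i => (pixiIm_comm _ _ _).symm,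
    sum_mul_of_comm _ _ _ fun i => (pixiIm_comm _ _ _).symm]
  simp only [mul_sub, mul_smul_comm, Finset.mul_sum]
  module

/-- The Lie derivative of `π∂_{x'^j}` along `∂/∂x'^k` vanishes, as the two vector fields commute. -/
theorem lie_pieIm_eq_zero (h : IsIntChange x χ c K N l) (k j : Fin m) :
    ∑ i, K x i k • (dpie K N x i j : SuperAlg m n) - ∑ i, K x i j • dpie K N x i k -
      (-1 : ℝ) ^ n • ∑ α, pixiIm (N x k) α * thetaIm (N x j) α +
      (-1 : ℝ) ^ n • ∑ α, thetaIm (N x k) α * pixiIm (N x j) α = 0 := by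
  have h1 : ∀ k j, ∑ i, K x i k • (dpie K N x i j : SuperAlg m n) =
      ∑ a, (∑ i, K x i k * pdMat i K x a j) • genE a + (-1 : ℝ) ^ n • ∑ β, ∑ γ,
        (∑ i, K x i k • pdMat i (fun y => N y j) x) β γ • (genTheta γ * genXi β) := by
    intro k j
    simp only [dpie, pieIm, smul_add, Finset.sum_add_distrib, Finset.smul_sum, Finset.sum_smul,
      smul_smul, Matrix.sum_apply, Matrix.smul_apply, smul_eq_mul]
    congr 1
    · rw [Finset.sum_comm]
    · rw [Finset.sum_comm]
      refine Finset.sum_congr rfl fun β _ => ?_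
      rw [Finset.sum_comm]
      refine Finset.sum_congr rfl fun γ _ => Finset.sum_congr rfl fun i _ => ?_
      ring_nf
  have h2 : ∀ A B : Matrix (Fin n) (Fin n) ℝ,
      ∑ α, (pixiIm A α : SuperAlg m n) * thetaIm B α =
        ∑ β, ∑ γ, (A * B) β γ • (genTheta γ * genXi β) := by
    intro A B
    simp only [pixiIm, thetaIm, Finset.sum_mul_sum, smul_mul_smul_comm, xi_theta,
      Matrix.mul_apply, Finset.sum_smul]
    rw [Finset.sum_comm]
    refine Finset.sum_congr rfl fun β _ => ?_
    rw [Finset.sum_comm]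
  have h3 : ∀ A B : Matrix (Fin n) (Fin n) ℝ,
      ∑ α, (thetaIm A α : SuperAlg m n) * pixiIm B α = ∑ α, pixiIm B α * thetaIm A α :=
    fun A B => Finset.sum_congr rfl fun α _ => (pixiIm_comm _ _ _).symm
  have h4 : ∑ i, K x i k • pdMat i (fun y => N y j) x =
      ∑ i, K x i j • pdMat i (fun y => N y k) x + (N x k * N x j - N x j * N x k) :=
    sub_eq_iff_eq_add'.1 (h.flat k j)
  rw [h3, h2, h2, h1 k j, h1 j k, h4]
  simp only [h.K_symm _ k j, Matrix.add_apply, Matrix.sub_apply, add_smul, sub_smul,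
    Finset.sum_add_distrib, Finset.sum_sub_distrib]
  module

/-- The Lie derivative along `∂/∂x'^k` annihilates `π∂_{x'^j}`. -/
theorem lieAt_e (h : IsIntChange x χ c K N l) (k j : Fin m)
    (F : SuperAlg m n) (F' : Fin m → SuperAlg m n) :
    lieAt K N x k (pieIm (K x) (N x) j * F)
      (fun i => dpie K N x i j * F + pieIm (K x) (N x) j * F' i) =
      pieIm (K x) (N x) j * lieAt K N x k F F' := by
  have h1 := congrArg (· * F) (lie_pieIm_eq_zero h k j)
  simp only [add_mul, sub_mul, Finset.sum_mul, smul_mul_assoc, zero_mul, mul_assoc] at h1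
  simp only [lieAt, smul_add, Finset.sum_add_distrib, dE_pieIm_mul, dXi_pieIm_mul,
    dTheta_pieIm_mul, mul_sub, mul_add, Finset.sum_sub_distrib, mul_smul_comm, ← Finset.smul_sum]
  rw [sum_mul_of_anticomm _ _ _ fun i => oddLinear_anticomm (dpie_mem i k) (pieIm_mem _ _ _),
    sum_mul_of_comm _ _ _ fun i => pixiIm_comm _ _ _,
    sum_mul_of_anticomm _ _ _ fun i => oddLinear_anticomm (thetaIm_mem _ _) (pieIm_mem _ _ _)]
  rw [← sub_eq_zero]
  simp only [mul_smul_comm, Finset.mul_sum] at h1 ⊢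
  rw [← h1]
  module

/-- The differential `δ`, twisted by the logarithmic derivatives `l` of the Berezinian, of an
integral form with value `F` and partial derivatives `F'` at a point. -/
def deltaAt (l : Fin m → ℝ) (F : SuperAlg m n) (F' : Fin m → SuperAlg m n) : SuperAlg m n :=
  (-1 : ℝ) ^ n • (∑ i, dE i (F' i) + ∑ i, l i • dE i F) - ∑ α, dXi α (dTheta α F)

/-- The Leibniz rule for `δ` and the product with `π∂_{x'^k}`: the bracket of the second-order
operator `δ` with this product is the Lie derivative along `∂/∂x'^k`, provided that the divergence
of this vector field, taken with respect to the Berezinian, vanishes. -/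
theorem deltaAt_e (h : IsIntChange x χ c K N l) (k : Fin m)
    (F : SuperAlg m n) (F' : Fin m → SuperAlg m n) :
    deltaAt l (pieIm (K x) (N x) k * F) (fun i => dpie K N x i k * F + pieIm (K x) (N x) k * F' i) =
      (-1 : ℝ) ^ n • lieAt K N x k F F' - pieIm (K x) (N x) k * deltaAt l F F' := by
  have h8 : ∀ i, dE i (dpie K N x i k * F : SuperAlg m n) =
      pdMat i K x i k • F - dpie K N x i k * dE i F := fun i => dE_pieIm_mul _ _ _ _ _
  have h1 : ∑ i, dE i (dpie K N x i k * F + pieIm (K x) (N x) k * F' i) =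
      (∑ i, pdMat i K x i k) • F - ∑ i, dpie K N x i k * dE i F + ∑ i, K x i k • F' i -
        pieIm (K x) (N x) k * ∑ i, dE i (F' i) := by
    simp only [map_add, h8, dE_pieIm_mul, Finset.sum_add_distrib, Finset.sum_sub_distrib,
      Finset.sum_smul, Finset.mul_sum]
    abel
  have h2 : ∑ i, l i • dE i (pieIm (K x) (N x) k * F) =
      (∑ i, l i * K x i k) • F - pieIm (K x) (N x) k * ∑ i, l i • dE i F := by
    simp only [dE_pieIm_mul, smul_sub, Finset.sum_sub_distrib, Finset.sum_smul, Finset.mul_sum,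
      smul_smul, mul_smul_comm]
  have h3 : ∑ α, dXi α (dTheta α (pieIm (K x) (N x) k * F)) =
      (-1 : ℝ) ^ n • (∑ α, pixiIm (N x k) α * dXi α F + (N x k).trace • F -
        ∑ α, thetaIm (N x k) α * dTheta α F) -
        pieIm (K x) (N x) k * ∑ α, dXi α (dTheta α F) := by
    simp only [dTheta_pieIm_mul, map_sub, map_smul, dXi_pixiIm_mul, dXi_pieIm_mul,
      Finset.sum_sub_distrib, Finset.sum_add_distrib, ← Finset.smul_sum, ← Finset.sum_smul,
      Finset.mul_sum, smul_sub, smul_add, Matrix.trace, Matrix.diag]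
    abel
  have h4 := congrArg (· • F) (h.divergence k)
  simp only [add_smul] at h4
  rw [deltaAt, h1, h2, h3, ← h4, lieAt, deltaAt, mul_sub, mul_smul_comm, mul_add]
  module

/-- The differential `δ` commutes with changes of coordinates, for integral forms with constant
coefficients in the new coordinates. The second-order operator `δ` obeys a Leibniz rule up to a
bracket, which is why the brackets with the new generators are needed. -/
theorem intMap_natural (h : IsIntChange x χ c K N l) (u : SuperAlg m n) :
    ∃ u', HasDer x (fun y => intMap (χ y) (c y) (K y) (N y) u) u' ∧
      (∀ k, lieAt K N x k (intMap (χ x) (c x) (K x) (N x) u) u' = 0) ∧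
      deltaAt l (intMap (χ x) (c x) (K x) (N x) u) u' =
        -intMap (χ x) (c x) (K x) (N x) (∑ α, dXi α (dTheta α u)) := by
  induction u using gen_induction with
  | one => exact ⟨_, (HasDer.const 1).congr (Filter.Eventually.of_forall fun y => map_one _),
      by simp [lieAt], by simp [deltaAt]⟩
  | smul r a ih =>
    obtain ⟨a', h1, h2, h3⟩ := ih
    refine ⟨_, (h1.map (LinearMap.lsmul ℝ _ r)).congr
      (Filter.Eventually.of_forall fun y => by simp), fun k => ?_, ?_⟩
    · refine Eq.trans ?_ ((congrArg (r • ·) (h2 k)).trans (smul_zero r))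
      simp only [lieAt, map_smul, LinearMap.lsmul_apply, mul_smul_comm, smul_comm _ r,
        ← Finset.smul_sum, ← smul_sub, ← smul_add]
    · simp only [deltaAt, map_smul, LinearMap.lsmul_apply, smul_comm _ r, ← Finset.smul_sum,
        ← smul_sub, ← smul_add, ← smul_neg, ← h3]
  | add a b ha hb =>
    obtain ⟨a', h1, h2, h3⟩ := ha
    obtain ⟨b', h4, h5, h6⟩ := hb
    refine ⟨_, (h1.add h4).congr (Filter.Eventually.of_forall fun y => map_add _ _ _),
      fun k => ?_, ?_⟩
    · refine Eq.trans ?_ ((congrArg₂ (· + ·) (h2 k) (h5 k)).trans (add_zero 0))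
      simp only [lieAt, map_add, smul_add, mul_add, Finset.sum_add_distrib]
      abel
    · simp only [map_add, Finset.sum_add_distrib, neg_add] at h3 h6 ⊢
      rw [← h3, ← h6]
      simp only [deltaAt, map_add, smul_add, Finset.sum_add_distrib]
      abel
  | theta α a ih =>
    obtain ⟨a', h1, h2, h3⟩ := ih
    refine ⟨_, ((hasDer_thetaIm h.diff_χ α).mul h1).congr (Filter.Eventually.of_forall fun y => by
      simp only [map_mul, intMap_theta]), fun k => ?_, ?_⟩
    · rw [map_mul, intMap_theta, lieAt_theta h, h2, mul_zero]
    · have h4 := intMap_bracket_theta (K := K x) h.χ_mul_c h.pd_χ α a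
      have h5 := congrArg (thetaIm (χ x) α * ·) h3
      simp only [deltaAt, map_mul, map_add, map_sub, map_sum, intMap_theta, dE_thetaIm_mul,
        dTheta_thetaIm_mul, dTheta_theta_mul, dXi_thetaIm_mul, dXi_theta_mul, map_smul,
        Finset.sum_add_distrib, Finset.sum_sub_distrib, apply_ite (dXi _), map_zero,
        Finset.sum_ite_eq', Finset.mem_univ, if_true, smul_neg, Finset.sum_neg_distrib] at h4 h5 ⊢
      rw [← h4]
      simp only [mul_add, mul_sub, mul_neg, mul_smul_comm, Finset.mul_sum] at h5 ⊢
      rw [← sub_eq_zero] at h5 ⊢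
      rw [← neg_eq_zero, ← h5]
      module
  | e k a ih =>
    obtain ⟨a', h1, h2, h3⟩ := ih
    refine ⟨_, ((hasDer_pieIm h.diff_K h.diff_N k).mul h1).congr
      (Filter.Eventually.of_forall fun y => by simp only [map_mul, intMap_e]), fun j => ?_, ?_⟩
    · rw [map_mul, intMap_e]
      have := lieAt_e h j k (intMap (χ x) (c x) (K x) (N x) a) a'
      rw [h2, mul_zero] at this
      exact this
    · rw [map_mul, intMap_e]
      refine (deltaAt_e h k _ a').trans ?_
      rw [h2, h3]
      simp only [dTheta_e_mul, dXi_e_mul, map_neg, map_mul, map_sum, intMap_e,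
        Finset.sum_neg_distrib]
      simp [Finset.mul_sum]
  | xi α a ih =>
    obtain ⟨a', h1, h2, h3⟩ := ih
    refine ⟨_, ((hasDer_pixiIm h.diff_c α).mul h1).congr (Filter.Eventually.of_forall fun y => by
      simp only [map_mul, intMap_xi]), fun k => ?_, ?_⟩
    · rw [map_mul, intMap_xi, lieAt_xi h, h2, mul_zero]
    · have h4 := intMap_bracket_xi (K := K x) h.χ_mul_c h.pd_c α a
      have h5 := congrArg (pixiIm (c x) α * ·) h3
      simp only [deltaAt, map_mul, map_add, map_sum, intMap_xi, dE_pixiIm_mul,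
        dTheta_pixiIm_mul, dTheta_xi_mul, dXi_pixiIm_mul, dXi_xi_mul,
        Finset.sum_add_distrib, Finset.sum_ite_eq', Finset.mem_univ, if_true] at h4 h5 ⊢
      rw [← h4]
      simp only [mul_add, mul_sub, mul_neg, mul_smul_comm, Finset.mul_sum] at h5 ⊢
      rw [← sub_eq_zero] at h5 ⊢
      rw [← h5]
      module

end DeltaNaturality

/-! ### Partial derivatives of matrices and determinants -/

section MatrixCalculus

variable {m k : ℕ} {x : EuclideanSpace ℝ (Fin m)}

theorem contDiffAt_pd {f : EuclideanSpace ℝ (Fin m) → ℝ} (hf : ContDiffAt ℝ ∞ f x) (i : Fin m) :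
    ContDiffAt ℝ ∞ (pd i f) x :=
  (hf.fderiv_right (m := ∞) (by norm_cast)).clm_apply contDiffAt_const

theorem pd_comm {f : EuclideanSpace ℝ (Fin m) → ℝ} (hf : ContDiffAt ℝ ∞ f x) (i j : Fin m) :
    pd i (pd j f) x = pd j (pd i f) x := by
  have hd : DifferentiableAt ℝ (fderiv ℝ f) x :=
    (hf.fderiv_right (m := 1) (by norm_cast)).differentiableAt (by simp)
  have key : ∀ a b : Fin m, pd a (pd b f) x = fderiv ℝ (fderiv ℝ f) x
      (EuclideanSpace.single a 1) (EuclideanSpace.single b 1) := by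
    intro a b
    change fderiv ℝ (fun y => fderiv ℝ f y (EuclideanSpace.single b 1)) x _ = _
    rw [fderiv_clm_apply hd (differentiableAt_const _)]
    simp
  rw [key, key]
  exact (hf.isSymmSndFDerivAt (by
    rw [minSmoothness_of_isRCLikeNormedField]
    exact WithTop.coe_le_coe.2 le_top)) _ _

theorem pdMat_mul {A B : EuclideanSpace ℝ (Fin m) → Matrix (Fin k) (Fin k) ℝ}
    (hA : ∀ a b, DifferentiableAt ℝ (fun y => A y a b) x)
    (hB : ∀ a b, DifferentiableAt ℝ (fun y => B y a b) x) (i : Fin m) :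
    pdMat i (fun y => A y * B y) x = pdMat i A x * B x + A x * pdMat i B x := by
  ext a b
  simp only [pdMat, Matrix.of_apply, Matrix.mul_apply, Matrix.add_apply]
  rw [pd_sum _ (f := fun c y => A y a c * B y c b) fun c _ => (hA a c).mul (hB c b),
    ← Finset.sum_add_distrib]
  exact Finset.sum_congr rfl fun c _ => pd_mul (hA a c) (hB c b) i

theorem pdMat_const {A : EuclideanSpace ℝ (Fin m) → Matrix (Fin k) (Fin k) ℝ}
    {C : Matrix (Fin k) (Fin k) ℝ} (hA : ∀ᶠ y in nhds x, A y = C) (i : Fin m) :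
    pdMat i A x = 0 := by
  ext a b
  refine (pd_congr (g := fun _ => C a b) ?_ i).trans (pd_const _ _ _)
  exact hA.mono fun y hy => congrFun (congrFun hy a) b

theorem pd_prod {ι : Type*} [DecidableEq ι] (s : Finset ι) {f : ι → EuclideanSpace ℝ (Fin m) → ℝ}
    (hf : ∀ a ∈ s, DifferentiableAt ℝ (f a) x) (i : Fin m) :
    pd i (fun y => ∏ a ∈ s, f a y) x = ∑ a ∈ s, (∏ b ∈ s.erase a, f b x) * pd i (f a) x := by
  simp [pd, fderiv_finsetProd hf]

theorem differentiableAt_prod_apply {A : EuclideanSpace ℝ (Fin m) → Matrix (Fin k) (Fin k) ℝ}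
    (hA : ∀ a b, DifferentiableAt ℝ (fun y => A y a b) x) (σ : Fin k → Fin k) :
    DifferentiableAt ℝ (fun y => ∏ a, A y (σ a) a) x :=
  (HasFDerivAt.finsetProd (u := Finset.univ) (g := fun a y => A y (σ a) a)
    fun _ _ => (hA _ _).hasFDerivAt).differentiableAt

theorem differentiableAt_det {A : EuclideanSpace ℝ (Fin m) → Matrix (Fin k) (Fin k) ℝ}
    (hA : ∀ a b, DifferentiableAt ℝ (fun y => A y a b) x) :
    DifferentiableAt ℝ (fun y => (A y).det) x := by
  simp only [Matrix.det_apply']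
  exact DifferentiableAt.fun_sum fun σ _ =>
    (differentiableAt_prod_apply hA σ).const_mul _

/-- Jacobi's formula for the derivative of a determinant. -/
theorem pd_det {A : EuclideanSpace ℝ (Fin m) → Matrix (Fin k) (Fin k) ℝ}
    (hA : ∀ a b, DifferentiableAt ℝ (fun y => A y a b) x) {B : Matrix (Fin k) (Fin k) ℝ}
    (hB : B * A x = 1) (i : Fin m) :
    pd i (fun y => (A y).det) x = (A x).det * (B * pdMat i A x).trace := by
  have h1 : pd i (fun y => (A y).det) x =
      ∑ a, ((A x).updateCol a fun b => pdMat i A x b a).det := by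
    simp only [Matrix.det_apply']
    rw [pd_sum _ (f := fun (σ : Equiv.Perm (Fin k)) y =>
      ((Equiv.Perm.sign σ : ℤ) : ℝ) * ∏ a, A y (σ a) a)
      fun σ _ => (differentiableAt_prod_apply hA σ).const_mul _, Finset.sum_comm]
    refine Finset.sum_congr rfl fun σ _ => ?_
    rw [pd_mul (differentiableAt_const _) (differentiableAt_prod_apply hA σ), pd_const, zero_mul,
      zero_add, pd_prod _ (f := fun a y => A y (σ a) a) fun a _ => hA _ _, Finset.mul_sum]
    refine Finset.sum_congr rfl fun a _ => ?_
    rw [← Finset.prod_erase_mul _ _ (Finset.mem_univ a)]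
    congr 2
    · refine Finset.prod_congr rfl fun b hb => ?_
      rw [Matrix.updateCol_ne (Finset.ne_of_mem_erase hb)]
    · rw [Matrix.updateCol_self]
      rfl
  have h2 : (A x).adjugate = (A x).det • B := by
    rw [← Matrix.one_mul (A x).adjugate, ← hB, Matrix.mul_assoc, Matrix.mul_adjugate,
      Matrix.mul_smul, Matrix.mul_one]
  simp only [h1, ← Matrix.cramer_apply, Matrix.cramer_eq_adjugate_mulVec, h2]
  simp only [Matrix.trace, Matrix.diag, Matrix.mul_apply, Matrix.mulVec, dotProduct,
    Matrix.smul_apply, smul_eq_mul, Finset.mul_sum, mul_assoc]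

end MatrixCalculus

/-! ### Transition functions -/

section Transitions

variable {m n : ℕ} {M : Type*} [TopologicalSpace M] [ChartedSpace (EuclideanSpace ℝ (Fin m)) M]
  {V : M → Type*} [TopologicalSpace (TotalSpace (EuclideanSpace ℝ (Fin n)) V)]
  [∀ x, TopologicalSpace (V x)]
  [FiberBundle (EuclideanSpace ℝ (Fin n)) V]

namespace SuperChart

variable {a b : SuperChart m n V} {x : EuclideanSpace ℝ (Fin m)}

theorem isOpen_overlap (a b : SuperChart m n V) : IsOpen (overlap a b) := by
  have h1 := a.chart.symm.isOpen_inter_preimage (b.chart.open_source.inter b.triv.open_baseSet)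
  have h2 : overlap a b = (a.domain : Set (EuclideanSpace ℝ (Fin m))) ∩
      (a.chart.symm.source ∩ a.chart.symm ⁻¹' (b.chart.source ∩ b.triv.baseSet)) := by
    ext x
    exact ⟨fun h => ⟨h.1, h.1.1, h.2⟩, fun h => ⟨h.1, h.2.2⟩⟩
  rw [h2]
  exact a.domain.isOpen.inter h1

theorem symm_phi (hx : x ∈ overlap a b) : b.chart.symm (phi a b x) = a.chart.symm x :=
  b.chart.left_inv hx.2.1

theorem phi_mem (hx : x ∈ overlap a b) : phi a b x ∈ overlap b a := by
  have h := symm_phi hx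
  refine ⟨⟨b.chart.map_source hx.2.1, ?_⟩, ?_, ?_⟩
  · change b.chart.symm (phi a b x) ∈ b.triv.baseSet
    rw [h]
    exact hx.2.2
  · rw [h]
    exact a.chart.map_target hx.1.1
  · rw [h]
    exact hx.1.2

theorem phi_phi (hx : x ∈ overlap a b) : phi b a (phi a b x) = x := by
  rw [phi, symm_phi hx]
  exact a.chart.right_inv hx.1.1

theorem eventually_mem (hx : x ∈ overlap a b) : ∀ᶠ y in nhds x, y ∈ overlap a b :=
  (isOpen_overlap a b).mem_nhds hx

theorem contDiffAt_phi [IsManifold (𝓡 m) ∞ M] (hx : x ∈ overlap a b) :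
    ContDiffAt ℝ ∞ (phi a b) x := by
  have h1 : ContMDiffOn (𝓡 m) (𝓡 m) ∞ a.chart.symm a.chart.target :=
    contMDiffOn_symm_of_mem_maximalAtlas (IsManifold.subset_maximalAtlas a.chart_mem)
  have h2 : ContMDiffOn (𝓡 m) (𝓡 m) ∞ b.chart b.chart.source :=
    contMDiffOn_of_mem_maximalAtlas (IsManifold.subset_maximalAtlas b.chart_mem)
  have h3 : ContMDiffOn (𝓡 m) (𝓡 m) ∞ (phi a b) (overlap a b) :=
    h2.comp (h1.mono fun y hy => hy.1.1) fun y hy => hy.2.1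
  exact (contMDiffOn_iff_contDiffOn.1 h3).contDiffAt ((isOpen_overlap a b).mem_nhds hx)

theorem contDiffAt_phi_apply [IsManifold (𝓡 m) ∞ M] (hx : x ∈ overlap a b) (j : Fin m) :
    ContDiffAt ℝ ∞ (fun y => phi a b y j) x :=
  (EuclideanSpace.proj j : EuclideanSpace ℝ (Fin m) →L[ℝ] ℝ).contDiff.contDiffAt.comp x
    (contDiffAt_phi hx)

theorem differentiableAt_phi [IsManifold (𝓡 m) ∞ M] (hx : x ∈ overlap a b) :
    DifferentiableAt ℝ (phi a b) x :=
  (contDiffAt_phi hx).differentiableAt (by simp)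

section Jacobian

variable [IsManifold (𝓡 m) ∞ M]

theorem jac_apply (hx : x ∈ overlap a b) (i j : Fin m) :
    jac a b x i j = pd j (fun y => phi a b y i) x := by
  have h : HasFDerivAt (fun y => phi a b y i)
      ((EuclideanSpace.proj i : EuclideanSpace ℝ (Fin m) →L[ℝ] ℝ).comp (fderiv ℝ (phi a b) x)) x :=
    (EuclideanSpace.proj i : EuclideanSpace ℝ (Fin m) →L[ℝ] ℝ).hasFDerivAt.comp x
      (differentiableAt_phi hx).hasFDerivAt
  rw [pd, h.fderiv]
  rfl

theorem pd_comp_phi (hx : x ∈ overlap a b) {f : EuclideanSpace ℝ (Fin m) → ℝ}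
    (hf : DifferentiableAt ℝ f (phi a b x)) (i : Fin m) :
    pd i (fun y => f (phi a b y)) x = ∑ j, jac a b x j i * pd j f (phi a b x) :=
  pd_comp (differentiableAt_phi hx) hf i

theorem jac_eventuallyEq (hx : x ∈ overlap a b) (i j : Fin m) :
    (fun y => jac a b y i j) =ᶠ[nhds x] pd j fun y => phi a b y i :=
  (eventually_mem hx).mono fun _ hy => jac_apply hy i j

theorem contDiffAt_jac (hx : x ∈ overlap a b) (i j : Fin m) :
    ContDiffAt ℝ ∞ (fun y => jac a b y i j) x :=
  (contDiffAt_pd (contDiffAt_phi_apply hx i) j).congr_of_eventuallyEq (jac_eventuallyEq hx i j)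

theorem pd_jac_comm (hx : x ∈ overlap a b) (i j k : Fin m) :
    pd i (fun y => jac a b y j k) x = pd k (fun y => jac a b y j i) x := by
  rw [pd_congr (jac_eventuallyEq hx j k), pd_congr (jac_eventuallyEq hx j i),
    pd_comm (contDiffAt_phi_apply hx j)]

theorem jac_mul_jac (hx : x ∈ overlap a b) : jac b a (phi a b x) * jac a b x = 1 := by
  ext i j
  rw [Matrix.mul_apply]
  have h1 := pd_comp_phi hx
    ((contDiffAt_phi_apply (phi_mem hx) i).differentiableAt (by simp)) j
  have h2 : (fun y => phi b a (phi a b y) i) =ᶠ[nhds x] fun y => y i :=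
    (eventually_mem hx).mono fun y hy =>
      congrArg (fun z : EuclideanSpace ℝ (Fin m) => z i) (phi_phi hy)
  have h3 : pd j (fun y : EuclideanSpace ℝ (Fin m) => y i) x =
      (1 : Matrix (Fin m) (Fin m) ℝ) i j := by
    have h : HasFDerivAt (fun y : EuclideanSpace ℝ (Fin m) => y i)
        (EuclideanSpace.proj i : EuclideanSpace ℝ (Fin m) →L[ℝ] ℝ) x :=
      (EuclideanSpace.proj i : EuclideanSpace ℝ (Fin m) →L[ℝ] ℝ).hasFDerivAt
    rw [pd, h.fderiv, Matrix.one_apply]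
    simp
  rw [← h3, ← pd_congr h2, h1]
  refine Finset.sum_congr rfl fun k _ => ?_
  rw [jac_apply (phi_mem hx), mul_comm]

theorem jac_mul_jac' (hx : x ∈ overlap a b) : jac a b x * jac b a (phi a b x) = 1 :=
  mul_eq_one_comm.1 (jac_mul_jac hx)

/-- The chain rule, for the coordinate vector fields of `b` acting on functions of the
coordinates of `a`. -/
theorem sum_jac_mul_pd (hx : x ∈ overlap a b) {f : EuclideanSpace ℝ (Fin m) → ℝ}
    (hf : DifferentiableAt ℝ f (phi a b x)) (k : Fin m) :
    ∑ i, jac b a (phi a b x) i k * pd i (fun y => f (phi a b y)) x = pd k f (phi a b x) := by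
  have h : ∀ j, ∑ i, jac a b x j i * jac b a (phi a b x) i k =
      (1 : Matrix (Fin m) (Fin m) ℝ) j k := fun j => by
    rw [← jac_mul_jac' hx, Matrix.mul_apply]
  simp only [pd_comp_phi hx hf, Finset.mul_sum]
  rw [Finset.sum_comm]
  have h2 : ∀ j, ∑ i, jac b a (phi a b x) i k * (jac a b x j i * pd j f (phi a b x)) =
      (1 : Matrix (Fin m) (Fin m) ℝ) j k * pd j f (phi a b x) := fun j => by
    rw [← h j, Finset.sum_mul]
    exact Finset.sum_congr rfl fun i _ => by ring
  simp [h2, Matrix.one_apply]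

theorem sum_jac_smul_pdMat (hx : x ∈ overlap a b) {k : ℕ}
    {A : EuclideanSpace ℝ (Fin m) → Matrix (Fin k) (Fin k) ℝ}
    (hA : ∀ α β, DifferentiableAt ℝ (fun y => A y α β) (phi a b x)) (l : Fin m) :
    ∑ i, jac b a (phi a b x) i l • pdMat i (fun y => A (phi a b y)) x =
      pdMat l A (phi a b x) := by
  ext α β
  simp only [Matrix.sum_apply, Matrix.smul_apply, smul_eq_mul, pdMat, Matrix.of_apply]
  exact sum_jac_mul_pd hx (hA α β) l

end Jacobian

variable [∀ x, AddCommGroup (V x)] [∀ x, Module ℝ (V x)]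
  [VectorBundle ℝ (EuclideanSpace ℝ (Fin n)) V]

theorem chi_mul_chi (hx : x ∈ overlap a b) : chi b a (phi a b x) * chi a b x = 1 := by
  have h : ∀ v, b.triv.coordChangeL ℝ a.triv (a.chart.symm x)
      (a.triv.coordChangeL ℝ b.triv (a.chart.symm x) v) = v := by
    intro v
    rw [← Trivialization.symm_coordChangeL (e := a.triv) b.triv ⟨hx.2.2, hx.1.2⟩]
    exact ContinuousLinearEquiv.symm_apply_apply _ _
  have h2 : ∀ (L : EuclideanSpace ℝ (Fin n) ≃L[ℝ] EuclideanSpace ℝ (Fin n))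
      (v : EuclideanSpace ℝ (Fin n)) (α : Fin n),
      ∑ β, L (EuclideanSpace.single β 1) α * v β = L v α := by
    intro L v α
    have hv : v = ∑ j, v j • EuclideanSpace.single j (1 : ℝ) := by
      ext k
      simp [Pi.single_apply]
    conv_rhs => rw [hv]
    simp [mul_comm]
  ext α β
  rw [Matrix.mul_apply]
  simp only [chi, Matrix.of_apply, symm_phi hx]
  rw [h2, h, Matrix.one_apply]
  simp

theorem chi_mul_chi' (hx : x ∈ overlap a b) : chi a b x * chi b a (phi a b x) = 1 :=
  mul_eq_one_comm.1 (chi_mul_chi hx)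

theorem ber_eq (hx : x ∈ overlap a b) :
    ber a b x = (jac a b x).det * (chi b a (phi a b x)).det := by
  have h : (chi a b x).det * (chi b a (phi a b x)).det = 1 := by
    rw [← Matrix.det_mul, chi_mul_chi' hx, Matrix.det_one]
  rw [ber, eq_inv_of_mul_eq_one_right h, div_eq_mul_inv]

theorem det_chi_ne_zero (hx : x ∈ overlap a b) : (chi a b x).det ≠ 0 := by
  intro h
  have h2 := congrArg Matrix.det (chi_mul_chi hx)
  rw [Matrix.det_mul, h, mul_zero, Matrix.det_one] at h2
  exact zero_ne_one h2

theorem ber_mul_det_chi (hx : x ∈ overlap a b) :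
    ber a b x * (chi a b x).det = (jac a b x).det :=
  div_mul_cancel₀ _ (det_chi_ne_zero hx)

theorem contDiffAt_chi [IsManifold (𝓡 m) ∞ M]
    [ContMDiffVectorBundle ∞ (EuclideanSpace ℝ (Fin n)) V (𝓡 m)]
    (hx : x ∈ overlap a b) (α β : Fin n) :
    ContDiffAt ℝ ∞ (fun y => chi a b y α β) x := by
  have h1 : ContMDiffOn (𝓡 m) (𝓡 m) ∞ a.chart.symm a.chart.target :=
    contMDiffOn_symm_of_mem_maximalAtlas (IsManifold.subset_maximalAtlas a.chart_mem)
  have h2 := contMDiffOn_coordChangeL (IB := 𝓡 m) (n := ∞) a.triv b.triv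
  have h3 := h2.comp (h1.mono fun y (hy : y ∈ overlap a b) => hy.1.1)
    fun y hy => ⟨hy.1.2, hy.2.2⟩
  have h4 := (contMDiffOn_iff_contDiffOn.1 h3).contDiffAt ((isOpen_overlap a b).mem_nhds hx)
  have h5 := h4.clm_apply (contDiffAt_const (c := EuclideanSpace.single β (1 : ℝ)))
  exact (EuclideanSpace.proj α : EuclideanSpace ℝ (Fin n) →L[ℝ] ℝ).contDiff.contDiffAt.comp x h5

end SuperChart
end Transitions

/-! ### The Berezinian and the divergence of the coordinate vector fields -/

section Transitions

variable {m n : ℕ} {M : Type*} [TopologicalSpace M] [ChartedSpace (EuclideanSpace ℝ (Fin m)) M]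
  [IsManifold (𝓡 m) ∞ M]
  {V : M → Type*} [TopologicalSpace (TotalSpace (EuclideanSpace ℝ (Fin n)) V)]
  [∀ x, TopologicalSpace (V x)] [FiberBundle (EuclideanSpace ℝ (Fin n)) V]

namespace SuperChart

variable {a b : SuperChart m n V} {x : EuclideanSpace ℝ (Fin m)}

theorem differentiableAt_jac (hx : x ∈ overlap a b) (i j : Fin m) :
    DifferentiableAt ℝ (fun y => jac a b y i j) x :=
  (contDiffAt_jac hx i j).differentiableAt (by simp)

theorem differentiableAt_jac_phi (hx : x ∈ overlap a b) (i j : Fin m) :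
    DifferentiableAt ℝ (fun y => jac b a (phi a b y) i j) x :=
  (differentiableAt_jac (phi_mem hx) i j).comp x (differentiableAt_phi hx)

/-- The divergence of the coordinate vector fields of one coordinate system with respect to the
coordinate volume of another one, plus the derivative of the logarithm of the Jacobian determinant
along them, vanishes. -/
theorem divergence_jac (hx : x ∈ overlap a b) (k : Fin m) :
    ∑ i, pdMat i (fun y => jac b a (phi a b y)) x i k +
      ∑ i, (jac b a (phi a b x) * pdMat i (jac a b) x).trace * jac b a (phi a b x) i k = 0 := by
  have h1 : ∀ i, pdMat i (fun y => jac b a (phi a b y)) x =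
      -(jac b a (phi a b x) * pdMat i (jac a b) x * jac b a (phi a b x)) := by
    intro i
    have h2 := pdMat_mul (differentiableAt_jac_phi hx) (differentiableAt_jac hx) i
    rw [pdMat_const ((eventually_mem hx).mono fun y hy => jac_mul_jac hy)] at h2
    have h3 := congrArg (· * jac b a (phi a b x)) h2.symm
    simp only [add_mul, Matrix.mul_assoc, jac_mul_jac' hx, Matrix.mul_one, Matrix.zero_mul] at h3
    rw [Matrix.mul_assoc]
    exact eq_neg_of_add_eq_zero_left h3
  -- after the trace is expanded, both sums agree by the symmetry of the second derivatives
  have h4 : ∀ i q p, pdMat i (jac a b) x q p = pdMat p (jac a b) x q i :=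
    fun i q p => pd_jac_comm hx i q p
  simp only [h1, Matrix.neg_apply, Finset.sum_neg_distrib, Matrix.mul_apply (M := _ * _)]
  rw [Finset.sum_comm, neg_add_eq_zero]
  refine Finset.sum_congr rfl fun p _ => ?_
  rw [← Finset.sum_mul]
  congr 1
  refine Finset.sum_congr rfl fun i _ => ?_
  rw [Matrix.diag, Matrix.mul_apply, Matrix.mul_apply]
  exact Finset.sum_congr rfl fun q _ => by rw [h4]

theorem det_jac_ne_zero (hx : x ∈ overlap a b) : (jac a b x).det ≠ 0 := by
  intro h
  have h2 := congrArg Matrix.det (jac_mul_jac hx)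
  rw [Matrix.det_mul, h, mul_zero, Matrix.det_one] at h2
  exact zero_ne_one h2

variable [∀ x, AddCommGroup (V x)] [∀ x, Module ℝ (V x)]
  [VectorBundle ℝ (EuclideanSpace ℝ (Fin n)) V]

theorem ber_ne_zero (hx : x ∈ overlap a b) : ber a b x ≠ 0 :=
  div_ne_zero (det_jac_ne_zero hx) (det_chi_ne_zero hx)

variable [ContMDiffVectorBundle ∞ (EuclideanSpace ℝ (Fin n)) V (𝓡 m)]

theorem differentiableAt_chi (hx : x ∈ overlap a b) (α β : Fin n) :
    DifferentiableAt ℝ (fun y => chi a b y α β) x :=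
  (contDiffAt_chi hx α β).differentiableAt (by simp)

theorem differentiableAt_dchi (hx : x ∈ overlap a b) (i : Fin m) (α β : Fin n) :
    DifferentiableAt ℝ (fun y => dchi a b i y α β) x :=
  (contDiffAt_pd (contDiffAt_chi hx α β) i).differentiableAt (by simp)

theorem differentiableAt_chi_phi (hx : x ∈ overlap a b) (α β : Fin n) :
    DifferentiableAt ℝ (fun y => chi b a (phi a b y) α β) x :=
  (differentiableAt_chi (phi_mem hx) α β).comp x (differentiableAt_phi hx)

theorem differentiableAt_dchi_phi (hx : x ∈ overlap a b) (i : Fin m) (α β : Fin n) :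
    DifferentiableAt ℝ (fun y => dchi b a i (phi a b y) α β) x :=
  (differentiableAt_dchi (phi_mem hx) i α β).comp x (differentiableAt_phi hx)

theorem pdMat_dchi (hx : x ∈ overlap a b) (i j : Fin m) :
    pdMat i (dchi a b j) x = pdMat j (dchi a b i) x := by
  ext α β
  exact pd_comm (contDiffAt_chi hx α β) i j

theorem differentiableAt_ber (hx : x ∈ overlap a b) : DifferentiableAt ℝ (ber a b) x :=
  ((differentiableAt_det (differentiableAt_jac hx)).mul
    (differentiableAt_det (differentiableAt_chi_phi hx))).congr_of_eventuallyEq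
      ((eventually_mem hx).mono fun _ hy => ber_eq hy)

/-- The logarithmic derivative of the Berezinian, by Jacobi's formula for both determinants. -/
theorem pd_ber (hx : x ∈ overlap a b) (i : Fin m) :
    pd i (ber a b) x / ber a b x = (jac b a (phi a b x) * pdMat i (jac a b) x).trace +
      (chi a b x * pdMat i (fun y => chi b a (phi a b y)) x).trace := by
  rw [div_eq_iff (ber_ne_zero hx), pd_congr ((eventually_mem hx).mono fun _ hy => ber_eq hy),
    pd_mul (differentiableAt_det (differentiableAt_jac hx))
    (differentiableAt_det (differentiableAt_chi_phi hx)),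
    pd_det (differentiableAt_jac hx) (jac_mul_jac hx),
    pd_det (differentiableAt_chi_phi hx) (chi_mul_chi' hx), ber_eq hx]
  ring

/-- The derivative along `∂/∂x'^k` of the inverse of `χ`. -/
theorem sum_jac_smul_pdMat_chi_phi (hx : x ∈ overlap a b) (k : Fin m) :
    ∑ i, jac b a (phi a b x) i k • pdMat i (fun y => chi b a (phi a b y)) x =
      dchi b a k (phi a b x) * chi a b x * chi b a (phi a b x) := by
  rw [sum_jac_smul_pdMat hx (differentiableAt_chi (phi_mem hx)) k, Matrix.mul_assoc,
    chi_mul_chi' hx, Matrix.mul_one]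
  rfl

theorem sum_jac_smul_pdMat_chi (hx : x ∈ overlap a b) (k : Fin m) :
    ∑ i, jac b a (phi a b x) i k • pdMat i (chi a b) x =
      -(chi a b x * (dchi b a k (phi a b x) * chi a b x)) := by
  have h1 : ∀ i, pdMat i (chi a b) x =
      -(chi a b x * pdMat i (fun y => chi b a (phi a b y)) x * chi a b x) := by
    intro i
    have h2 := pdMat_mul (differentiableAt_chi hx) (differentiableAt_chi_phi hx) i
    rw [pdMat_const ((eventually_mem hx).mono fun y hy => chi_mul_chi' hy)] at h2
    have h3 := congrArg (· * chi a b x) h2.symm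
    simp only [add_mul, Matrix.mul_assoc, chi_mul_chi hx, Matrix.mul_one, Matrix.zero_mul] at h3
    rw [Matrix.mul_assoc]
    exact eq_neg_of_add_eq_zero_left h3
  have h2 : ∀ i, jac b a (phi a b x) i k • pdMat i (chi a b) x = -(chi a b x *
      (jac b a (phi a b x) i k • pdMat i (fun y => chi b a (phi a b y)) x) * chi a b x) := by
    intro i
    rw [h1, smul_neg, Matrix.mul_smul, Matrix.smul_mul]
  simp only [h2, Finset.sum_neg_distrib]
  rw [← Finset.sum_mul, ← Finset.mul_sum, sum_jac_smul_pdMat_chi_phi hx]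
  simp only [Matrix.mul_assoc, chi_mul_chi hx, Matrix.mul_one]

/-- The transition functions of the supermanifold are a change of coordinates in the sense of
`IsIntChange`. -/
theorem isIntChange (hx : x ∈ overlap a b) :
    IsIntChange x (chi a b) (fun y => chi b a (phi a b y)) (fun y => jac b a (phi a b y))
      (fun y k => dchi b a k (phi a b y) * chi a b y) fun i =>
      pd i (ber a b) x / ber a b x where
  diff_χ := differentiableAt_chi hx
  diff_c := differentiableAt_chi_phi hx
  diff_K := differentiableAt_jac_phi hx
  diff_N k α β := by
    simp only [Matrix.mul_apply]
    exact DifferentiableAt.fun_sum fun γ _ =>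
      (differentiableAt_dchi_phi hx k α γ).mul (differentiableAt_chi hx γ β)
  χ_mul_c := chi_mul_chi' hx
  pd_χ := sum_jac_smul_pdMat_chi hx
  pd_c := sum_jac_smul_pdMat_chi_phi hx
  K_symm j k l := by
    have h : ∀ k l, ∑ i, jac b a (phi a b x) i k * pdMat i (fun y => jac b a (phi a b y)) x j l =
        pd k (fun y => jac b a y j l) (phi a b x) := fun k l =>
      sum_jac_mul_pd hx (f := fun y => jac b a y j l) (differentiableAt_jac (phi_mem hx) j l) k
    rw [h, h, pd_jac_comm (phi_mem hx)]
  flat k l := by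
    have h : ∀ k l, ∑ i, jac b a (phi a b x) i k •
        pdMat i (fun y => dchi b a l (phi a b y) * chi a b y) x =
        pdMat k (dchi b a l) (phi a b x) * chi a b x - dchi b a l (phi a b x) * chi a b x *
          (dchi b a k (phi a b x) * chi a b x) := by
      intro k l
      simp only [pdMat_mul (differentiableAt_dchi_phi hx l) (differentiableAt_chi hx),
        smul_add, Finset.sum_add_distrib]
      rw [← sum_jac_smul_pdMat hx (A := dchi b a l) (differentiableAt_dchi (phi_mem hx) l) k,
        sub_eq_add_neg, Matrix.mul_assoc (dchi b a l _), ← Matrix.mul_neg,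
        ← sum_jac_smul_pdMat_chi hx, Finset.sum_mul, Finset.mul_sum]
      simp only [Matrix.smul_mul, Matrix.mul_smul]
    rw [h, h, pdMat_dchi (phi_mem hx) k l]
    abel
  divergence k := by
    have h1 : ∑ i, (chi a b x * pdMat i (fun y => chi b a (phi a b y)) x).trace *
        jac b a (phi a b x) i k = (dchi b a k (phi a b x) * chi a b x).trace := by
      have h2 := congrArg (fun A => (chi a b x * A).trace) (sum_jac_smul_pdMat_chi_phi hx k)
      simp only [Finset.mul_sum, Matrix.trace_sum, Matrix.mul_smul, Matrix.trace_smul,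
        smul_eq_mul] at h2
      rw [Matrix.trace_mul_comm (chi a b x), Matrix.mul_assoc _ _ (chi a b x), chi_mul_chi hx,
        Matrix.mul_one] at h2
      rw [← h2]
      exact Finset.sum_congr rfl fun i _ => mul_comm _ _
    simp only [pd_ber hx, add_mul, Finset.sum_add_distrib]
    rw [h1, ← add_assoc, divergence_jac hx, zero_add]

end SuperChart
end Transitions

/-! ### Global forms -/

section Degree

variable {m n : ℕ} {U : TopologicalSpace.Opens (EuclideanSpace ℝ (Fin m))}

/-- All the terms of `c` have degree `q` in the generators `e` and `ξ`. -/
def HasDegree (q : ℤ) (c : LocalForm n U) : Prop :=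
  ∀ S I κ, (I.card : ℤ) + ∑ α, (κ α : ℤ) ≠ q → c S I κ = 0

namespace HasDegree

variable {q : ℤ} {c c' : LocalForm n U}

theorem expBounded (hc : HasDegree q c) : ExpBounded q.toNat c := by
  rintro S I κ ⟨α, hα⟩
  refine hc S I κ fun h => ?_
  have h1 : (κ α : ℤ) ≤ ∑ β, (κ β : ℤ) :=
    Finset.single_le_sum (f := fun β => (κ β : ℤ)) (fun _ _ => Int.natCast_nonneg _)
      (Finset.mem_univ α)
  omega

theorem add (hc : HasDegree q c) (hc' : HasDegree q c') : HasDegree q (c + c') :=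
  fun S I κ h => by simp only [Pi.add_apply, hc S I κ h, hc' S I κ h, add_zero]

theorem smul (hc : HasDegree q c) (r : ℝ) : HasDegree q (r • c) :=
  fun S I κ h => by simp only [Pi.smul_apply, hc S I κ h, smul_zero]

theorem sub (hc : HasDegree q c) (hc' : HasDegree q c') : HasDegree q (c - c') :=
  fun S I κ h => by simp only [Pi.sub_apply, hc S I κ h, hc' S I κ h, sub_zero]

theorem sum {ι : Type*} (s : Finset ι) {c : ι → LocalForm n U}
    (hc : ∀ i ∈ s, HasDegree q (c i)) : HasDegree q (∑ i ∈ s, c i) := fun S I κ h => by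
  simp only [Finset.sum_apply]
  exact Finset.sum_eq_zero fun i hi => hc i hi S I κ h

theorem cTheta (hc : HasDegree q c) (α : Fin n) : HasDegree q (cTheta α c) := by
  intro S I κ h
  simp [PictureChanging.cTheta, hc _ I κ h]

theorem cDTheta (hc : HasDegree q c) (α : Fin n) : HasDegree q (cDTheta α c) := by
  intro S I κ h
  simp [PictureChanging.cDTheta, hc _ I κ h]

theorem cPartial (hc : HasDegree q c) (i : Fin m) : HasDegree q (cPartial i c) := by
  intro S I κ h
  simp [PictureChanging.cPartial, hc _ I κ h]

theorem cE (hc : HasDegree q c) (i : Fin m) : HasDegree (q + 1) (cE i c) := by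
  intro S I κ h
  by_cases hi : i ∈ I
  · have h1 := Finset.card_erase_add_one hi
    have : c S (I.erase i) κ = 0 := hc _ _ _ (by omega)
    simp [PictureChanging.cE, this]
  · simp [PictureChanging.cE, hi]

theorem cDE (hc : HasDegree q c) (i : Fin m) : HasDegree (q - 1) (cDE i c) := by
  intro S I κ h
  by_cases hi : i ∈ I
  · simp [PictureChanging.cDE, hi]
  · have h1 := Finset.card_insert_of_notMem hi
    have : c S (insert i I) κ = 0 := hc _ _ _ (by omega)
    simp [PictureChanging.cDE, this]

theorem sum_add_single (κ : Fin n → ℕ) (α : Fin n) :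
    ∑ β, (((κ + Pi.single α 1 : Fin n → ℕ) β : ℕ) : ℤ) = ∑ β, (κ β : ℤ) + 1 := by
  simp [Finset.sum_add_distrib, Pi.single_apply]

theorem cDXi (hc : HasDegree q c) (α : Fin n) : HasDegree (q - 1) (cDXi α c) := by
  intro S I κ h
  have h1 := sum_add_single κ α
  have : c S I (κ + Pi.single α 1) = 0 := hc _ _ _ (by omega)
  simp [PictureChanging.cDXi, this]

theorem cXi (hc : HasDegree q c) (α : Fin n) : HasDegree (q + 1) (cXi α c) := by
  intro S I κ h
  by_cases hα : κ α = 0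
  · simp [PictureChanging.cXi, hα]
  · have h1 := sum_add_single (κ - Pi.single α 1) α
    have h2 : κ - Pi.single α 1 + Pi.single α 1 = κ := by
      funext β
      by_cases hβ : β = α
      · subst hβ; simp; omega
      · simp [hβ]
    rw [h2] at h1
    have : c S I (κ - Pi.single α 1) = 0 := hc _ _ _ (by omega)
    simp [PictureChanging.cXi, this]

theorem localD (hc : HasDegree q c) : HasDegree (q + 1) (localD c) := by
  rw [localD_eq]
  exact (sum _ fun i _ => (hc.cPartial i).cE i).add (sum _ fun α _ => (hc.cDTheta α).cXi α)

theorem localDelta (hc : HasDegree q c) : HasDegree (q - 1) (localDelta c) := by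
  rw [localDelta_eq]
  exact ((sum _ fun i _ => (hc.cPartial i).cDE i).smul _).sub
    (sum _ fun α _ => (hc.cDTheta α).cDXi α)

theorem localIota (hc : HasDegree q c) : HasDegree (q - 1) (localIota c) := by
  rw [localIota_apply]
  exact sum _ fun α _ => (hc.cDXi α).cTheta α

theorem localEuler (hc : HasDegree q c) : HasDegree (q + 1) (localEuler c) := by
  rw [localEuler_apply]
  exact sum _ fun α _ => (hc.cXi α).cTheta α

theorem localPCO (hc : HasDegree q c) : HasDegree (m - q) (localPCO c) := by
  intro S J κ h
  by_cases hS : S = Finset.univ ∧ κ = 0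
  · refine (if_pos hS).trans (Finset.sum_eq_zero fun I _ => ?_)
    by_cases h1 : contractAll I decreasingTop J = 0
    · rw [h1, zero_smul]
    · have h2 := card_of_contractAll_ne_zero decreasingTop_ne_zero I J h1
      rw [hc ∅ I 0, smul_zero]
      simp only [hS.2, Pi.zero_apply, Nat.cast_zero, Finset.sum_const_zero, add_zero] at h ⊢
      omega
  · exact if_neg hS

theorem localZ (hc : HasDegree q c) : HasDegree (m - q) (localZ c) := by
  intro S J κ h
  by_cases hS : S = ∅ ∧ κ = 0
  · refine (if_pos hS).trans (Finset.sum_eq_zero fun I _ => ?_)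
    by_cases h1 : contractAll I increasingTop J = 0
    · rw [h1, zero_smul]
    · have h2 := card_of_contractAll_ne_zero increasingTop_ne_zero I J h1
      rw [hc Finset.univ I 0, smul_zero]
      simp only [hS.2, Pi.zero_apply, Nat.cast_zero, Finset.sum_const_zero, add_zero] at h ⊢
      omega
  · exact if_neg hS

theorem localPCO_eq_zero (hc : HasDegree q c) (hq : q < 0 ∨ m < q) :
    PictureChanging.localPCO c = 0 := by
  funext S J κ
  by_cases hS : S = Finset.univ ∧ κ = 0
  · refine (if_pos hS).trans (Finset.sum_eq_zero fun I _ => ?_)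
    have := I.card_le_univ
    rw [Fintype.card_fin] at this
    rw [hc ∅ I 0, smul_zero]
    simp only [Pi.zero_apply, Nat.cast_zero, Finset.sum_const_zero, add_zero]
    omega
  · exact if_neg hS

theorem localZ_eq_zero (hc : HasDegree q c) (hq : q < 0 ∨ m < q) :
    PictureChanging.localZ c = 0 := by
  funext S J κ
  by_cases hS : S = ∅ ∧ κ = 0
  · refine (if_pos hS).trans (Finset.sum_eq_zero fun I _ => ?_)
    have := I.card_le_univ
    rw [Fintype.card_fin] at this
    rw [hc Finset.univ I 0, smul_zero]
    simp only [Pi.zero_apply, Nat.cast_zero, Finset.sum_const_zero, add_zero]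
    omega
  · exact if_neg hS

end HasDegree
end Degree

section ChainRule

variable {m n : ℕ} {M : Type*} [TopologicalSpace M] [ChartedSpace (EuclideanSpace ℝ (Fin m)) M]
  [IsManifold (𝓡 m) ∞ M]
  {V : M → Type*} [TopologicalSpace (TotalSpace (EuclideanSpace ℝ (Fin n)) V)]
  [∀ x, TopologicalSpace (V x)]
  [FiberBundle (EuclideanSpace ℝ (Fin n)) V]

open SuperChart

/-- The chain rule for local expressions that are related by a variable linear map `T`. -/
theorem genEval_cPartial_of_eq {Q : ℕ} {a b : SuperChart m n V}
    {x : EuclideanSpace ℝ (Fin m)} (hx : x ∈ overlap a b) {ca : LocalForm n a.domain}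
    {cb : LocalForm n b.domain} {T : EuclideanSpace ℝ (Fin m) → SuperAlg m n →ₗ[ℝ] SuperAlg m n}
    {T' : Fin m → SuperAlg m n →ₗ[ℝ] SuperAlg m n}
    (hT : ∀ u, HasDer x (fun y => T y u) (fun i => T' i u))
    (h : ∀ y ∈ overlap a b, genEval Q y ca = T y (genEval Q (phi a b y) cb)) (i : Fin m) :
    genEval Q x (cPartial i ca) = T' i (genEval Q (phi a b x) cb) +
      T x (∑ j, jac a b x j i • genEval Q (phi a b x) (cPartial j cb)) := by
  have h1 := (hasDer_genEval Q cb (phi_mem hx).1).comp (differentiableAt_phi hx)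
  exact (hasDer_genEval Q ca hx.1).unique
    ((h1.apply hT).congr ((eventually_mem hx).mono fun y hy => h y hy)) i

end ChainRule

section GlobalForms

variable {m n : ℕ} {M : Type*} [TopologicalSpace M] [ChartedSpace (EuclideanSpace ℝ (Fin m)) M]
  {V : M → Type*} [TopologicalSpace (TotalSpace (EuclideanSpace ℝ (Fin n)) V)]
  [∀ x, AddCommGroup (V x)] [∀ x, Module ℝ (V x)] [∀ x, TopologicalSpace (V x)]
  [FiberBundle (EuclideanSpace ℝ (Fin n)) V] [VectorBundle ℝ (EuclideanSpace ℝ (Fin n)) V]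

open SuperChart

/-- The change of coordinates of superforms at the point `x`. -/
def formTrans (a b : SuperChart m n V) (x : EuclideanSpace ℝ (Fin m)) :
    SuperAlg m n →ₐ[ℝ] SuperAlg m n :=
  formMap (chi a b x) (fun i => dchi a b i x) (jac a b x)

/-- The change of coordinates of integral forms at the point `x`, without the Berezinian. -/
def intTrans (a b : SuperChart m n V) (x : EuclideanSpace ℝ (Fin m)) :
    SuperAlg m n →ₐ[ℝ] SuperAlg m n :=
  intMap (chi a b x) (chi b a (phi a b x)) (jac b a (phi a b x))
    (fun k => dchi b a k (phi a b x) * chi a b x)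

variable {p : ℤ} {w σ : Family m n V}

theorem superforms_hasDegree (hw : w ∈ superforms m n V p) (a : SuperChart m n V) :
    HasDegree p (w a) := hw.1 a

theorem integralForms_hasDegree (hσ : σ ∈ integralForms m n V p) (a : SuperChart m n V) :
    HasDegree (m - p) (σ a) := hσ.1 a

theorem evalAt_formTrans (Q : ℕ) {U : TopologicalSpace.Opens (EuclideanSpace ℝ (Fin m))}
    (c : LocalForm n U) (a b : SuperChart m n V) (x : EuclideanSpace ℝ (Fin m)) :
    evalAt Q c (phi a b x) (theta' a b x) (dx' a b x) (dtheta' a b x) =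
      formTrans a b x (genEval Q (phi a b x) c) := by
  rw [← evalAt_eq_map]
  simp only [formTrans, formMap_theta, formMap_e, formMap_xi]
  rfl

theorem evalAt_intTrans (Q : ℕ) {U : TopologicalSpace.Opens (EuclideanSpace ℝ (Fin m))}
    (c : LocalForm n U) (a b : SuperChart m n V) (x : EuclideanSpace ℝ (Fin m)) :
    evalAt Q c (phi a b x) (theta' a b x) (piDx' a b x) (piDtheta' a b x) =
      intTrans a b x (genEval Q (phi a b x) c) := by
  rw [← evalAt_eq_map]
  simp only [intTrans, intMap_theta, intMap_e, intMap_xi]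
  rfl

/-- The condition of compatibility of superforms, with any bound on the exponents. -/
theorem mem_superforms_iff {Q : ℕ} (hQ : p.toNat ≤ Q) :
    w ∈ superforms m n V p ↔ (∀ a, HasDegree p (w a)) ∧
      ∀ a b, ∀ x ∈ overlap a b,
        genEval Q x (w a) = formTrans a b x (genEval Q (phi a b x) (w b)) := by
  refine and_congr_right fun h => forall_congr' fun a => forall_congr' fun b =>
    forall_congr' fun x => imp_congr_right fun hx => ?_
  rw [← evalAt_of_le (HasDegree.expBounded (h a)) hQ,
    ← evalAt_of_le (HasDegree.expBounded (h b)) hQ, evalAt_formTrans]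
  rfl

/-- The condition of compatibility of integral forms, with any bound on the exponents. -/
theorem mem_integralForms_iff {Q : ℕ} (hQ : (m - p).toNat ≤ Q) :
    σ ∈ integralForms m n V p ↔ (∀ a, HasDegree (m - p) (σ a)) ∧
      ∀ a b, ∀ x ∈ overlap a b, genEval Q x (σ a) =
        ber a b x • intTrans a b x (genEval Q (phi a b x) (σ b)) := by
  refine and_congr_right fun h => forall_congr' fun a => forall_congr' fun b =>
    forall_congr' fun x => imp_congr_right fun hx => ?_
  rw [← evalAt_of_le (HasDegree.expBounded (h a)) hQ,
    ← evalAt_of_le (HasDegree.expBounded (h b)) hQ, evalAt_intTrans]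
  rfl

theorem deRham_deRham (hw : w ∈ superforms m n V p) : deRham m n V (deRham m n V w) = 0 :=
  funext fun a => localD_localD (superforms_hasDegree hw a).expBounded

theorem delta_delta (hσ : σ ∈ integralForms m n V p) : delta m n V (delta m n V σ) = 0 :=
  funext fun a => localDelta_localDelta (integralForms_hasDegree hσ a).expBounded

variable (m n V) in
/-- The contraction of superforms with the Euler vector field of the odd fibres. -/
def iota : Family m n V →ₗ[ℝ] Family m n V :=
  LinearMap.pi fun a => localIota ∘ₗ LinearMap.proj a

variable (m n V) in
/-- The product of integral forms with the Euler vector field of the odd fibres. -/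
def euler : Family m n V →ₗ[ℝ] Family m n V :=
  LinearMap.pi fun a => localEuler ∘ₗ LinearMap.proj a

theorem iota_mem (hw : w ∈ superforms m n V p) : iota m n V w ∈ superforms m n V (p - 1) := by
  have h := (mem_superforms_iff le_rfl).1 hw
  refine (mem_superforms_iff (Q := p.toNat) (by omega)).2
    ⟨fun a => (h.1 a).localIota, fun a b x hx => ?_⟩
  change genEval _ x (localIota (w a)) = formTrans a b x (genEval _ _ (localIota (w b)))
  rw [genEval_localIota x (h.1 a).expBounded le_rfl, genEval_localIota _ (h.1 b).expBounded le_rfl,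
    h.2 a b x hx]
  exact formMap_iota _ _ _ _

theorem euler_mem (hσ : σ ∈ integralForms m n V p) :
    euler m n V σ ∈ integralForms m n V (p - 1) := by
  have h := (mem_integralForms_iff (Q := (m - p).toNat + 1) (by omega)).1 hσ
  refine (mem_integralForms_iff (Q := (m - p).toNat + 1) (by omega)).2
    ⟨fun a => ?_, fun a b x hx => ?_⟩
  · have h1 := (h.1 a).localEuler
    rwa [show (m : ℤ) - p + 1 = m - (p - 1) by ring] at h1
  · change genEval _ x (localEuler (σ a)) = _ • intTrans a b x (genEval _ _ (localEuler (σ b)))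
    rw [genEval_localEuler x (h.1 a).expBounded (Nat.lt_succ_self _),
      genEval_localEuler _ (h.1 b).expBounded (Nat.lt_succ_self _), h.2 a b x hx]
    have h1 : intTrans a b x (∑ α, genTheta α * genXi α) = ∑ α, genTheta α * genXi α :=
      intMap_euler _ _ (chi_mul_chi hx)
    simp only [← mul_assoc, ← Finset.sum_mul, map_mul]
    rw [h1, mul_smul_comm]

end GlobalForms

/-! ### The global differentials -/

section Differentials

variable {m n : ℕ} {M : Type*} [TopologicalSpace M] [ChartedSpace (EuclideanSpace ℝ (Fin m)) M]
  [IsManifold (𝓡 m) ∞ M]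
  {V : M → Type*} [TopologicalSpace (TotalSpace (EuclideanSpace ℝ (Fin n)) V)]
  [∀ x, AddCommGroup (V x)] [∀ x, Module ℝ (V x)] [∀ x, TopologicalSpace (V x)]
  [FiberBundle (EuclideanSpace ℝ (Fin n)) V] [VectorBundle ℝ (EuclideanSpace ℝ (Fin n)) V]
  [ContMDiffVectorBundle ∞ (EuclideanSpace ℝ (Fin n)) V (𝓡 m)]

open SuperChart

variable {p : ℤ} {w σ : Family m n V} {a b : SuperChart m n V} {x : EuclideanSpace ℝ (Fin m)}

/-- `formMap_natural` for the transition functions, with the derivative of the change of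
coordinates as a linear map. -/
theorem exists_hasDer_formTrans (hx : x ∈ overlap a b) :
    ∃ T' : Fin m → SuperAlg m n →ₗ[ℝ] SuperAlg m n,
      (∀ u, HasDer x (fun y => (formTrans a b y).toLinearMap u) (fun i => T' i u)) ∧
      ∀ u, ∑ i, genE i * T' i u + ∑ α, genXi α * dTheta α (formTrans a b x u) =
        formTrans a b x (∑ α, genXi α * dTheta α u) := by
  have h := formMap_natural (dχ := fun y i => dchi a b i y) (differentiableAt_chi hx)
    (fun i => rfl) (differentiableAt_dchi hx) (pdMat_dchi hx) (differentiableAt_jac hx)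
    (fun i j k => pd_jac_comm hx i j k)
  obtain ⟨T', hT'⟩ := exists_derivative_linearMap
    (T := fun y => (formTrans a b y).toLinearMap) fun u => (h u).imp fun _ h => h.1
  refine ⟨T', hT', fun u => ?_⟩
  obtain ⟨u', h1, h2⟩ := h u
  rw [← Finset.sum_congr rfl fun i _ => congrArg (genE i * ·) (h1.unique (hT' u) i)]
  exact h2

/-- `intMap_natural` for the transition functions, with the derivative of the change of
coordinates as a linear map. -/
theorem exists_hasDer_intTrans (hx : x ∈ overlap a b) :
    ∃ T' : Fin m → SuperAlg m n →ₗ[ℝ] SuperAlg m n,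
      (∀ u, HasDer x (fun y => (intTrans a b y).toLinearMap u) (fun i => T' i u)) ∧
      ∀ u, deltaAt (fun i => pd i (ber a b) x / ber a b x) (intTrans a b x u) (fun i => T' i u) =
        -intTrans a b x (∑ α, dXi α (dTheta α u)) := by
  have h := intMap_natural (isIntChange hx)
  obtain ⟨T', hT'⟩ := exists_derivative_linearMap
    (T := fun y => (intTrans a b y).toLinearMap) fun u => (h u).imp fun _ h => h.1
  refine ⟨T', hT', fun u => ?_⟩
  obtain ⟨u', h1, -, h2⟩ := h u
  rw [← funext fun i => h1.unique (hT' u) i]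
  exact h2

theorem deRham_mem (hw : w ∈ superforms m n V p) :
    deRham m n V w ∈ superforms m n V (p + 1) := by
  have h := (mem_superforms_iff (Q := p.toNat + 1) (by omega)).1 hw
  refine (mem_superforms_iff (Q := p.toNat + 1) (by omega)).2
    ⟨fun a => (h.1 a).localD, fun a b x hx => ?_⟩
  change genEval _ x (localD (w a)) = formTrans a b x (genEval _ _ (localD (w b)))
  obtain ⟨T', hT', hT⟩ := exists_hasDer_formTrans hx
  rw [genEval_localD x (h.1 a).expBounded (Nat.lt_succ_self _),
    genEval_localD _ (h.1 b).expBounded (Nat.lt_succ_self _), h.2 a b x hx, map_add, ← hT]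
  have h1 : ∀ j, ∑ i, jac a b x j i • genE i = formTrans a b x (genE j) :=
    fun j => (formMap_e _ _ _ j).symm
  have h2 : ∀ i, genEval (p.toNat + 1) x (cPartial i (w a)) =
      T' i (genEval (p.toNat + 1) (phi a b x) (w b)) + formTrans a b x
        (∑ j, jac a b x j i • genEval (p.toNat + 1) (phi a b x) (cPartial j (w b))) :=
    genEval_cPartial_of_eq hx hT' (h.2 a b)
  simp only [h2, mul_add, Finset.sum_add_distrib, map_sum, map_mul, ← h1, map_smul,
    Finset.mul_sum, Finset.sum_mul, mul_smul_comm, smul_mul_assoc]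
  rw [Finset.sum_comm (f := fun i j => jac a b x j i •
    (genE i * formTrans a b x (genEval (p.toNat + 1) (phi a b x) (cPartial j (w b)))))]
  abel

theorem delta_mem (hσ : σ ∈ integralForms m n V p) :
    delta m n V σ ∈ integralForms m n V (p + 1) := by
  have h := (mem_integralForms_iff le_rfl).1 hσ
  refine (mem_integralForms_iff (Q := (m - p).toNat) (by omega)).2
    ⟨fun a => ?_, fun a b x hx => ?_⟩
  · have h1 := (h.1 a).localDelta
    rwa [show (m : ℤ) - p - 1 = m - (p + 1) by ring] at h1
  change genEval _ x (localDelta (σ a)) = _ • intTrans a b x (genEval _ _ (localDelta (σ b)))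
  obtain ⟨T', hT', hT⟩ := exists_hasDer_intTrans hx
  rw [genEval_localDelta x (h.1 a).expBounded le_rfl,
    genEval_localDelta _ (h.1 b).expBounded le_rfl, h.2 a b x hx, map_sub, sub_eq_add_neg
      (intTrans a b x _), ← hT]
  set q := ((m : ℤ) - p).toNat
  -- the product rule yields the logarithmic derivative of the Berezinian, which twists `deltaAt`
  have h1 : ∀ u, HasDer x (fun y => (ber a b y • (intTrans a b y).toLinearMap) u)
      (fun i => (pd i (ber a b) x • (intTrans a b x).toLinearMap + ber a b x • T' i) u) :=
    fun u => (hT' u).smul (differentiableAt_ber hx)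
  have h2 : ∀ i, genEval q x (cPartial i (σ a)) =
      pd i (ber a b) x • intTrans a b x (genEval q (phi a b x) (σ b)) +
      ber a b x • T' i (genEval q (phi a b x) (σ b)) + ber a b x • intTrans a b x
        (∑ j, jac a b x j i • genEval q (phi a b x) (cPartial j (σ b))) :=
    genEval_cPartial_of_eq hx h1 (h.2 a b)
  have h3 : ∀ j u, ∑ i, jac a b x j i • dE i (intTrans a b x u) = intTrans a b x (dE j u) :=
    dE_intMap _ _ _ (jac_mul_jac' hx)
  have h4 : ∀ i u, pd i (ber a b) x • u = ber a b x • (pd i (ber a b) x / ber a b x) •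
      (u : SuperAlg m n) := fun i u => by
    rw [smul_smul, mul_div_cancel₀ _ (ber_ne_zero hx)]
  simp only [h2, deltaAt, map_add, map_sum, map_smul, h4, ← h3, smul_add, smul_sub,
    Finset.sum_add_distrib, Finset.smul_sum]
  rw [Finset.sum_comm (f := fun i j => _ • _ • jac a b x j i • _)]
  simp only [smul_comm ((-1 : ℝ) ^ n) (ber a b x)]
  abel

end Differentials

/-! ### The picture changing maps are well defined -/

section TopForms

variable {m n : ℕ}

theorem thetaTop_mul_of_anticomm {v : SuperAlg m n} (hv : v ∈ oddLinear m n) (u : SuperAlg m n) :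
    thetaTop * (v * u) = (-1 : ℝ) ^ n • (v * (thetaTop * u)) := by
  have h := mul_oddProd_of_anticomm genTheta v
    (fun a => oddLinear_anticomm hv (genTheta_mem a)) Finset.univ u
  rw [Finset.card_univ, Fintype.card_fin] at h
  rw [thetaTop, h, neg_one_pow_smul_self]

theorem thetaTop_mul_theta_mul (α : Fin n) (u : SuperAlg m n) :
    thetaTop * (genTheta α * u) = 0 := by
  rw [thetaTop_mul_of_anticomm (genTheta_mem α), ← mul_assoc, theta_mul_thetaTop, zero_mul,
    smul_zero]

theorem thetaTop_mul_thetaIm_mul (χ : Matrix (Fin n) (Fin n) ℝ) (α : Fin n) (u : SuperAlg m n) :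
    thetaTop * (thetaIm χ α * u) = 0 := by
  simp only [thetaIm, Finset.sum_mul, Finset.mul_sum, smul_mul_assoc, mul_smul_comm,
    thetaTop_mul_theta_mul, smul_zero, Finset.sum_const_zero]

/-- The factor `θ^1 ⋯ θ^n` cancels the nilpotent part of the transformation of `π∂_x`. -/
theorem thetaTop_mul_intMap (χ c : Matrix (Fin n) (Fin n) ℝ) (K : Matrix (Fin m) (Fin m) ℝ)
    (N : Fin m → Matrix (Fin n) (Fin n) ℝ) (u : SuperAlg m n) :
    thetaTop * intMap χ c K N u = thetaTop * intMap χ c K 0 u := by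
  induction u using gen_induction with
  | one => simp
  | smul r a h => simp only [map_smul, mul_smul_comm, h]
  | add a b ha hb => simp only [map_add, mul_add, ha, hb]
  | theta α a h => simp only [map_mul, intMap_theta, thetaTop_mul_thetaIm_mul]
  | e i a h =>
    have h1 : ∀ u, thetaTop * (pieIm K N i * u : SuperAlg m n) =
        thetaTop * (pieIm K 0 i * u) := by
      intro u
      simp [pieIm, add_mul, mul_add, Finset.sum_mul, Finset.mul_sum, mul_assoc,
        thetaTop_mul_theta_mul]
    rw [map_mul, map_mul, intMap_e, intMap_e, h1, thetaTop_mul_of_anticomm (pieIm_mem _ _ _),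
      thetaTop_mul_of_anticomm (pieIm_mem _ _ _), h]
  | xi α a h =>
    rw [map_mul, map_mul, intMap_xi, intMap_xi, pixiIm_comm, pixiIm_comm, ← mul_assoc, h,
      mul_assoc]

theorem intMap_thetaTop (χ c : Matrix (Fin n) (Fin n) ℝ) (K : Matrix (Fin m) (Fin m) ℝ)
    (N : Fin m → Matrix (Fin n) (Fin n) ℝ) :
    intMap χ c K N thetaTop = χ.det • (thetaTop : SuperAlg m n) := by
  rw [thetaTop, map_oddProd]
  simp only [intMap_theta]
  exact oddProd_linearCombination genTheta genTheta_mul_genTheta χ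

theorem intMap_eTop (χ c : Matrix (Fin n) (Fin n) ℝ) (K : Matrix (Fin m) (Fin m) ℝ) :
    intMap χ c K 0 eTop = K.det • (eTop : SuperAlg m n) := by
  rw [eTop, map_oddProd, ← Matrix.det_transpose,
    ← oddProd_linearCombination genE genE_mul_genE K.transpose]
  simp [pieIm]

theorem formMap_eTop (χ : Matrix (Fin n) (Fin n) ℝ) (dχ : Fin m → Matrix (Fin n) (Fin n) ℝ)
    (J : Matrix (Fin m) (Fin m) ℝ) :
    formMap χ dχ J eTop = J.det • (eTop : SuperAlg m n) := by
  rw [eTop, map_oddProd, ← oddProd_linearCombination genE genE_mul_genE J]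
  simp [eIm]

theorem contraction_thetaIm (χ : Matrix (Fin n) (Fin n) ℝ) (α : Fin n) :
    contraction (thetaIm χ α : SuperAlg m n) = 0 := by
  simp [thetaIm]

/-- Contraction is compatible with the changes of coordinates of superforms and of multivector
fields. -/
theorem intMap_contraction (χ c : Matrix (Fin n) (Fin n) ℝ) (dχ : Fin m → Matrix (Fin n) (Fin n) ℝ)
    {J K : Matrix (Fin m) (Fin m) ℝ} (hJK : J * K = 1) (u v : SuperAlg m n) :
    intMap χ c K 0 (contraction u v) = contraction (formMap χ dχ J u) (intMap χ c K 0 v) := by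
  refine linearMap_ext_gen
    ((intMap χ c K 0).toLinearMap ∘ₗ LinearMap.applyₗ v ∘ₗ contraction.toLinearMap)
    (LinearMap.applyₗ (intMap χ c K 0 v) ∘ₗ contraction.toLinearMap ∘ₗ
      (formMap χ dχ J).toLinearMap) ?_ ?_ ?_ ?_ u
  · simp
  · intro α a _
    simp [contraction_thetaIm]
  · intro j a h
    simp only [LinearMap.comp_apply, LinearMap.applyₗ_apply_apply, AlgHom.toLinearMap_apply] at h ⊢
    rw [map_mul, map_mul, map_mul, Module.End.mul_apply, Module.End.mul_apply, contraction_e,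
      ← dE_intMap χ c 0 hJK, h, formMap_e, eIm, map_sum, LinearMap.sum_apply]
    simp
  · intro α a _
    simp [dthetaIm]

/-- Contraction is compatible with the changes of coordinates of multivector fields and of forms. -/
theorem formMap_zero_contraction (χ c : Matrix (Fin n) (Fin n) ℝ) {J K : Matrix (Fin m) (Fin m) ℝ}
    (hJK : J * K = 1) (u v : SuperAlg m n) :
    formMap 0 0 J (contraction u v) = contraction (intMap χ c K 0 u) (formMap 0 0 J v) := by
  refine linearMap_ext_gen
    ((formMap 0 0 J).toLinearMap ∘ₗ LinearMap.applyₗ v ∘ₗ contraction.toLinearMap)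
    (LinearMap.applyₗ (formMap 0 0 J v) ∘ₗ contraction.toLinearMap ∘ₗ
      (intMap χ c K 0).toLinearMap) ?_ ?_ ?_ ?_ u
  · simp
  · intro α a _
    simp [contraction_thetaIm]
  · intro j a h
    simp only [LinearMap.comp_apply, LinearMap.applyₗ_apply_apply, AlgHom.toLinearMap_apply] at h ⊢
    rw [map_mul, map_mul, map_mul, Module.End.mul_apply, Module.End.mul_apply, contraction_e,
      ← dE_formMap_zero hJK, h, intMap_e]
    simp [pieIm]
  · intro α a _
    simp [pixiIm]

theorem formMap_body (χ : Matrix (Fin n) (Fin n) ℝ) (dχ : Fin m → Matrix (Fin n) (Fin n) ℝ)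
    (J : Matrix (Fin m) (Fin m) ℝ) (u : SuperAlg m n) :
    formMap χ dχ J (body u) = formMap 0 0 J u := by
  refine linearMap_ext_gen ((formMap χ dχ J).toLinearMap ∘ₗ body.toLinearMap)
    (formMap 0 0 J).toLinearMap ?_ ?_ ?_ ?_ u
  · simp
  · intro α a _
    simp [thetaIm]
  · intro i a h
    simp only [LinearMap.comp_apply, AlgHom.toLinearMap_apply] at h ⊢
    simp [h]
  · intro α a _
    simp [dthetaIm]

theorem body_dE (i : Fin m) (u : SuperAlg m n) : body (dE i u) = dE i (body u) := by
  refine linearMap_ext_gen (body.toLinearMap ∘ₗ dE i) (dE i ∘ₗ body.toLinearMap) ?_ ?_ ?_ ?_ u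
  · simp [dE_one]
  · intro α a _
    simp [dE_theta_mul]
  · intro j a h
    simp only [LinearMap.comp_apply, AlgHom.toLinearMap_apply] at h ⊢
    rw [dE_e_mul, map_sub, map_mul, map_mul, body_e, dE_e_mul, h]
    split_ifs <;> simp
  · intro α a _
    simp [dE_xi_mul]

theorem body_contraction_eTop (u : SuperAlg m n) :
    body (contraction u eTop) = contraction u eTop := by
  have h : body (eTop : SuperAlg m n) = eTop := by
    rw [eTop, map_oddProd]
    simp
  refine linearMap_ext_gen
    (body.toLinearMap ∘ₗ LinearMap.applyₗ eTop ∘ₗ contraction.toLinearMap)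
    (LinearMap.applyₗ eTop ∘ₗ contraction.toLinearMap) ?_ ?_ ?_ ?_ u
  · simpa using h
  · intro α a _
    simp
  · intro i a h
    simp only [LinearMap.comp_apply, LinearMap.applyₗ_apply_apply, AlgHom.toLinearMap_apply] at h ⊢
    rw [map_mul, Module.End.mul_apply, contraction_e, body_dE, h]
  · intro α a _
    simp

theorem eq_zero_of_oddProd_theta_mul (S : Finset (Fin n)) {u : SuperAlg m n}
    (hu : ∀ α, dTheta α u = 0) (h : oddProd genTheta S * u = 0) : u = 0 := by
  induction S using Finset.induction_on_min with
  | empty => simpa using h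
  | insert a S ha ih =>
    have ha' : a ∉ S := fun h' => lt_irrefl _ (ha a h')
    -- apply `∂/∂θ^a` to the product
    refine ih ?_
    have h1 := derivation_oddProd_mul genTheta (dTheta a) a (dTheta_theta_mul a) (insert a S) u
    rw [h, map_zero, if_pos (Finset.mem_insert_self _ _), Finset.erase_insert ha', hu, mul_zero,
      smul_zero, add_zero, sgn_of_le fun b hb => ?_, one_smul] at h1
    · exact h1.symm
    · rcases Finset.mem_insert.1 hb with rfl | hb
      exacts [le_rfl, (ha b hb).le]

/-- Forms without `θ` can be recovered from their products with `θ^1 ⋯ θ^n`. -/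
theorem eq_of_thetaTop_mul_eq {u v : SuperAlg m n} (hu : ∀ α, dTheta α u = 0)
    (hv : ∀ α, dTheta α v = 0) (h : thetaTop * u = thetaTop * v) : u = v := by
  refine sub_eq_zero.1 (eq_zero_of_oddProd_theta_mul Finset.univ (fun α => ?_) ?_)
  · rw [map_sub, hu, hv, sub_zero]
  · rw [mul_sub, sub_eq_zero]
    exact h

variable {U : TopologicalSpace.Opens (EuclideanSpace ℝ (Fin m))}

theorem dTheta_genEval_pureE (Q : ℕ) (x : EuclideanSpace ℝ (Fin m))
    (f : Finset (Fin m) → smoothFunctions U) (α : Fin n) :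
    dTheta α (genEval Q x (pureE f : LocalForm n U)) = 0 := by
  rw [genEval_pureE]
  simp only [map_sum, map_smul]
  refine Finset.sum_eq_zero fun I _ => ?_
  have h := anticomm_oddProd_mul genE (dTheta α) (dTheta_e_mul α) I (1 : SuperAlg m n)
  rw [mul_one, dTheta_one, mul_zero, smul_zero] at h
  rw [h, smul_zero]

theorem dTheta_intMap_genEval_pureE (χ c : Matrix (Fin n) (Fin n) ℝ)
    (K : Matrix (Fin m) (Fin m) ℝ) (Q : ℕ) (x : EuclideanSpace ℝ (Fin m))
    (f : Finset (Fin m) → smoothFunctions U) (α : Fin n) :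
    dTheta α (intMap χ c K 0 (genEval Q x (pureE f : LocalForm n U))) = 0 := by
  rw [genEval_pureE]
  simp only [map_sum, map_smul, map_oddProd, intMap_e]
  refine Finset.sum_eq_zero fun I _ => ?_
  have h := anticomm_oddProd_mul (pieIm K 0) (dTheta α)
    (fun i u => by rw [dTheta_pieIm_mul]; simp [pixiIm]) I (1 : SuperAlg m n)
  rw [mul_one, dTheta_one, mul_zero, smul_zero] at h
  rw [h, smul_zero]

end TopForms

section GlobalMaps

variable {m n : ℕ} {M : Type*} [TopologicalSpace M] [ChartedSpace (EuclideanSpace ℝ (Fin m)) M]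
  [IsManifold (𝓡 m) ∞ M]
  {V : M → Type*} [TopologicalSpace (TotalSpace (EuclideanSpace ℝ (Fin n)) V)]
  [∀ x, AddCommGroup (V x)] [∀ x, Module ℝ (V x)] [∀ x, TopologicalSpace (V x)]
  [FiberBundle (EuclideanSpace ℝ (Fin n)) V] [VectorBundle ℝ (EuclideanSpace ℝ (Fin n)) V]

open SuperChart

variable {p : ℤ} {w σ : Family m n V} {a b : SuperChart m n V} {x : EuclideanSpace ℝ (Fin m)}

/-- The PCO map commutes with changes of coordinates: the Berezinian cancels the determinants by
which `θ^1 ⋯ θ^n` and `π∂_{x^m} ∧ ⋯ ∧ π∂_{x^1}` are multiplied. -/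
theorem ber_smul_intTrans_thetaTop_mul (hx : x ∈ overlap a b) (r : ℝ) (u : SuperAlg m n) :
    ber a b x • intTrans a b x (thetaTop * contraction u (r • eTop)) =
      thetaTop * contraction (formTrans a b x u) (r • eTop) := by
  rw [map_mul, intTrans, intMap_thetaTop, smul_mul_assoc, thetaTop_mul_intMap, smul_smul,
    ber_mul_det_chi hx, intMap_contraction _ _ (fun i => dchi a b i x) (jac_mul_jac' hx), map_smul,
    intMap_eTop, smul_comm r, map_smul, mul_smul_comm, smul_smul, ← Matrix.det_mul,
    jac_mul_jac' hx, Matrix.det_one, one_smul]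
  rfl

theorem pco_mem (hw : w ∈ superforms m n V p) : pco m n V w ∈ integralForms m n V p := by
  have h := (mem_superforms_iff (Q := p.toNat + (m - p).toNat) (by omega)).1 hw
  refine (mem_integralForms_iff (Q := p.toNat + (m - p).toNat) (by omega)).2
    ⟨fun a => (h.1 a).localPCO, fun a b x hx => ?_⟩
  change genEval _ x (localPCO (w a)) = _ • intTrans a b x (genEval _ _ (localPCO (w b)))
  rw [genEval_localPCO, genEval_localPCO, h.2 a b x hx, ber_smul_intTrans_thetaTop_mul hx]

/-- If the part of `σ` with top degree in `θ` and without `π∂_θ` is a global integral form, then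
the image of `σ` under the map `Z` is a global superform. -/
theorem quasiInv_mem_of_topE
    (hσ : (fun a => topE fun I => σ a Finset.univ I 0 : Family m n V) ∈ integralForms m n V p)
    (hd : ∀ a, HasDegree (m - p) (σ a)) : quasiInv m n V σ ∈ superforms m n V p := by
  have h := (mem_integralForms_iff (Q := p.toNat + (m - p).toNat) (by omega)).1 hσ
  refine (mem_superforms_iff (Q := p.toNat + (m - p).toNat) (by omega)).2
    ⟨fun a => ?_, fun a b x hx => ?_⟩
  · have h1 := (hd a).localZ
    rwa [show (m : ℤ) - (m - p) = p by ring] at h1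
  change genEval _ x (localZ (σ a)) = formTrans a b x (genEval _ _ (localZ (σ b)))
  have h1 := h.2 a b x hx
  rw [genEval_topE, genEval_topE, map_mul, intTrans, intMap_thetaTop, smul_mul_assoc,
    thetaTop_mul_intMap, smul_smul, ber_mul_det_chi hx, ← mul_smul_comm] at h1
  -- the factor `θ^1 ⋯ θ^n` cancels, so the contractions with `dx^1 ∧ ⋯ ∧ dx^m` can be compared
  have h2 := eq_of_thetaTop_mul_eq (dTheta_genEval_pureE _ _ _)
    (fun α => by rw [map_smul, dTheta_intMap_genEval_pureE, smul_zero]) h1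
  rw [genEval_localZ, genEval_localZ, h2, formTrans,
    ← body_contraction_eTop (genEval _ (phi a b x) _), formMap_body,
    formMap_zero_contraction (chi a b x) (chi b a (phi a b x)) (jac_mul_jac' hx), formMap_eTop,
    map_smul, map_smul, LinearMap.smul_apply]

end GlobalMaps

/-! ### Weights and cohomology -/

open Polynomial

section Homotopy

variable {W : Type*} [AddCommGroup W] [Module ℝ W]

theorem aeval_mem_of_forall_mem {S : Submodule ℝ W} {T : Module.End ℝ W}
    (hT : ∀ v ∈ S, T v ∈ S) (q : ℝ[X]) {v : W} (hv : v ∈ S) : aeval T q v ∈ S := by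
  have hpow : ∀ k : ℕ, (T ^ k) v ∈ S := by
    intro k
    induction k with
    | zero => simpa using hv
    | succ k ih =>
      rw [pow_succ', Module.End.mul_apply]
      exact hT _ ih
  induction q using Polynomial.induction_on' with
  | add p q hp hq =>
    rw [map_add, LinearMap.add_apply]
    exact S.add_mem hp hq
  | monomial k r =>
    rw [aeval_monomial, Module.End.mul_apply, Module.algebraMap_end_apply]
    exact S.smul_mem _ (hpow k)

/-- If `T = Dh + hD` is null-homotopic and a cocycle `w` is annihilated by a polynomial in `T` with
constant term `1`, then `w` is the coboundary of an element of degree `p - 1`. -/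
theorem exists_eq_of_aeval_eq_zero {C : ℤ → Submodule ℝ W} {D h T : Module.End ℝ W} {p : ℤ}
    (hD : ∀ v ∈ C (p - 1), D v ∈ C p) (hDD : ∀ v ∈ C (p - 1), D (D v) = 0)
    (hh : ∀ v ∈ C p, h v ∈ C (p - 1)) (hT : ∀ v ∈ C p, T v = D (h v) + h (D v))
    {q : ℝ[X]} (hq : q.eval 0 = 1) {w : W} (hw : w ∈ cocycles C D p) (hqw : aeval T q w = 0) :
    ∃ v ∈ C (p - 1), D v = w := by
  have key : ∀ v ∈ cocycles C D p, T v = D (h v) := by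
    intro v hv
    rw [hT v hv.1, LinearMap.mem_ker.1 hv.2, map_zero, add_zero]
  -- with `1 - q = X r` the cocycle is `w = T (r(T) w) = D (h (r(T) w))`
  obtain ⟨r, hr⟩ : X ∣ 1 - q := by
    rw [X_dvd_iff, coeff_zero_eq_eval_zero, eval_sub, hq, eval_one, sub_self]
  have h1 : aeval T r w ∈ cocycles C D p := by
    refine aeval_mem_of_forall_mem (fun v hv => ?_) r hw
    rw [key v hv]
    exact ⟨hD _ (hh v hv.1), LinearMap.mem_ker.2 (hDD _ (hh v hv.1))⟩
  refine ⟨h (aeval T r w), hh _ h1.1, ?_⟩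
  have h2 := congrArg (fun q => aeval T q w) hr
  simp only [map_sub, map_one, map_mul, aeval_X, LinearMap.sub_apply, hqw, sub_zero,
    Module.End.mul_apply, Module.End.one_apply] at h2
  rw [← key _ h1, ← h2]

/-- The polynomial `∏ (1 - X / k)` over `1 ≤ k ≤ L`, which vanishes at `1, …, L` and has the value
`1` at `0`. -/
def weightPoly (L : ℕ) : ℝ[X] := ∏ k ∈ Finset.range L, (1 - C ((k + 1 : ℝ)⁻¹) * X)

theorem weightPoly_eval_zero (L : ℕ) : (weightPoly L).eval 0 = 1 := by
  simp [weightPoly, eval_prod]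

theorem weightPoly_eval {L k : ℕ} (hk : k ≠ 0) (hkL : k ≤ L) : (weightPoly L).eval (k : ℝ) = 0 := by
  rw [weightPoly, eval_prod]
  refine Finset.prod_eq_zero (i := k - 1) (by simp; omega) ?_
  have h1 : ((k - 1 : ℕ) : ℝ) + 1 = k := by exact_mod_cast Nat.succ_pred_eq_of_ne_zero hk
  have h2 : (k : ℝ) ≠ 0 := Nat.cast_ne_zero.2 hk
  simp [h1, h2]

end Homotopy

section QuasiInverse

variable {W W' : Type*} [AddCommGroup W] [Module ℝ W] [AddCommGroup W'] [Module ℝ W']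

/-- Cochain maps that are inverse to each other up to coboundaries induce mutually inverse
isomorphisms in cohomology. -/
theorem exists_cohomology_equiv {C : ℤ → Submodule ℝ W} {D : W →ₗ[ℝ] W}
    {C' : ℤ → Submodule ℝ W'} {D' : W' →ₗ[ℝ] W'} {f : W →ₗ[ℝ] W'} {g : W' →ₗ[ℝ] W}
    (hf : ∀ p, ∀ w ∈ C p, f w ∈ C' p ∧ f (D w) = D' (f w))
    (hg : ∀ p, ∀ w ∈ C' p, g w ∈ C p ∧ g (D' w) = D (g w)) {p : ℤ}
    (hgf : ∀ w ∈ cocycles C D p, ∃ v ∈ C (p - 1), D v = w - g (f w))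
    (hfg : ∀ w ∈ cocycles C' D' p, ∃ v ∈ C' (p - 1), D' v = w - f (g w)) :
    ∃ (hf : ∀ w ∈ cocycles C D p, f w ∈ cocycles C' D' p)
      (hg : ∀ w ∈ cocycles C' D' p, g w ∈ cocycles C D p)
      (e : Cohomology C D p ≃ₗ[ℝ] Cohomology C' D' p),
      (∀ w, ∀ hw : w ∈ cocycles C D p,
        e (cohomologyClass C D p w hw) = cohomologyClass C' D' p (f w) (hf w hw)) ∧
      (∀ w, ∀ hw : w ∈ cocycles C' D' p,
        e.symm (cohomologyClass C' D' p w hw) = cohomologyClass C D p (g w) (hg w hw)) := by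
  have h1 : ∀ w ∈ cocycles C D p, f w ∈ cocycles C' D' p := fun w hw =>
    ⟨(hf p w hw.1).1, LinearMap.mem_ker.2 (by
      rw [← (hf p w hw.1).2, LinearMap.mem_ker.1 hw.2, map_zero])⟩
  have h2 : ∀ w ∈ cocycles C' D' p, g w ∈ cocycles C D p := fun w hw =>
    ⟨(hg p w hw.1).1, LinearMap.mem_ker.2 (by
      rw [← (hg p w hw.1).2, LinearMap.mem_ker.1 hw.2, map_zero])⟩
  have h3 : coboundaries C D p ≤ (coboundaries C' D' p).comap (f.restrict h1) := by
    rintro ⟨w, hw⟩ ⟨v, hv, hvw⟩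
    refine ⟨f v, (hf _ v hv).1, ?_⟩
    rw [← (hf _ v hv).2, hvw]
    rfl
  have h4 : coboundaries C' D' p ≤ (coboundaries C D p).comap (g.restrict h2) := by
    rintro ⟨w, hw⟩ ⟨v, hv, hvw⟩
    refine ⟨g v, (hg _ v hv).1, ?_⟩
    rw [← (hg _ v hv).2, hvw]
    rfl
  refine ⟨h1, h2, LinearEquiv.ofLinearMap (Submodule.mapQ _ _ (f.restrict h1) h3)
    (Submodule.mapQ _ _ (g.restrict h2) h4) ?_ ?_, fun w hw => rfl, fun w hw => rfl⟩
  · refine LinearMap.ext fun z => ?_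
    obtain ⟨⟨w, hw⟩, rfl⟩ := Submodule.Quotient.mk_surjective _ z
    refine ((Submodule.Quotient.eq _).2 ?_).symm
    exact hfg w hw
  · refine LinearMap.ext fun z => ?_
    obtain ⟨⟨w, hw⟩, rfl⟩ := Submodule.Quotient.mk_surjective _ z
    refine ((Submodule.Quotient.eq _).2 ?_).symm
    exact hgf w hw

end QuasiInverse

section Weights

variable {m n : ℕ} {M : Type*} [TopologicalSpace M] [ChartedSpace (EuclideanSpace ℝ (Fin m)) M]
  {V : M → Type*} [TopologicalSpace (TotalSpace (EuclideanSpace ℝ (Fin n)) V)]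
  [∀ x, TopologicalSpace (V x)]
  [FiberBundle (EuclideanSpace ℝ (Fin n)) V]

theorem quasiInv_delta (σ : Family m n V) :
    quasiInv m n V (delta m n V σ) = deRham m n V (quasiInv m n V σ) :=
  funext fun a => localZ_localDelta (σ a)

theorem pco_quasiInv_pco (w : Family m n V) :
    pco m n V (quasiInv m n V (pco m n V w)) = pco m n V w :=
  funext fun a => localPCO_localZ_localPCO (w a)

theorem quasiInv_pco_quasiInv (σ : Family m n V) :
    quasiInv m n V (pco m n V (quasiInv m n V σ)) = quasiInv m n V σ :=
  funext fun a => localZ_localPCO_localZ (σ a)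

variable (m V) in
/-- Multiplication of the terms with `θ^S` and `ξ^κ` by the weight `μ S κ`. -/
def weigh (μ : Finset (Fin n) → (Fin n → ℕ) → ℕ) : Module.End ℝ (Family m n V) where
  toFun w a S I κ := (μ S κ : ℝ) • w a S I κ
  map_add' w η := by
    funext a S I κ
    exact smul_add _ _ _
  map_smul' r w := by
    funext a S I κ
    exact smul_comm (μ S κ : ℝ) r (w a S I κ)

theorem aeval_weigh (μ : Finset (Fin n) → (Fin n → ℕ) → ℕ) (q : ℝ[X]) (w : Family m n V)
    (a : SuperChart m n V) (S : Finset (Fin n)) (I : Finset (Fin m)) (κ : Fin n → ℕ) :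
    aeval (weigh m V μ) q w a S I κ = q.eval (μ S κ : ℝ) • w a S I κ := by
  have hpow : ∀ k : ℕ, (weigh m V μ ^ k) w a S I κ = (μ S κ : ℝ) ^ k • w a S I κ := by
    intro k
    induction k with
    | zero => simp
    | succ k ih =>
      rw [pow_succ', Module.End.mul_apply, pow_succ', mul_smul, ← ih]
      rfl
  induction q using Polynomial.induction_on' with
  | add p q hp hq =>
    rw [map_add, LinearMap.add_apply, eval_add, add_smul, ← hp, ← hq]
    rfl
  | monomial k r =>
    rw [aeval_monomial, Module.End.mul_apply, Module.algebraMap_end_apply, eval_monomial, mul_smul,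
      ← hpow]
    rfl

/-- A polynomial in the weights gives the projection to the terms of weight `0`. -/
theorem aeval_weightPoly {μ : Finset (Fin n) → (Fin n → ℕ) → ℕ}
    (hμ : ∀ S κ, μ S κ ≤ n + ∑ α, κ α) {q : ℤ} {w : Family m n V} (hw : ∀ a, HasDegree q (w a)) :
    aeval (weigh m V μ) (weightPoly (n + q.toNat)) w =
      fun a S I κ => if μ S κ = 0 then w a S I κ else 0 := by
  funext a S I κ
  rw [aeval_weigh]
  split_ifs with h
  · rw [h, Nat.cast_zero, weightPoly_eval_zero, one_smul]
  · by_cases h1 : (I.card : ℤ) + ∑ α, (κ α : ℤ) = q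
    · have h2 := hμ S κ
      have h3 : ((∑ α, κ α : ℕ) : ℤ) = ∑ α, (κ α : ℤ) := Nat.cast_sum _ _
      rw [weightPoly_eval h (by omega), zero_smul]
    · rw [hw a S I κ h1, smul_zero]

/-- The weight of superforms, for which `f` and `Z` are concerned with the terms of weight `0`. -/
def formWeight (S : Finset (Fin n)) (κ : Fin n → ℕ) : ℕ := S.card + ∑ α, κ α

/-- The weight of integral forms, for which `f` and `Z` are concerned with the terms of
weight `0`. -/
def intWeight (S : Finset (Fin n)) (κ : Fin n → ℕ) : ℕ := (n - S.card) + ∑ α, κ α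

theorem card_le_rank (S : Finset (Fin n)) : S.card ≤ n := by
  simpa using S.card_le_univ

theorem formWeight_le (S : Finset (Fin n)) (κ : Fin n → ℕ) : formWeight S κ ≤ n + ∑ α, κ α :=
  Nat.add_le_add_right (card_le_rank S) _

theorem intWeight_le (S : Finset (Fin n)) (κ : Fin n → ℕ) : intWeight S κ ≤ n + ∑ α, κ α :=
  Nat.add_le_add_right (Nat.sub_le _ _) _

theorem sum_eq_zero_iff (κ : Fin n → ℕ) : ∑ α, κ α = 0 ↔ κ = 0 := by
  simp [Finset.sum_eq_zero_iff, funext_iff]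

theorem formWeight_eq_zero (S : Finset (Fin n)) (κ : Fin n → ℕ) :
    formWeight S κ = 0 ↔ S = ∅ ∧ κ = 0 := by
  rw [formWeight, Nat.add_eq_zero_iff, Finset.card_eq_zero, sum_eq_zero_iff]

theorem intWeight_eq_zero (S : Finset (Fin n)) (κ : Fin n → ℕ) :
    intWeight S κ = 0 ↔ S = Finset.univ ∧ κ = 0 := by
  rw [intWeight, Nat.add_eq_zero_iff, sum_eq_zero_iff, ← Finset.card_eq_iff_eq_univ,
    Fintype.card_fin]
  have := card_le_rank S
  refine and_congr_left fun _ => ?_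
  omega

variable [∀ x, AddCommGroup (V x)] [∀ x, Module ℝ (V x)]
  [VectorBundle ℝ (EuclideanSpace ℝ (Fin n)) V]
  {p : ℤ} {w σ : Family m n V}

theorem pco_deRham (hw : w ∈ superforms m n V p) :
    pco m n V (deRham m n V w) = delta m n V (pco m n V w) :=
  funext fun a => localPCO_localD (superforms_hasDegree hw a).expBounded

/-- `Z ∘ f` is a polynomial with constant term `1` in the weights. -/
theorem aeval_formWeight (hw : w ∈ superforms m n V p) :
    aeval (weigh m V formWeight) (weightPoly (n + p.toNat)) w =
      quasiInv m n V (pco m n V w) := by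
  rw [aeval_weightPoly formWeight_le (superforms_hasDegree hw)]
  funext a
  refine Eq.trans ?_ (localZ_localPCO (w a)).symm
  funext S I κ
  simp only [formWeight_eq_zero, pureE]
  split_ifs with h
  · rw [h.1, h.2]
  · rfl

/-- `f ∘ Z` is a polynomial with constant term `1` in the weights. -/
theorem aeval_intWeight (hσ : σ ∈ integralForms m n V p) :
    aeval (weigh m V intWeight) (weightPoly (n + ((m : ℤ) - p).toNat)) σ =
      pco m n V (quasiInv m n V σ) := by
  rw [aeval_weightPoly intWeight_le (integralForms_hasDegree hσ)]
  funext a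
  refine Eq.trans ?_ (localPCO_localZ (σ a)).symm
  funext S I κ
  simp only [intWeight_eq_zero, topE]
  split_ifs with h
  · rw [h.1, h.2]
  · rfl

/-- Cartan's formula for the Euler vector field, on global superforms. -/
theorem weigh_formWeight (hw : w ∈ superforms m n V p) :
    weigh m V formWeight w = deRham m n V (iota m n V w) + iota m n V (deRham m n V w) := by
  funext a S I κ
  refine Eq.trans ?_ (localD_localIota (superforms_hasDegree hw a).expBounded S I κ).symm
  change (formWeight S κ : ℝ) • w a S I κ = _
  rw [formWeight]
  push_cast
  rfl

/-- Cartan's formula for the Euler vector field, on global integral forms. -/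
theorem weigh_intWeight (hσ : σ ∈ integralForms m n V p) :
    weigh m V intWeight σ =
      delta m n V ((-euler m n V) σ) + (-euler m n V) (delta m n V σ) := by
  have h : delta m n V ((-euler m n V) σ) + (-euler m n V) (delta m n V σ) =
      -(delta m n V (euler m n V σ) + euler m n V (delta m n V σ)) := by
    rw [LinearMap.neg_apply, LinearMap.neg_apply, map_neg, neg_add]
  rw [h]
  funext a S I κ
  have h2 := localDelta_localEuler (integralForms_hasDegree hσ a).expBounded S I κ
  change (intWeight S κ : ℝ) • σ a S I κ = -((localDelta (localEuler (σ a)) +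
    localEuler (localDelta (σ a))) S I κ)
  rw [h2, intWeight]
  push_cast [card_le_rank S]
  module

theorem neg_euler_mem (hσ : σ ∈ integralForms m n V p) :
    (-euler m n V) σ ∈ integralForms m n V (p - 1) :=
  Submodule.neg_mem _ (euler_mem hσ)

end Weights

section Cohomology

variable {m n : ℕ} {M : Type*} [TopologicalSpace M] [ChartedSpace (EuclideanSpace ℝ (Fin m)) M]
  [IsManifold (𝓡 m) ∞ M]
  {V : M → Type*} [TopologicalSpace (TotalSpace (EuclideanSpace ℝ (Fin n)) V)]
  [∀ x, AddCommGroup (V x)] [∀ x, Module ℝ (V x)] [∀ x, TopologicalSpace (V x)]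
  [FiberBundle (EuclideanSpace ℝ (Fin n)) V] [VectorBundle ℝ (EuclideanSpace ℝ (Fin n)) V]
  [ContMDiffVectorBundle ∞ (EuclideanSpace ℝ (Fin n)) V (𝓡 m)]

variable {p : ℤ} {w σ : Family m n V}

theorem deRham_mem_of_sub_one (hw : w ∈ superforms m n V (p - 1)) :
    deRham m n V w ∈ superforms m n V p := by
  simpa using deRham_mem hw

theorem delta_mem_of_sub_one (hσ : σ ∈ integralForms m n V (p - 1)) :
    delta m n V σ ∈ integralForms m n V p := by
  simpa using delta_mem hσ

theorem weigh_intWeight_mem (hσ : σ ∈ integralForms m n V p) :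
    weigh m V intWeight σ ∈ integralForms m n V p := by
  rw [weigh_intWeight hσ]
  refine Submodule.add_mem _ (delta_mem_of_sub_one (neg_euler_mem hσ)) ?_
  simpa using neg_euler_mem (delta_mem hσ)

/-- The projection of integral forms to the terms of weight `0` is compatible with changes of
coordinates, as it is a polynomial in `δP + Pδ`, where `P` is the product with the Euler vector
field. -/
theorem pco_quasiInv_mem (hσ : σ ∈ integralForms m n V p) :
    pco m n V (quasiInv m n V σ) ∈ integralForms m n V p := by
  rw [← aeval_intWeight hσ]
  exact aeval_mem_of_forall_mem (fun _ hv => weigh_intWeight_mem hv) _ hσ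

/-- The map `Z` is compatible with changes of coordinates. It only sees the projection of an
integral form to the terms of weight `0`, and that projection is a global integral form. -/
theorem quasiInv_mem (hσ : σ ∈ integralForms m n V p) :
    quasiInv m n V σ ∈ superforms m n V p := by
  refine quasiInv_mem_of_topE ?_ (integralForms_hasDegree hσ)
  have h := pco_quasiInv_mem hσ
  rwa [show pco m n V (quasiInv m n V σ) = fun a => topE fun I => σ a Finset.univ I 0 from
    funext fun a => localPCO_localZ (σ a)] at h

theorem exists_deRham_eq_sub (hw : w ∈ cocycles (superforms m n V) (deRham m n V) p) :
    ∃ v ∈ superforms m n V (p - 1), deRham m n V v = w - quasiInv m n V (pco m n V w) := by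
  have h1 : quasiInv m n V (pco m n V w) ∈ superforms m n V p := quasiInv_mem (pco_mem hw.1)
  have h2 : quasiInv m n V (pco m n V w) ∈ LinearMap.ker (deRham m n V) := by
    rw [LinearMap.mem_ker, ← quasiInv_delta, ← pco_deRham hw.1, LinearMap.mem_ker.1 hw.2,
      map_zero, map_zero]
  refine exists_eq_of_aeval_eq_zero (h := iota m n V) (T := weigh m V formWeight)
    (fun v => deRham_mem_of_sub_one) (fun v => deRham_deRham) (fun v => iota_mem)
    (fun v => weigh_formWeight) (weightPoly_eval_zero (n + p.toNat))
    (Submodule.sub_mem _ hw ⟨h1, h2⟩) ?_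
  rw [map_sub, aeval_formWeight hw.1, aeval_formWeight h1, pco_quasiInv_pco, sub_self]

theorem exists_delta_eq_sub (hσ : σ ∈ cocycles (integralForms m n V) (delta m n V) p) :
    ∃ v ∈ integralForms m n V (p - 1), delta m n V v = σ - pco m n V (quasiInv m n V σ) := by
  have h1 : pco m n V (quasiInv m n V σ) ∈ integralForms m n V p := pco_quasiInv_mem hσ.1
  have h2 : pco m n V (quasiInv m n V σ) ∈ LinearMap.ker (delta m n V) := by
    rw [LinearMap.mem_ker, ← pco_deRham (quasiInv_mem hσ.1), ← quasiInv_delta,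
      LinearMap.mem_ker.1 hσ.2, map_zero, map_zero]
  refine exists_eq_of_aeval_eq_zero (h := -euler m n V) (T := weigh m V intWeight)
    (fun v => delta_mem_of_sub_one) (fun v => delta_delta) (fun v => neg_euler_mem)
    (fun v => weigh_intWeight) (weightPoly_eval_zero (n + ((m : ℤ) - p).toNat))
    (Submodule.sub_mem _ hσ ⟨h1, h2⟩) ?_
  rw [map_sub, aeval_intWeight hσ.1, aeval_intWeight h1, quasiInv_pco_quasiInv, sub_self]

end Cohomology

end PictureChanging

end

theorem mainTheorem2 (m n : ℕ)
    {M : Type*} [TopologicalSpace M] [ChartedSpace (EuclideanSpace ℝ (Fin m)) M]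
    [IsManifold (𝓡 m) ∞ M]
    (V : M → Type*) [TopologicalSpace (TotalSpace (EuclideanSpace ℝ (Fin n)) V)]
    [∀ x, AddCommGroup (V x)] [∀ x, Module ℝ (V x)] [∀ x, TopologicalSpace (V x)]
    [FiberBundle (EuclideanSpace ℝ (Fin n)) V] [VectorBundle ℝ (EuclideanSpace ℝ (Fin n)) V]
    [ContMDiffVectorBundle ∞ (EuclideanSpace ℝ (Fin n)) V (𝓡 m)] :
    -- superforms and integral forms are cochain complexes
    (∀ p : ℤ, ∀ w ∈ superforms m n V p, deRham m n V w ∈ superforms m n V (p + 1) ∧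
      deRham m n V (deRham m n V w) = 0) ∧
    (∀ p : ℤ, ∀ σ ∈ integralForms m n V p, delta m n V σ ∈ integralForms m n V (p + 1) ∧
      delta m n V (delta m n V σ) = 0) ∧
    -- `f` and `Z` are well defined cochain maps, zero outside of the degrees `0, …, m`
    (∀ p : ℤ, ∀ w ∈ superforms m n V p, pco m n V w ∈ integralForms m n V p ∧
      pco m n V (deRham m n V w) = delta m n V (pco m n V w) ∧
      (p < 0 ∨ m < p → pco m n V w = 0)) ∧
    (∀ p : ℤ, ∀ σ ∈ integralForms m n V p, quasiInv m n V σ ∈ superforms m n V p ∧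
      quasiInv m n V (delta m n V σ) = deRham m n V (quasiInv m n V σ) ∧
      (p < 0 ∨ m < p → quasiInv m n V σ = 0)) ∧
    -- the quasi-inverse identities
    (∀ p : ℤ, ∀ w ∈ superforms m n V p,
      pco m n V (quasiInv m n V (pco m n V w)) = pco m n V w) ∧
    (∀ p : ℤ, ∀ σ ∈ integralForms m n V p,
      quasiInv m n V (pco m n V (quasiInv m n V σ)) = quasiInv m n V σ) ∧
    -- `f` and `Z` induce mutually inverse isomorphisms in cohomology
    (∀ p : ℤ,
      ∃ (hf : ∀ w ∈ cocycles (superforms m n V) (deRham m n V) p,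
          pco m n V w ∈ cocycles (integralForms m n V) (delta m n V) p)
        (hZ : ∀ σ ∈ cocycles (integralForms m n V) (delta m n V) p,
          quasiInv m n V σ ∈ cocycles (superforms m n V) (deRham m n V) p)
        (e : Cohomology (superforms m n V) (deRham m n V) p ≃ₗ[ℝ]
          Cohomology (integralForms m n V) (delta m n V) p),
        (∀ w, ∀ hw : w ∈ cocycles (superforms m n V) (deRham m n V) p,
          e (cohomologyClass _ _ p w hw) =
            cohomologyClass _ _ p (pco m n V w) (hf w hw)) ∧
        (∀ σ, ∀ hσ : σ ∈ cocycles (integralForms m n V) (delta m n V) p,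
          e.symm (cohomologyClass _ _ p σ hσ) =
            cohomologyClass _ _ p (quasiInv m n V σ) (hZ σ hσ))) := by
  refine ⟨fun p w hw => ⟨deRham_mem hw, deRham_deRham hw⟩,
    fun p σ hσ => ⟨delta_mem hσ, delta_delta hσ⟩,
    fun p w hw => ⟨pco_mem hw, pco_deRham hw, fun hp => funext fun a =>
      (superforms_hasDegree hw a).localPCO_eq_zero hp⟩,
    fun p σ hσ => ⟨quasiInv_mem hσ, quasiInv_delta σ, fun hp => funext fun a =>
      (integralForms_hasDegree hσ a).localZ_eq_zero (by omega)⟩,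
    fun p w _ => pco_quasiInv_pco w, fun p σ _ => quasiInv_pco_quasiInv σ, fun p => ?_⟩
  exact exists_cohomology_equiv (fun p w hw => ⟨pco_mem hw, pco_deRham hw⟩)
    (fun p σ hσ => ⟨quasiInv_mem hσ, quasiInv_delta σ⟩)
    (fun w hw => exists_deRham_eq_sub hw) (fun σ hσ => exists_delta_eq_sub hσ)
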